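/- Let $X$ be a complex manifold (Hausdorff and $\sigma$-compact, e.g. compact Kähler), and let $(\mathcal E,\theta)$ be a Higgs bundle on $X$: a holomorphic vector bundle $\mathcal E$ of finite rank with underlying smooth bundle $E$ and operator $\overline\partial_E$, together with a holomorphic 1-form $\theta\in H^0(X,\operatorname{End}(\mathcal E)\otimes\Omega^1)$ such that $\theta\wedge\theta=0$. Let $A^k(X,E)$ be the space of smooth complex $k$-forms on $X$ with values in $E$, let $D''=\overline\partial_E+\theta$, and let $H^i_{Dol}(E)$ be the $i$-th cohomology of the complex $(A^\bullet(X,E),D'')$. Let $H^j(\mathcal E\otimes\Omega^p)$ denote the sheaf cohomology on $X$ of the sheaf of holomorphic $p$-forms with values in $\mathcal E$. If $\theta=0$, then for every $i\ge 0$ there is an isomorphism of complex vector spaces $$H^i_{Dol}(E)\;\cong\;\bigoplus_{j=0}^{i}H^j(\mathcal E\otimes\Omega^{i-j}),$$ natural with respect to morphisms of Higgs bundles (with vanishing Higgs fields) on $X$, under which the classes of closed forms of type $(i-j,j)$ lie in the summand $H^j(\mathcal E\otimes\Omega^{i-j})$. In particular, suppose that $(\mathcal E,\theta)$ is the Higgs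 bundle associated to a flat bundle $(E,D)$ with unitary $D$; that is, $D$ is flat and preserves a smooth Hermitian metric $h$ on $E$, and $D=\nabla+\theta+\theta^*$, where $\nabla$ is an $h$-unitary connection with $(0,1)$-part $\overline\partial_E$ and $\theta^*$ is the $h$-adjoint of $\theta$. Then $\theta=0$, and the above isomorphism for $i=1$ reads $$H^1_{Dol}(E)\;\cong\;H^1(\mathcal E)\oplus H^0(\mathcal E\otimes\Omega^1).$$ -/

import Mathlib

open Bundle Topology
open scoped Manifold ContDiff

universe u

set_option linter.unusedSectionVars false

noncomputable section

section Flat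

variable {V W : Type*} [NormedAddCommGroup V] [NormedSpace ℂ V]
  [NormedAddCommGroup W] [NormedSpace ℂ W]

/-- The complex antilinear part `v ↦ (L v + i L (i v)) / 2` of a real linear map `L`. -/
def antilinearPart (L : V →L[ℝ] W) : V →L[ℝ] W :=
  (1 / 2 : ℂ) • (L + Complex.I • L.comp (Complex.I • ContinuousLinearMap.id ℝ V))

lemma antilinearPart_apply (L : V →L[ℝ] W) (v : V) :
    antilinearPart L v = (1 / 2 : ℂ) • (L v + Complex.I • L (Complex.I • v)) := rfl

/-- The operator `∂̄` on `W`-valued `k`-forms on (an open subset of) `V`. As the exterior derivative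
`d` is the alternatization of the derivative `dω : V → Alt^k(V, W)`, the operator `∂̄`, which
differentiates the coefficients with respect to the conjugate variables only, is the
alternatization of the antilinear part of that derivative. -/
def dbarFlat {k : ℕ} (η : V → V [⋀^Fin k]→L[ℝ] W) (z : V) : V [⋀^Fin (k + 1)]→L[ℝ] W :=
  ContinuousAlternatingMap.alternatizeUncurryFin (antilinearPart (fderiv ℝ η z))

lemma antilinearPart_add (L M : V →L[ℝ] W) :
    antilinearPart (L + M) = antilinearPart L + antilinearPart M := by
  ext v
  simp only [antilinearPart_apply, _root_.add_apply, smul_add]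
  abel

lemma antilinearPart_smul (c : ℂ) (L : V →L[ℝ] W) :
    antilinearPart (c • L) = c • antilinearPart L := by
  ext v
  simp only [antilinearPart_apply, _root_.smul_apply, smul_add, smul_smul]
  congr 2 <;> ring

lemma alternatizeUncurryFin_smul_complex {k : ℕ} (c : ℂ) (L : V →L[ℝ] V [⋀^Fin k]→L[ℝ] W) :
    ContinuousAlternatingMap.alternatizeUncurryFin (c • L)
      = c • ContinuousAlternatingMap.alternatizeUncurryFin L := by
  ext v
  simp only [ContinuousAlternatingMap.alternatizeUncurryFin_apply, Finset.smul_sum,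
    ContinuousAlternatingMap.smul_apply, _root_.smul_apply]
  exact Finset.sum_congr rfl fun i _ => smul_comm _ _ _

lemma alternatizeUncurryFin_comp {W' : Type*} [NormedAddCommGroup W'] [NormedSpace ℂ W'] {k : ℕ}
    (P : W →L[ℂ] W') (L : V →L[ℝ] V [⋀^Fin k]→L[ℝ] W) (L' : V →L[ℝ] V [⋀^Fin k]→L[ℝ] W')
    (h : ∀ v m, L' v m = P (L v m)) (m : Fin (k + 1) → V) :
    ContinuousAlternatingMap.alternatizeUncurryFin L' m
      = P (ContinuousAlternatingMap.alternatizeUncurryFin L m) := by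
  simp [ContinuousAlternatingMap.alternatizeUncurryFin_apply, h, map_sum]

/-- Composition with a complex linear map, as a bilinear operation. -/
def compBilin (V W W' : Type*) [NormedAddCommGroup V] [NormedSpace ℂ V]
    [NormedAddCommGroup W] [NormedSpace ℂ W] [NormedAddCommGroup W'] [NormedSpace ℂ W'] (k : ℕ) :
    (W →L[ℂ] W') →L[ℂ] (V [⋀^Fin k]→L[ℝ] W) →L[ℂ] (V [⋀^Fin k]→L[ℝ] W') :=
  LinearMap.mkContinuous₂
    (LinearMap.mk₂ ℂ (fun P η => (P.restrictScalars ℝ).compContinuousAlternatingMap η)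
      (fun _ _ _ => by ext; simp) (fun _ _ _ => by ext; simp) (fun _ _ _ => by ext; simp)
      (fun _ _ _ => by ext; simp)) 1
    (fun P η => by
      simpa using ContinuousLinearMap.norm_compContinuousAlternatingMap_le
        (P.restrictScalars ℝ) η)

lemma compBilin_apply {W' : Type*} [NormedAddCommGroup W'] [NormedSpace ℂ W'] {k : ℕ}
    (P : W →L[ℂ] W') (η : V [⋀^Fin k]→L[ℝ] W) :
    compBilin V W W' k P η = (P.restrictScalars ℝ).compContinuousAlternatingMap η := rfl

lemma isBoundedBilinearMap_compBilin (V W W' : Type*) [NormedAddCommGroup V] [NormedSpace ℂ V]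
    [NormedAddCommGroup W] [NormedSpace ℂ W] [NormedAddCommGroup W'] [NormedSpace ℂ W'] (k : ℕ) :
    IsBoundedBilinearMap ℝ fun p : (W →L[ℂ] W') × (V [⋀^Fin k]→L[ℝ] W) =>
      compBilin V W W' k p.1 p.2 where
  add_left P Q η := by simp only [compBilin_apply]; ext; simp
  add_right P η η' := by simp only [compBilin_apply]; ext; simp
  smul_left c P η := by simp only [compBilin_apply]; ext; simp
  smul_right c P η := by simp only [compBilin_apply]; ext; simp
  bound := (compBilin V W W' k).isBoundedBilinearMap.bound

end Flat

variable (V X : Type u) [NormedAddCommGroup V] [NormedSpace ℂ V]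
  [TopologicalSpace X] [ChartedSpace V X]

/-- A holomorphic vector bundle of finite rank, with fibres `E x` and model fibre `F`, over the
complex manifold `X`, which is modelled on the complex vector space `V`. -/
structure HolomorphicVectorBundle where
  F : Type u
  E : X → Type u
  [normedAddCommGroup : NormedAddCommGroup F]
  [normedSpace : NormedSpace ℂ F]
  [finiteDimensional : FiniteDimensional ℂ F]
  [fibreTopology : ∀ x, TopologicalSpace (E x)]
  [fibreAddCommGroup : ∀ x, AddCommGroup (E x)]
  [fibreModule : ∀ x, Module ℂ (E x)]
  [totalTopology : TopologicalSpace (TotalSpace F E)]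
  [fiberBundle : FiberBundle F E]
  [vectorBundle : VectorBundle ℂ F E]
  [holomorphic : ContMDiffVectorBundle ω F E 𝓘(ℂ, V)]

attribute [instance] HolomorphicVectorBundle.normedAddCommGroup
  HolomorphicVectorBundle.normedSpace HolomorphicVectorBundle.finiteDimensional
  HolomorphicVectorBundle.fibreTopology HolomorphicVectorBundle.fibreAddCommGroup
  HolomorphicVectorBundle.fibreModule HolomorphicVectorBundle.totalTopology
  HolomorphicVectorBundle.fiberBundle HolomorphicVectorBundle.vectorBundle
  HolomorphicVectorBundle.holomorphic

variable {V X}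

namespace HolomorphicVectorBundle

section Basic

variable (𝓔 : HolomorphicVectorBundle V X)

/-- The identification of the fibre at `x` with the model fibre that is given by the preferred
local trivialization at `x`. -/
def fibreIso (x : X) : 𝓔.E x ≃L[ℂ] 𝓔.F :=
  (trivializationAt 𝓔.F 𝓔.E x).continuousLinearEquivAt ℂ x
    (mem_baseSet_trivializationAt 𝓔.F 𝓔.E x)

instance (x : X) : IsTopologicalAddGroup (𝓔.E x) :=
  (𝓔.fibreIso x).toHomeomorph.isInducing.topologicalAddGroup (𝓔.fibreIso x)

instance (x : X) : ContinuousSMul ℂ (𝓔.E x) :=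
  (𝓔.fibreIso x).toHomeomorph.isInducing.continuousSMul continuous_id (by simp)

/-- (Not necessarily continuous) `E`-valued complex differential `k`-forms on `X`. Recall that in
Mathlib the tangent space of `X` at `x` is `V` by definition, through the preferred chart
`chartAt V x` at `x`. -/
abbrev Form (k : ℕ) : Type u := ∀ x : X, V [⋀^Fin k]→L[ℝ] 𝓔.E x

instance (k : ℕ) : AddCommGroup (𝓔.Form k) := Pi.addCommGroup

instance (k : ℕ) : Module ℂ (𝓔.Form k) := Pi.module _ _ _

end Basic

variable [IsManifold 𝓘(ℂ, V) ω X] (𝓔 : HolomorphicVectorBundle V X)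

/-- The expression of an `E`-valued `k`-form in the chart and the local trivialization at `x₀`,
as an `F`-valued form on an open subset of `V`; here `tangentCoordChange _ x₀ y y` is the
derivative at `y` of the change of coordinates from the chart at `x₀` to the chart at `y`.
Only its germ at the point `chartAt V x₀ x₀` matters. -/
def localRep {k : ℕ} (η : 𝓔.Form k) (x₀ : X) (z : V) : V [⋀^Fin k]→L[ℝ] 𝓔.F :=
  let y := (chartAt V x₀).symm z
  (((trivializationAt 𝓔.F 𝓔.E x₀).continuousLinearMapAt ℂ y).restrictScalars
    ℝ).compContinuousAlternatingMap
      ((η y).compContinuousLinearMap ((tangentCoordChange 𝓘(ℂ, V) x₀ y y).restrictScalars ℝ))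

lemma localRep_apply {k : ℕ} (η : 𝓔.Form k) (x₀ : X) (z : V) (m : Fin k → V) :
    𝓔.localRep η x₀ z m =
      (trivializationAt 𝓔.F 𝓔.E x₀).continuousLinearMapAt ℂ ((chartAt V x₀).symm z)
        (η ((chartAt V x₀).symm z) fun i =>
          tangentCoordChange 𝓘(ℂ, V) x₀ ((chartAt V x₀).symm z) ((chartAt V x₀).symm z) (m i)) :=
  rfl

lemma localRep_add {k : ℕ} (η η' : 𝓔.Form k) (x₀ : X) :
    𝓔.localRep (η + η') x₀ = 𝓔.localRep η x₀ + 𝓔.localRep η' x₀ := by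
  ext z m
  simp [localRep_apply]

lemma localRep_smul {k : ℕ} (c : ℂ) (η : 𝓔.Form k) (x₀ : X) :
    𝓔.localRep (c • η) x₀ = c • 𝓔.localRep η x₀ := by
  ext z m
  simp [localRep_apply]

lemma localRep_zero {k : ℕ} (x₀ : X) :
    𝓔.localRep (0 : 𝓔.Form k) x₀ = 0 := by
  ext z m
  simp [localRep_apply]

/-- Smoothness of a form (in the real sense). -/
def IsSmooth {k : ℕ} (η : 𝓔.Form k) : Prop :=
  ∀ x₀ : X, ContDiffAt ℝ ∞ (𝓔.localRep η x₀) (chartAt V x₀ x₀)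

/-- The space `A^k(X, E)` of smooth `E`-valued complex `k`-forms on `X`. -/
def A (k : ℕ) : Submodule ℂ (𝓔.Form k) where
  carrier := {η | 𝓔.IsSmooth η}
  add_mem' {a b} ha hb x₀ := by
    rw [localRep_add]
    exact (ha x₀).add (hb x₀)
  zero_mem' x₀ := by
    rw [localRep_zero]
    exact contDiffAt_const
  smul_mem' c a ha x₀ := by
    rw [localRep_smul]
    exact (ha x₀).const_smul c

instance (k : ℕ) : AddCommGroup (𝓔.A k) := Submodule.addCommGroup _

instance (k : ℕ) : Module ℂ (𝓔.A k) := Submodule.module _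

/-- The operator `∂̄_E` of the holomorphic vector bundle: in a local holomorphic trivialization and
in local holomorphic coordinates it is the operator `∂̄` on vector valued forms. At the point `x`
we use the chart and the trivialization at `x`. -/
def dbar {k : ℕ} (η : 𝓔.Form k) : 𝓔.Form (k + 1) := fun x =>
  ((𝓔.fibreIso x).symm.toContinuousLinearMap.restrictScalars ℝ).compContinuousAlternatingMap
    (dbarFlat (𝓔.localRep η x) (chartAt V x x))

/-- The local expression of a family of linear maps between the fibres of two bundles. -/
def homRep {𝓔 𝓔' : HolomorphicVectorBundle V X} (φ : ∀ x, 𝓔.E x →L[ℂ] 𝓔'.E x)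
    (x₀ : X) (z : V) : 𝓔.F →L[ℂ] 𝓔'.F :=
  let y := (chartAt V x₀).symm z
  (trivializationAt 𝓔'.F 𝓔'.E x₀).continuousLinearMapAt ℂ y ∘L φ y ∘L
    (trivializationAt 𝓔.F 𝓔.E x₀).symmL ℂ y

lemma homRep_apply {𝓔 𝓔' : HolomorphicVectorBundle V X} (φ : ∀ x, 𝓔.E x →L[ℂ] 𝓔'.E x)
    (x₀ : X) (z : V) (w : 𝓔.F) :
    homRep φ x₀ z w =
      (trivializationAt 𝓔'.F 𝓔'.E x₀).continuousLinearMapAt ℂ ((chartAt V x₀).symm z)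
        (φ ((chartAt V x₀).symm z)
          ((trivializationAt 𝓔.F 𝓔.E x₀).symmL ℂ ((chartAt V x₀).symm z) w)) :=
  rfl

/-! ### Sheaf cohomology of `𝓔 ⊗ Ω^p` -/

/-- Holomorphic sections of `𝓔 ⊗ Ω^p` over an open set `U` are the `E`-valued holomorphic
`p`-forms on `U`; for such a form this is its extension by zero to `X`, viewed as a form. -/
def extendZero {p : ℕ} {U : Set X} (s : ∀ x : U, V [⋀^Fin p]→L[ℂ] 𝓔.E x) : 𝓔.Form p :=
  open Classical in
  fun x => if hx : x ∈ U then (s ⟨x, hx⟩).restrictScalars ℝ else 0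

/-- The `E`-valued complex multilinear `p`-form `s` on the open set `U` is holomorphic, i.e. its
local expressions are. -/
def IsHolomorphic {p : ℕ} {U : Set X} (s : ∀ x : U, V [⋀^Fin p]→L[ℂ] 𝓔.E x) : Prop :=
  ∀ x₀ ∈ U, AnalyticAt ℂ (𝓔.localRep (𝓔.extendZero s) x₀) (chartAt V x₀ x₀)

/-- The local expression at `x₀` depends only on the germ at `x₀` of the form. -/
lemma localRep_congr {k : ℕ} {η η' : 𝓔.Form k} {x₀ : X} (h : ∀ᶠ y in 𝓝 x₀, η y = η' y) :
    𝓔.localRep η x₀ =ᶠ[𝓝 (chartAt V x₀ x₀)] 𝓔.localRep η' x₀ := by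
  have hc := (chartAt V x₀).continuousAt_symm (mem_chart_target V x₀)
  rw [ContinuousAt, (chartAt V x₀).left_inv (mem_chart_source V x₀)] at hc
  filter_upwards [hc.eventually h] with z hz
  simp only [localRep, hz]

lemma extendZero_congr {p : ℕ} {U U' : Set X} (hU : IsOpen U) {x₀ : X} (hx₀ : x₀ ∈ U)
    (hUU' : U ⊆ U') (s : ∀ x : U', V [⋀^Fin p]→L[ℂ] 𝓔.E x) :
    𝓔.localRep (𝓔.extendZero fun x : U => s ⟨x, hUU' x.2⟩) x₀
      =ᶠ[𝓝 (chartAt V x₀ x₀)] 𝓔.localRep (𝓔.extendZero s) x₀ := by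
  apply localRep_congr
  filter_upwards [hU.mem_nhds hx₀] with y hy
  simp [extendZero, hy, hUU' hy]

/-- Holomorphy as a local condition. -/
def holomorphicLocalPredicate (p : ℕ) :
    TopCat.LocalPredicate (X := TopCat.of X) fun x => V [⋀^Fin p]→L[ℂ] 𝓔.E x where
  pred {U} s := 𝓔.IsHolomorphic (U := (U : Set X)) s
  res {U _} i s hs x₀ hx₀ :=
    (hs x₀ (i.le hx₀)).congr (𝓔.extendZero_congr U.isOpen hx₀ i.le s).symm
  locality {U} s hs x₀ hx₀ := by
    obtain ⟨U', hx', i, h⟩ := hs ⟨x₀, hx₀⟩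
    exact (h x₀ hx').congr (𝓔.extendZero_congr U'.isOpen hx' i.le s)

/-- The space of holomorphic sections of `𝓔 ⊗ Ω^p` over `U`. -/
def holomorphicForms (p : ℕ) (U : Set X) : Submodule ℂ (∀ x : U, V [⋀^Fin p]→L[ℂ] 𝓔.E x) where
  carrier := {s | 𝓔.IsHolomorphic s}
  add_mem' {s t} hs ht x₀ hx₀ := by
    have : 𝓔.extendZero (s + t) = 𝓔.extendZero s + 𝓔.extendZero t := by
      ext x m
      by_cases hx : x ∈ U <;> simp [extendZero, hx]
    rw [this, localRep_add]
    exact (hs x₀ hx₀).add (ht x₀ hx₀)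
  zero_mem' x₀ _ := by
    have : 𝓔.extendZero (0 : ∀ x : U, V [⋀^Fin p]→L[ℂ] 𝓔.E x) = 0 := by
      ext x m
      by_cases hx : x ∈ U <;> simp [extendZero, hx]
    rw [this, localRep_zero]
    exact analyticAt_const
  smul_mem' c s hs x₀ hx₀ := by
    have : 𝓔.extendZero (c • s) = c • 𝓔.extendZero s := by
      ext x m
      by_cases hx : x ∈ U <;> simp [extendZero, hx]
    rw [this, localRep_smul]
    exact analyticAt_const.smul (hs x₀ hx₀)

open CategoryTheory Opposite TopologicalSpace in
/-- The presheaf of abelian groups of holomorphic sections of `𝓔 ⊗ Ω^p`. -/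
def omegaPresheaf (p : ℕ) : TopCat.Presheaf AddCommGrpCat.{u} (TopCat.of X) where
  obj U := AddCommGrpCat.of (𝓔.holomorphicForms p ((unop U : Opens (TopCat.of X)) : Set X))
  map i := AddCommGrpCat.ofHom
    { toFun s := ⟨fun x => s.1 ⟨x, i.unop.le x.2⟩,
        (𝓔.holomorphicLocalPredicate p).res i.unop s.1 s.2⟩
      map_zero' := rfl
      map_add' _ _ := rfl }
  map_id _ := rfl
  map_comp _ _ := rfl

/-- The sheaf `𝓔 ⊗ Ω^p` of abelian groups on `X`. -/
def omegaSheaf (p : ℕ) :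
    CategoryTheory.Sheaf (Opens.grothendieckTopology (TopCat.of X)) AddCommGrpCat.{u} where
  obj := 𝓔.omegaPresheaf p
  property := by
    rw [CategoryTheory.Presheaf.isSheaf_iff_isSheaf_forget _ _
      (CategoryTheory.forget AddCommGrpCat)]
    exact (TopCat.subsheafToTypes (𝓔.holomorphicLocalPredicate p)).property

/-- A morphism of holomorphic vector bundles. -/
structure Hom (𝓔 𝓔' : HolomorphicVectorBundle V X) where
  map : ∀ x, 𝓔.E x →L[ℂ] 𝓔'.E x
  analyticAt : ∀ x₀, AnalyticAt ℂ (homRep map x₀) (chartAt V x₀ x₀)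

section Functoriality

variable {𝓔} {𝓔' : HolomorphicVectorBundle V X} (φ : Hom 𝓔 𝓔')

/-- The map `φ ⊗ id` on `E`-valued forms. -/
def Hom.form (k : ℕ) : 𝓔.Form k →ₗ[ℂ] 𝓔'.Form k where
  toFun η x := ((φ.map x).restrictScalars ℝ).compContinuousAlternatingMap (η x)
  map_add' _ _ := by ext; simp
  map_smul' _ _ := by ext; simp

lemma Hom.form_apply {k : ℕ} (η : 𝓔.Form k) (x : X) (m : Fin k → V) :
    φ.form k η x m = φ.map x (η x m) := rfl

lemma Hom.localRep_form {k : ℕ} (η : 𝓔.Form k) (x₀ : X) :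
    𝓔'.localRep (φ.form k η) x₀ =ᶠ[𝓝 (chartAt V x₀ x₀)] fun z =>
      ((homRep φ.map x₀ z).restrictScalars ℝ).compContinuousAlternatingMap
        (𝓔.localRep η x₀ z) := by
  have hc := (chartAt V x₀).continuousAt_symm (mem_chart_target V x₀)
  rw [ContinuousAt, (chartAt V x₀).left_inv (mem_chart_source V x₀)] at hc
  have hb := (trivializationAt 𝓔.F 𝓔.E x₀).open_baseSet.mem_nhds
    (mem_baseSet_trivializationAt 𝓔.F 𝓔.E x₀)
  filter_upwards [hc.eventually hb] with z hz
  ext m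
  simp only [localRep_apply, form_apply, homRep_apply,
    ContinuousLinearMap.compContinuousAlternatingMap_coe, Function.comp_apply,
    ContinuousLinearMap.coe_restrictScalars']
  rw [Trivialization.symmL_continuousLinearMapAt _ hz]

lemma Hom.analyticAt_localRep {k : ℕ} {η : 𝓔.Form k} {x₀ : X}
    (h : AnalyticAt ℂ (𝓔.localRep η x₀) (chartAt V x₀ x₀)) :
    AnalyticAt ℂ (𝓔'.localRep (φ.form k η) x₀) (chartAt V x₀ x₀) := by
  refine AnalyticAt.congr ?_ (φ.localRep_form η x₀).symm
  exact ((compBilin V 𝓔.F 𝓔'.F k).analyticAt_bilinear _).comp₂ (φ.analyticAt x₀) h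

lemma Hom.isSmooth_form {k : ℕ} {η : 𝓔.Form k} (h : 𝓔.IsSmooth η) :
    𝓔'.IsSmooth (φ.form k η) := by
  intro x₀
  refine ContDiffAt.congr_of_eventuallyEq ?_ (φ.localRep_form η x₀)
  exact (isBoundedBilinearMap_compBilin V 𝓔.F 𝓔'.F k).contDiff.contDiffAt.comp _
    (((φ.analyticAt x₀).restrictScalars (𝕜 := ℝ)).contDiffAt.prodMk (h x₀))

lemma Hom.homRep_self (x : X) (w : 𝓔.F) :
    homRep φ.map x (chartAt V x x) w = 𝓔'.fibreIso x (φ.map x ((𝓔.fibreIso x).symm w)) := by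
  rw [homRep_apply, (chartAt V x).left_inv (mem_chart_source V x)]
  rw [fibreIso, fibreIso, ← Trivialization.symm_continuousLinearEquivAt_eq _
      (mem_baseSet_trivializationAt 𝓔.F 𝓔.E x),
    ← Trivialization.coe_continuousLinearEquivAt_eq _
      (mem_baseSet_trivializationAt 𝓔'.F 𝓔'.E x)]

lemma Hom.dbar_form {k : ℕ} {η : 𝓔.Form k} (h : 𝓔.IsSmooth η) :
    𝓔'.dbar (φ.form k η) = φ.form (k + 1) (𝓔.dbar η) := by
  ext x m
  have hφ : DifferentiableAt ℂ (homRep φ.map x) (chartAt V x x) :=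
    (φ.analyticAt x).differentiableAt
  have hφ' := hφ.hasFDerivAt.restrictScalars ℝ
  have hη : HasFDerivAt (𝓔.localRep η x) _ (chartAt V x x) :=
    ((h x).differentiableAt (by simp)).hasFDerivAt
  have hd := ((isBoundedBilinearMap_compBilin V 𝓔.F 𝓔'.F k).hasFDerivAt _).comp _
    (hφ'.prodMk hη)
  have key : dbarFlat (𝓔'.localRep (φ.form k η) x) (chartAt V x x) m
      = homRep φ.map x (chartAt V x x) (dbarFlat (𝓔.localRep η x) (chartAt V x x) m) := by
    refine alternatizeUncurryFin_comp _ _ _ (fun v m => ?_) m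
    rw [(φ.localRep_form η x).fderiv_eq]
    erw [hd.fderiv]
    have hI : (2⁻¹ * Complex.I * Complex.I : ℂ) = -2⁻¹ := by
      rw [mul_assoc, Complex.I_mul_I]; ring
    simp only [one_div, antilinearPart_apply, ContinuousLinearMap.coe_comp,
      Function.comp_apply, ContinuousLinearMap.prod_apply,
      ContinuousLinearMap.coe_restrictScalars', IsBoundedBilinearMap.deriv_apply, compBilin_apply,
      map_smul, smul_add, smul_smul, ContinuousAlternatingMap.add_apply,
      ContinuousAlternatingMap.smul_apply, map_add, _root_.smul_apply, hI,
      ContinuousLinearMap.compContinuousAlternatingMap_coe]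
    module
  simp only [dbar, form_apply, ContinuousLinearMap.compContinuousAlternatingMap_coe,
    Function.comp_apply, key, homRep_self]
  simp

open CategoryTheory Opposite TopologicalSpace in
/-- The morphism of sheaves `𝓔 ⊗ Ω^p ⟶ 𝓔' ⊗ Ω^p` induced by a morphism `𝓔 ⟶ 𝓔'`. -/
def Hom.omegaMap (p : ℕ) : 𝓔.omegaSheaf p ⟶ 𝓔'.omegaSheaf p where
  hom :=
    { app U := AddCommGrpCat.ofHom
        { toFun s := ⟨fun x => (φ.map x).compContinuousAlternatingMap (s.1 x), fun x₀ hx₀ => by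
            refine (φ.analyticAt_localRep (s.2 x₀ hx₀)).congr (localRep_congr _ ?_)
            filter_upwards [(unop U).isOpen.mem_nhds hx₀] with y hy
            ext m
            have hy' : y ∈ ((unop U : Opens (TopCat.of X)) : Set X) := hy
            simp [form_apply, extendZero, hy']⟩
          map_zero' := by
            ext x m
            exact map_zero (φ.map _)
          map_add' _ _ := by
            ext x m
            exact map_add (φ.map _) _ _ }
      naturality _ _ _ := rfl }

end Functoriality

open CategoryTheory in
/-- Multiplication by a complex number on the sheaf `𝓔 ⊗ Ω^p`. -/
def omegaSmul (p : ℕ) (c : ℂ) : 𝓔.omegaSheaf p ⟶ 𝓔.omegaSheaf p where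
  hom :=
    { app _ := AddCommGrpCat.ofHom (DistribSMul.toAddMonoidHom _ c)
      naturality _ _ _ := rfl }

/-- The sheaf cohomology group `H^j(X, 𝓔 ⊗ Ω^p)`. -/
def SheafH (p j : ℕ) : Type u := (𝓔.omegaSheaf p).H j

instance (p j : ℕ) : AddCommGroup (𝓔.SheafH p j) :=
  inferInstanceAs (AddCommGroup ((𝓔.omegaSheaf p).H j))

lemma omegaSmul_one (p : ℕ) : 𝓔.omegaSmul p 1 = CategoryTheory.CategoryStruct.id _ := by
  ext U s
  exact one_smul ℂ (show 𝓔.holomorphicForms p _ from s)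

lemma omegaSmul_mul (p : ℕ) (c d : ℂ) : 𝓔.omegaSmul p (c * d) =
    CategoryTheory.CategoryStruct.comp (𝓔.omegaSmul p d) (𝓔.omegaSmul p c) := by
  ext U s
  exact mul_smul c d (show 𝓔.holomorphicForms p _ from s)

lemma omegaSmul_add (p : ℕ) (c d : ℂ) :
    𝓔.omegaSmul p (c + d) = 𝓔.omegaSmul p c + 𝓔.omegaSmul p d := by
  ext U s
  exact add_smul c d (show 𝓔.holomorphicForms p _ from s)

instance (p j : ℕ) : SMul ℂ (𝓔.SheafH p j) where
  smul c a := CategoryTheory.Sheaf.H.map (𝓔.omegaSmul p c) j a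

lemma sheafH_smul_def (p j : ℕ) (c : ℂ) (a : 𝓔.SheafH p j) :
    c • a = CategoryTheory.Sheaf.H.map (𝓔.omegaSmul p c) j a := rfl

/-- `H^j(X, 𝓔 ⊗ Ω^p)` is a complex vector space, by functoriality. -/
instance (p j : ℕ) : Module ℂ (𝓔.SheafH p j) :=
  Module.ofMinimalAxioms
    (fun c a b => map_add (CategoryTheory.Sheaf.H.map (𝓔.omegaSmul p c) j) a b)
    (fun c d a => by
      simp only [sheafH_smul_def, omegaSmul_add]
      exact CategoryTheory.Sheaf.H.map_add_apply _ _ a)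
    (fun c d a => by
      simp only [sheafH_smul_def, omegaSmul_mul]
      exact CategoryTheory.Sheaf.H.map_comp_apply _ _ a)
    (fun a => by
      simp only [sheafH_smul_def, omegaSmul_one]
      exact CategoryTheory.Sheaf.H.map_id_apply a)

/-- The map on sheaf cohomology induced by a morphism of holomorphic vector bundles. -/
def Hom.sheafH {𝓔 𝓔' : HolomorphicVectorBundle V X} (φ : Hom 𝓔 𝓔') (p j : ℕ) :
    𝓔.SheafH p j →+ 𝓔'.SheafH p j :=
  CategoryTheory.Sheaf.H.map (φ.omegaMap p) j

lemma dbar_add {k : ℕ} {η η' : 𝓔.Form k} (h : 𝓔.IsSmooth η) (h' : 𝓔.IsSmooth η') :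
    𝓔.dbar (η + η') = 𝓔.dbar η + 𝓔.dbar η' := by
  ext x m
  have := (h x).differentiableAt (by simp)
  have := (h' x).differentiableAt (by simp)
  simp only [dbar, dbarFlat, localRep_add]
  rw [fderiv_add ‹_› ‹_›]
  simp [antilinearPart_add, ContinuousAlternatingMap.alternatizeUncurryFin_add, dbar, dbarFlat]

lemma dbar_smul {k : ℕ} (c : ℂ) (η : 𝓔.Form k) : 𝓔.dbar (c • η) = c • 𝓔.dbar η := by
  ext x m
  simp only [dbar, dbarFlat, localRep_smul]
  have h := congrFun (fderiv_const_smul_field (𝕜 := ℝ) (f := 𝓔.localRep η x) c) (chartAt V x x)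
  rw [h, Pi.smul_apply, antilinearPart_smul, alternatizeUncurryFin_smul_complex]
  simp [dbar, dbarFlat]

/-- The form `η` is of type `(p, q)`, i.e. a section of `E ⊗ Λ^{p,q}`. Indeed a complex number
`c` acts on the tangent spaces, and then on `Λ^{p,q}` it acts as `c ^ p * conj c ^ q`. -/
def IsOfType {k : ℕ} (η : 𝓔.Form k) (p q : ℕ) : Prop :=
  ∀ (x : X) (c : ℂ) (m : Fin k → V),
    η x (fun i => c • m i) = (c ^ p * (starRingEnd ℂ c) ^ q) • η x m

end HolomorphicVectorBundle

open HolomorphicVectorBundle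

variable (V X) in
/-- A Higgs bundle `(𝓔, θ)`: a holomorphic vector bundle with a holomorphic one-form `θ` with values
in `End 𝓔` such that `θ ∧ θ = 0`. -/
structure HiggsBundle [IsManifold 𝓘(ℂ, V) ω X] where
  bundle : HolomorphicVectorBundle V X
  θ : ∀ x, V →L[ℂ] bundle.E x →L[ℂ] bundle.E x
  /-- The coefficients of `θ` in local coordinates are holomorphic. -/
  analyticAt : ∀ (x₀ : X) (v : V), AnalyticAt ℂ
    (homRep (fun y => θ y (tangentCoordChange 𝓘(ℂ, V) x₀ y y v)) x₀) (chartAt V x₀ x₀)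
  wedge_self : ∀ x v w, θ x v ∘L θ x w - θ x w ∘L θ x v = 0

namespace HiggsBundle

variable [IsManifold 𝓘(ℂ, V) ω X] (𝓗 : HiggsBundle V X)

/-- The map `v ↦ θ(v) ∘ η(x)` in terms of which `θ ∧ η` is defined (the fibre at `x` is
identified with the model fibre). -/
def thetaComp {k : ℕ} (η : 𝓗.bundle.Form k) (x : X) : V →L[ℝ] V [⋀^Fin k]→L[ℝ] 𝓗.bundle.F :=
  ((compBilin V 𝓗.bundle.F 𝓗.bundle.F k).flip
    (((𝓗.bundle.fibreIso x).toContinuousLinearMap.restrictScalars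
      ℝ).compContinuousAlternatingMap (η x)) ∘L
    (((𝓗.bundle.fibreIso x).arrowCongr (𝓗.bundle.fibreIso x)).toContinuousLinearMap ∘L
      𝓗.θ x)).restrictScalars ℝ

/-- The exterior product `θ ∧ η`; see `thetaWedge_apply` for an explicit formula. -/
def thetaWedge {k : ℕ} (η : 𝓗.bundle.Form k) : 𝓗.bundle.Form (k + 1) := fun x =>
  ((𝓗.bundle.fibreIso x).symm.toContinuousLinearMap.restrictScalars
    ℝ).compContinuousAlternatingMap
      (ContinuousAlternatingMap.alternatizeUncurryFin (𝓗.thetaComp η x))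

lemma thetaWedge_apply {k : ℕ} (η : 𝓗.bundle.Form k) (x : X) (m : Fin (k + 1) → V) :
    𝓗.thetaWedge η x m
      = ∑ i : Fin (k + 1), (-1 : ℤ) ^ (i : ℕ) • 𝓗.θ x (m i) (η x (i.removeNth m)) := by
  simp [thetaWedge, ContinuousAlternatingMap.alternatizeUncurryFin_apply, thetaComp,
    compBilin_apply, map_sum]

/-- The operator `D'' = ∂̄_E + θ` on smooth forms. -/
def D'' (k : ℕ) : 𝓗.bundle.A k →ₗ[ℂ] 𝓗.bundle.Form (k + 1) where
  toFun η := 𝓗.bundle.dbar η.1 + 𝓗.thetaWedge η.1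
  map_add' η η' := by
    ext x m
    simp only [Submodule.coe_add, 𝓗.bundle.dbar_add η.2 η'.2]
    simp [thetaWedge_apply, Finset.sum_add_distrib]
    abel
  map_smul' c η := by
    ext x m
    simp only [Submodule.coe_smul, 𝓗.bundle.dbar_smul, Pi.add_apply, Pi.smul_apply,
      ContinuousAlternatingMap.add_apply, ContinuousAlternatingMap.smul_apply, thetaWedge_apply,
      map_smul, RingHom.id_apply, smul_add, Finset.smul_sum]
    congr 1
    exact Finset.sum_congr rfl fun i _ => smul_comm _ _ _

/-- The `D''`-closed smooth `k`-forms. -/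
def closedForms (k : ℕ) : Submodule ℂ (𝓗.bundle.A k) := LinearMap.ker (𝓗.D'' k)

/-- The `D''`-exact forms of degree `k`, i.e. the image `D''(A^{k-1}(X, E))`. -/
def exactForms : ∀ k : ℕ, Submodule ℂ (𝓗.bundle.Form k)
  | 0 => ⊥
  | k + 1 => LinearMap.range (𝓗.D'' k)

/-- The Dolbeault cohomology `H^k_Dol` of the Higgs bundle, i.e. the cohomology of the complex
`(A^•(X, E), D'')`: closed forms modulo exact forms. -/
abbrev DolbeaultH (k : ℕ) : Type u :=
  𝓗.closedForms k ⧸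
    (𝓗.exactForms k).comap ((𝓗.bundle.A k).subtype ∘ₗ (𝓗.closedForms k).subtype)

/-- The class of a closed form in Dolbeault cohomology. -/
def classOf (k : ℕ) : 𝓗.closedForms k →ₗ[ℂ] 𝓗.DolbeaultH k := Submodule.mkQ _

/-- A morphism of Higgs bundles. -/
structure Hom (𝓗 𝓗' : HiggsBundle V X) extends
    HolomorphicVectorBundle.Hom 𝓗.bundle 𝓗'.bundle where
  map_theta : ∀ x v e, map x (𝓗.θ x v e) = 𝓗'.θ x v (map x e)

variable {𝓗} {𝓗' : HiggsBundle V X} (φ : Hom 𝓗 𝓗')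

lemma Hom.D''_form {k : ℕ} (η : 𝓗.bundle.A k) :
    𝓗'.D'' k ⟨φ.toHom.form k η.1, φ.toHom.isSmooth_form η.2⟩
      = φ.toHom.form (k + 1) (𝓗.D'' k η) := by
  funext x
  have h := congrFun (φ.toHom.dbar_form η.2) x
  simp only [D'', LinearMap.coe_mk, AddHom.coe_mk, Pi.add_apply, map_add, h]
  congr 1
  ext m
  simp [thetaWedge_apply, HolomorphicVectorBundle.Hom.form_apply, map_sum, φ.map_theta]

/-- The map on closed forms induced by a morphism of Higgs bundles. -/
def Hom.closedMap (k : ℕ) : 𝓗.closedForms k →ₗ[ℂ] 𝓗'.closedForms k where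
  toFun η := ⟨⟨φ.toHom.form k η.1.1, φ.toHom.isSmooth_form η.1.2⟩, by
    have h : 𝓗.D'' k η.1 = 0 := LinearMap.mem_ker.1 η.2
    refine LinearMap.mem_ker.2 ?_
    rw [φ.D''_form, h, map_zero]⟩
  map_add' _ _ := by ext; simp
  map_smul' _ _ := by ext; simp

/-- The map on Dolbeault cohomology induced by a morphism of Higgs bundles. -/
def Hom.dolbeaultH (k : ℕ) : 𝓗.DolbeaultH k →ₗ[ℂ] 𝓗'.DolbeaultH k :=
  Submodule.mapQ _ _ (φ.closedMap k) (by
    rintro η hη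
    cases k with
    | zero =>
      have h0 : (η.1.1 : 𝓗.bundle.Form 0) = 0 := hη
      change φ.toHom.form 0 η.1.1 = 0
      rw [h0, map_zero]
    | succ k =>
      obtain ⟨ζ, hζ⟩ := hη
      refine ⟨⟨φ.toHom.form k ζ.1, φ.toHom.isSmooth_form ζ.2⟩, ?_⟩
      rw [φ.D''_form, hζ]
      rfl)

end HiggsBundle

/-! ### Flat connections, Hermitian metrics and the Higgs bundle of a flat bundle -/

namespace HolomorphicVectorBundle

variable [IsManifold 𝓘(ℂ, V) ω X] (𝓔 : HolomorphicVectorBundle V X)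

/-- The differential of a complex valued function. -/
def differential (f : X → ℂ) (x : X) (v : V) : ℂ := mfderiv 𝓘(ℝ, V) 𝓘(ℝ, ℂ) f x v

/-- A smooth connection on the smooth vector bundle `E` underlying `𝓔`. -/
structure Connection where
  toFun : 𝓔.A 0 →ₗ[ℂ] 𝓔.A 1
  leibniz : ∀ f : X → ℂ, ContMDiff 𝓘(ℝ, V) 𝓘(ℝ, ℂ) ∞ f → ∀ s t : 𝓔.A 0,
    (∀ x, t.1 x ![] = f x • s.1 x ![]) → ∀ (x : X) (v : V),
      (toFun t).1 x ![v] = differential f x v • s.1 x ![]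
        + f x • (toFun s).1 x ![v]

/-- The connection is flat: every vector of `E` extends to a section of `E` that is parallel
near the given point. -/
def Connection.IsFlat {𝓔 : HolomorphicVectorBundle V X} (D : 𝓔.Connection) : Prop :=
  ∀ (x : X) (e : 𝓔.E x), ∃ s : 𝓔.A 0, s.1 x ![] = e ∧ ∀ᶠ y in 𝓝 x, (D.toFun s).1 y = 0

/-- A smooth Hermitian metric on `E`. -/
structure HermitianMetric where
  inner : ∀ x, 𝓔.E x →ₗ⋆[ℂ] 𝓔.E x →ₗ[ℂ] ℂ
  conj_symm : ∀ x e e', starRingEnd ℂ (inner x e e') = inner x e' e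
  pos : ∀ x e, e ≠ 0 → 0 < (inner x e e).re
  smooth : ∀ s t : 𝓔.A 0, ContMDiff 𝓘(ℝ, V) 𝓘(ℝ, ℂ) ∞ fun x => inner x (s.1 x ![]) (t.1 x ![])

/-- The connection is unitary with respect to the metric: `d h(s, t) = h(D s, t) + h(s, D t)`. -/
def Connection.IsUnitary {𝓔 : HolomorphicVectorBundle V X} (D : 𝓔.Connection)
    (h : 𝓔.HermitianMetric) : Prop :=
  ∀ (s t : 𝓔.A 0) (x : X) (v : V),
    differential (fun y => h.inner y (s.1 y ![]) (t.1 y ![])) x v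
      = h.inner x ((D.toFun s).1 x ![v]) (t.1 x ![]) + h.inner x (s.1 x ![]) ((D.toFun t).1 x ![v])

end HolomorphicVectorBundle

/-- `(𝓔, θ)` is the Higgs bundle that the metric `h` associates to the flat bundle `(E, D)`
(so that `h` is a harmonic metric): `D = ∇ + θ + θ^*`, where `∇` is a unitary connection
whose `(0,1)`-part is `∂̄_E`, and `θ^*` is the adjoint of `θ`. -/
def HiggsBundle.IsAssociatedTo [IsManifold 𝓘(ℂ, V) ω X] (𝓗 : HiggsBundle V X)
    (D : 𝓗.bundle.Connection) (h : 𝓗.bundle.HermitianMetric) : Prop :=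
  D.IsFlat ∧
  ∃ (nabla : 𝓗.bundle.Connection) (θs : ∀ x, V → 𝓗.bundle.E x → 𝓗.bundle.E x),
    nabla.IsUnitary h ∧
    (∀ (s : 𝓗.bundle.A 0) (x : X) (v : V),
      (1 / 2 : ℂ) • ((nabla.toFun s).1 x ![v]
        + Complex.I • (nabla.toFun s).1 x ![Complex.I • v]) = 𝓗.bundle.dbar s.1 x ![v]) ∧
    (∀ x v e e', h.inner x (θs x v e) e' = h.inner x e (𝓗.θ x v e')) ∧
    ∀ (s : 𝓗.bundle.A 0) (x : X) (v : V), (D.toFun s).1 x ![v]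
      = (nabla.toFun s).1 x ![v] + 𝓗.θ x v (s.1 x ![]) + θs x v (s.1 x ![])

end

/-! When θ = 0 the operator D'' is ∂̄, which sends forms of type (p, q) to forms of type (p, q + 1).
The complex of E-valued forms is therefore the direct sum over p of the complexes (A^{p,•}, ∂̄), and
what remains is Dolbeault's theorem: the q-th cohomology of (A^{p,•}, ∂̄) is H^q(𝓔 ⊗ Ω^p).

Let Z^{p,q} be the sheaf of ∂̄-closed smooth forms of type (p, q). Smooth solutions of the
Cauchy-Riemann equations are analytic, so Z^{p,0} is 𝓔 ⊗ Ω^p (`omegaIncl_bijective`). The Dolbeault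
lemma (`exists_dbar_eq`) makes 0 → Z^{p,q} → A^{p,q} → Z^{p,q+1} → 0 exact (`isKernel_dbarHom`), and
A^{p,q} is acyclic by partitions of unity (`IsFine.subsingleton_H`). Composing the connecting maps
carries H^0(Z^{p,q}) onto H^q(Z^{p,0}), and for q > 0 the kernel consists of the forms ∂̄t with t
global and smooth (`dolbeaultClass_surjective`, `dolbeaultClass_eq_zero_iff_of_succ`). Connecting
maps are natural; this gives naturality in 𝓔 and, for the endomorphism "multiplication by c",
linearity over ℂ.

Three inputs are proved by hand. Acyclicity: a fine sheaf embeds in the injective sheaf of all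
discontinuous sections, with a quotient that is again fine, so dimension shifting applies. The local
Dolbeault lemma: a Cauchy transform along one complex line at a time removes the antiholomorphic
components of a closed form one after another. Independence of coordinates: on forms of pure type ∂̄
is a type component of d, and holomorphic maps preserve types while d commutes with pullback
(`dbarFlat_pullback`).

For a unitary flat bundle, D and ∇ are both unitary, so their difference θ + θ* is skew-Hermitian as
well as Hermitian; since θ is complex linear in the tangent vector, this forces θ = 0
(`IsAssociatedTo.theta_eq_zero`). -/

noncomputable section

/-! ### Sheaves of sections determined by conditions on germs -/

section GermSheaf

variable {X : Type u} [TopologicalSpace X]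

/-- A family of abelian groups `M x` together with, for every point `x`, a subgroup of the
sections of `M` that is determined by the germs at `x`. -/
structure GermSheaf (M : X → Type u) [∀ x, AddCommGroup (M x)] where
  good : X → AddSubgroup (∀ y, M y)
  congr : ∀ {x : X} {s t : ∀ y, M y}, (∀ᶠ y in 𝓝 x, s y = t y) → s ∈ good x → t ∈ good x

namespace GermSheaf

variable {M : X → Type u} [∀ x, AddCommGroup (M x)]
  {N : X → Type u} [∀ x, AddCommGroup (N x)]
  {P : X → Type u} [∀ x, AddCommGroup (P x)]

/-- The extension by zero of a section over `U`. -/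
def ext0 {U : Set X} (s : ∀ x : U, M x) : ∀ y, M y :=
  open Classical in fun y => if h : y ∈ U then s ⟨y, h⟩ else 0

lemma ext0_of_mem {U : Set X} (s : ∀ x : U, M x) {y : X} (h : y ∈ U) : ext0 s y = s ⟨y, h⟩ := by
  simp [ext0, h]

lemma ext0_add {U : Set X} (s t : ∀ x : U, M x) : ext0 (s + t) = ext0 s + ext0 t := by
  funext y
  by_cases h : y ∈ U <;> simp [ext0, h]

lemma ext0_zero {U : Set X} : ext0 (0 : ∀ x : U, M x) = 0 := by
  funext y
  by_cases h : y ∈ U <;> simp [ext0, h]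

lemma ext0_neg {U : Set X} (s : ∀ x : U, M x) : ext0 (-s) = -ext0 s := by
  funext y
  by_cases h : y ∈ U <;> simp [ext0, h]

lemma ext0_restrict {U : Set X} (hU : IsOpen U) (s : ∀ y, M y) {x : X} (hx : x ∈ U) :
    ∀ᶠ y in 𝓝 x, ext0 (fun z : U => s z) y = s y := by
  filter_upwards [hU.mem_nhds hx] with y hy
  exact ext0_of_mem _ hy

lemma ext0_restrict_set {U U' : Set X} (hU : IsOpen U) (hUU' : U ⊆ U') (s : ∀ y : U', M y)
    {x : X} (hx : x ∈ U) :
    ∀ᶠ y in 𝓝 x, ext0 (fun z : U => s ⟨z, hUU' z.2⟩) y = ext0 s y := by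
  filter_upwards [hU.mem_nhds hx] with y hy
  rw [ext0_of_mem _ hy, ext0_of_mem _ (hUU' hy)]

lemma good_congr (F : GermSheaf M) {x : X} {s t : ∀ y, M y} (h : ∀ᶠ y in 𝓝 x, s y = t y) :
    s ∈ F.good x ↔ t ∈ F.good x :=
  ⟨F.congr h, F.congr (h.mono fun _ h => h.symm)⟩

/-- The sections over `U`. -/
def sections (F : GermSheaf M) (U : Set X) : AddSubgroup (∀ x : U, M x) where
  carrier := {s | ∀ x ∈ U, ext0 s ∈ F.good x}
  add_mem' {s t} hs ht x hx := by
    rw [ext0_add]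
    exact add_mem (hs x hx) (ht x hx)
  zero_mem' x _ := by
    rw [ext0_zero]
    exact zero_mem _
  neg_mem' {s} hs x hx := by
    rw [ext0_neg]
    exact neg_mem (hs x hx)

/-- The local predicate that defines the sections. -/
def localPredicate (F : GermSheaf M) : TopCat.LocalPredicate (X := TopCat.of X) M where
  pred {U} s := ∀ x ∈ (U : Set X), ext0 (U := (U : Set X)) s ∈ F.good x
  res {U _} i s hs x hx := (F.good_congr (ext0_restrict_set U.isOpen i.le s hx)).2 (hs x (i.le hx))
  locality {U} s hs x hx := by
    obtain ⟨U', hx', i, h⟩ := hs ⟨x, hx⟩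
    exact (F.good_congr (ext0_restrict_set U'.isOpen i.le s hx')).1 (h x hx')

open CategoryTheory Opposite TopologicalSpace

/-- The presheaf of sections. -/
def presheaf (F : GermSheaf M) : TopCat.Presheaf AddCommGrpCat.{u} (TopCat.of X) where
  obj U := AddCommGrpCat.of (F.sections ((unop U : Opens (TopCat.of X)) : Set X))
  map i := AddCommGrpCat.ofHom
    { toFun s := ⟨fun x => s.1 ⟨x, i.unop.le x.2⟩, F.localPredicate.res i.unop s.1 s.2⟩
      map_zero' := rfl
      map_add' _ _ := rfl }
  map_id _ := rfl
  map_comp _ _ := rfl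

/-- The sheaf of sections. -/
def sheaf (F : GermSheaf M) :
    Sheaf (Opens.grothendieckTopology (TopCat.of X)) AddCommGrpCat.{u} where
  obj := F.presheaf
  property := by
    rw [Presheaf.isSheaf_iff_isSheaf_forget _ _ (forget AddCommGrpCat)]
    exact (TopCat.subsheafToTypes F.localPredicate).property

/-- A local operator between sections of two families, which is additive on germs of sections
of the first sheaf and maps them to germs of sections of the second. -/
structure Hom (F : GermSheaf M) (G : GermSheaf N) where
  toFun : (∀ y, M y) → ∀ y, N y
  congr' : ∀ {x : X} {s t : ∀ y, M y}, (∀ᶠ y in 𝓝 x, s y = t y) → toFun s x = toFun t x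
  map_good : ∀ {x : X} {s : ∀ y, M y}, (∀ᶠ y in 𝓝 x, s ∈ F.good y) → toFun s ∈ G.good x
  map_add : ∀ {x : X} {s t : ∀ y, M y}, s ∈ F.good x → t ∈ F.good x →
    toFun (s + t) x = toFun s x + toFun t x

variable {F : GermSheaf M} {G : GermSheaf N} {H : GermSheaf P}

lemma good_ext0 {U : Set X} (hU : IsOpen U) (s : F.sections U) {x : X} (hx : x ∈ U) :
    ∀ᶠ y in 𝓝 x, ext0 s.1 ∈ F.good y :=
  Filter.mem_of_superset (hU.mem_nhds hx) fun y hy => s.2 y hy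

/-- The action of a local operator on sections over an open set. -/
def Hom.onSections (f : Hom F G) {U : Set X} (hU : IsOpen U) : F.sections U →+ G.sections U :=
  AddMonoidHom.mk' (fun s => ⟨fun x => f.toFun (ext0 s.1) x, fun x hx =>
      (G.good_congr (ext0_restrict hU _ hx)).2 (f.map_good (good_ext0 hU s hx))⟩)
    fun s t => by
      ext x
      simp only [AddSubgroup.coe_add, ext0_add]
      exact f.map_add (s.2 x x.2) (t.2 x x.2)

lemma Hom.onSections_apply (f : Hom F G) {U : Set X} (hU : IsOpen U) (s : F.sections U) (x : U) :
    (f.onSections hU s).1 x = f.toFun (ext0 s.1) x := rfl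

/-- The morphism of sheaves given by a local operator. -/
def Hom.sheafHom (f : Hom F G) : F.sheaf ⟶ G.sheaf where
  hom :=
    { app U := AddCommGrpCat.ofHom (f.onSections (unop U).isOpen)
      naturality U U' i := by
        ext s
        refine Subtype.ext (funext fun x => ?_)
        exact f.congr' (ext0_restrict_set (unop U').isOpen i.unop.le s.1 x.2) }

/-- The inclusion of a sheaf into a larger one. -/
def inclusion {F G : GermSheaf M} (h : ∀ x, F.good x ≤ G.good x) : Hom F G where
  toFun s := s
  congr' hs := hs.self_of_nhds
  map_good hs := h _ hs.self_of_nhds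
  map_add _ _ := rfl

lemma onSections_inclusion {F G : GermSheaf M} (h : ∀ x, F.good x ≤ G.good x) {U : Set X}
    (hU : IsOpen U) (s : F.sections U) : ((inclusion h).onSections hU s).1 = s.1 := by
  funext x
  rw [Hom.onSections_apply]
  exact ext0_of_mem _ x.2

/-- A local operator `g` is a surjection of sheaves with kernel `F`. -/
structure IsKernel {F G : GermSheaf M} {H : GermSheaf P} (le : ∀ x, F.good x ≤ G.good x)
    (g : Hom G H) : Prop where
  ker : ∀ {x : X} {s : ∀ y, M y}, (∀ᶠ y in 𝓝 x, s ∈ G.good y) →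
    ((∀ᶠ y in 𝓝 x, s ∈ F.good y) ↔ ∀ᶠ y in 𝓝 x, g.toFun s y = 0)
  surj : ∀ {x : X} {t : ∀ y, P y}, (∀ᶠ y in 𝓝 x, t ∈ H.good y) →
    ∃ s, (∀ᶠ y in 𝓝 x, s ∈ G.good y) ∧ ∀ᶠ y in 𝓝 x, g.toFun s y = t y

section Exact

variable {F G : GermSheaf M} {H : GermSheaf P} {le : ∀ x, F.good x ≤ G.good x} {g : Hom G H}

lemma IsKernel.onSections_eq_zero (h : IsKernel le g) {U : Set X} (hU : IsOpen U)
    (s : G.sections U) : g.onSections hU s = 0 ↔ ∀ x ∈ U, ext0 s.1 ∈ F.good x := by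
  constructor
  · intro h0 x hx
    refine ((h.ker (good_ext0 hU s hx)).2 ?_).self_of_nhds
    filter_upwards [hU.mem_nhds hx] with y hy
    exact congrFun (congrArg Subtype.val h0) ⟨y, hy⟩
  · intro h0
    refine Subtype.ext (funext fun x => ?_)
    refine ((h.ker (good_ext0 hU s x.2)).1 ?_).self_of_nhds
    filter_upwards [hU.mem_nhds x.2] with y hy
    exact h0 y hy

/-- The short complex of sheaves. -/
def IsKernel.shortComplex (h : IsKernel le g) :
    ShortComplex (Sheaf (Opens.grothendieckTopology (TopCat.of X)) AddCommGrpCat.{u}) :=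
  ShortComplex.mk (inclusion le).sheafHom g.sheafHom (by
    ext U s
    refine (h.onSections_eq_zero (unop U).isOpen
      ((inclusion le).onSections (unop U).isOpen s)).2 fun x hx => ?_
    exact (F.good_congr (Filter.Eventually.of_forall fun y => congrFun (congrArg ext0
      (onSections_inclusion le (unop U).isOpen s)) y)).2 (s.2 x hx))

/-- Exactness is checked on sections: the inclusion is injective over every open set, `surj` is
local surjectivity, and a section killed by `g` has all its germs in `F`. -/
lemma IsKernel.shortExact (h : IsKernel le g) : h.shortComplex.ShortExact := by
  have hinj : ∀ (U : (Opens (TopCat.of X))ᵒᵖ) (s t : F.sections ((unop U : Opens X) : Set X)),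
      (inclusion le).onSections (unop U).isOpen s = (inclusion le).onSections (unop U).isOpen t →
        s = t := by
    intro U s t hst
    refine Subtype.ext ?_
    rw [← onSections_inclusion le (unop U).isOpen s, hst, onSections_inclusion]
  have hmono : Mono h.shortComplex.f := by
    refine ⟨fun a b hab => ?_⟩
    ext U s
    refine hinj U _ _ ?_
    exact ConcreteCategory.congr_hom (congrArg (fun k => k.hom.app U) hab) s
  have hepi : Epi h.shortComplex.g := by
    rw [← Sheaf.isLocallySurjective_iff_epi']
    refine (TopCat.Presheaf.isLocallySurjective_iff g.sheafHom.hom).2 fun U t x hx => ?_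
    obtain ⟨s, hs, hst⟩ := h.surj (good_ext0 U.isOpen t hx)
    obtain ⟨W, hW, hWo, hxW⟩ := eventually_nhds_iff.1
      ((hs.and hst).and (U.isOpen.eventually_mem hx))
    refine ⟨⟨W, hWo⟩, fun y hy => (hW y hy).2, ⟨⟨fun y => s y, fun y hy => ?_⟩, ?_⟩, hxW⟩
    · exact (G.good_congr (ext0_restrict hWo s hy)).2 (hW y hy).1.1
    · refine Subtype.ext (funext fun y => ?_)
      refine (g.congr' (ext0_restrict hWo s y.2)).trans ((hW y y.2).1.2.trans ?_)
      exact ext0_of_mem _ _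
  have : h.shortComplex.Exact := by
    -- The universal property of the kernel: the values of `k` are sections of `G` killed by `g`, so
    -- the same functions are sections of `F`.
    have hlift : ∀ {W} (k : W ⟶ h.shortComplex.X₂), k ≫ h.shortComplex.g = 0 →
        ∃ l, l ≫ h.shortComplex.f = k := by
      intro W k hk
      refine ⟨⟨?_⟩, ?_⟩
      · exact
          { app U := AddCommGrpCat.ofHom <| AddMonoidHom.mk' (fun w =>
              (⟨(show G.sections ((unop U : Opens X) : Set X) from k.hom.app U w).1,
                (h.onSections_eq_zero (unop U).isOpen _).1 <|
                  ConcreteCategory.congr_hom (congrArg (fun k => k.hom.app U) hk) w⟩ :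
                F.sections ((unop U : Opens X) : Set X)))
              fun a b => Subtype.ext
                ((congrArg (fun t : G.sections ((unop U : Opens X) : Set X) => t.1)
                  (map_add (k.hom.app U).hom a b)).trans rfl)
            naturality U U' i := by
              ext w
              refine Subtype.ext ?_
              exact congrArg (fun t : G.sections ((unop U' : Opens X) : Set X) => t.1)
                (ConcreteCategory.congr_hom (k.hom.naturality i) w) }
      · ext U w
        refine Subtype.ext ?_
        exact onSections_inclusion le (unop U).isOpen _
    refine ShortComplex.exact_of_f_is_kernel _
      (Limits.KernelFork.IsLimit.ofι _ _ (fun {W} k hk => (hlift k hk).choose)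
        (fun {W} k hk => (hlift k hk).choose_spec)
        (fun {W} k hk m hm => (cancel_mono h.shortComplex.f).1
          (hm.trans (hlift k hk).choose_spec.symm)))
  exact ⟨this⟩

end Exact

/-- The sheaf of all sections. -/
def all (M : X → Type u) [∀ x, AddCommGroup (M x)] : GermSheaf M where
  good _ := ⊤
  congr _ _ := trivial

/-- Evaluation of germs of arbitrary sections. -/
def evalStalk (M : X → Type u) [∀ x, AddCommGroup (M x)] (x : X) :
    (all M).presheaf.stalk x ⟶ AddCommGrpCat.of (M x) :=
  Limits.colimit.desc _
    { pt := AddCommGrpCat.of (M x)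
      ι := 
        { app U := AddCommGrpCat.ofHom (AddMonoidHom.mk'
            (fun s : (all M).sections (((unop U).1 : Opens X) : Set X) => s.1 ⟨x, (unop U).2⟩)
            fun _ _ => rfl) } }

lemma evalStalk_germ (M : X → Type u) [∀ x, AddCommGroup (M x)] (U : Opens X) (x : X)
    (hx : x ∈ U) (s : (all M).sections (U : Set X)) :
    evalStalk M x (TopCat.Presheaf.germ (X := TopCat.of X) (all M).presheaf U x hx s) = s.1 ⟨x, hx⟩ := by
  dsimp [evalStalk, TopCat.Presheaf.germ]
  exact Limits.colimit.ι_desc_apply _ _ _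

/-- The sheaf of all sections is a product of skyscrapers, so a map into it is the same as a family
of maps from the stalks to the groups `M x`. These groups are divisible, hence injective, and each
stalk map extends along the monomorphism of stalks induced by `i`. -/
lemma injective_all (M : X → Type u) [∀ x, AddCommGroup (M x)] [∀ x, DivisibleBy (M x) ℤ] :
    Injective (all M).sheaf where
  factors {A B} f i hi := by
    have hst : ∀ x : TopCat.of X, Mono ((TopCat.Presheaf.stalkFunctor (X := TopCat.of X) AddCommGrpCat.{u} x).map i.hom) := by
      have : @Mono (TopCat.Sheaf AddCommGrpCat.{u} (TopCat.of X)) _ A B i := hi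
      exact TopCat.Presheaf.stalk_mono_of_mono (X := TopCat.of X) i
    have hinj : ∀ x, Injective (AddCommGrpCat.of (M x)) := fun x => inferInstance
    let ψ (x : TopCat.of X) : TopCat.Presheaf.stalk (X := TopCat.of X) B.obj x ⟶ AddCommGrpCat.of (M x) :=
      @Injective.factorThru _ _ _ _ _ (hinj x)
        ((TopCat.Presheaf.stalkFunctor (X := TopCat.of X) AddCommGrpCat.{u} x).map f.hom ≫ evalStalk M x)
        ((TopCat.Presheaf.stalkFunctor (X := TopCat.of X) AddCommGrpCat.{u} x).map i.hom) (hst x)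
    have hψ (x : TopCat.of X) : (TopCat.Presheaf.stalkFunctor (X := TopCat.of X) AddCommGrpCat.{u} x).map i.hom ≫ ψ x =
        (TopCat.Presheaf.stalkFunctor (X := TopCat.of X) AddCommGrpCat.{u} x).map f.hom ≫ evalStalk M x :=
      @Injective.comp_factorThru _ _ _ _ _ (hinj x) _ _ (hst x)
    refine ⟨⟨?_⟩, ?_⟩
    -- The extension sends `b` to the function whose value at `x` is `ψ x` of the germ of `b`; no
    -- condition on sections has to be verified.
    · exact
        { app U := AddCommGrpCat.ofHom <| AddMonoidHom.mk' (fun b =>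
            (⟨fun x => ψ x (TopCat.Presheaf.germ (X := TopCat.of X) B.obj (unop U) x x.2 b),
              fun _ _ => trivial⟩ : (all M).sections ((unop U : Opens X) : Set X)))
            fun a b => by
              refine Subtype.ext (funext fun x => ?_)
              simp only [map_add]
              rfl
          naturality U U' j := by
            ext w
            refine Subtype.ext (funext fun x => ?_)
            exact congrArg (ψ x)
              (TopCat.Presheaf.germ_res_apply (X := TopCat.of X) B.obj j.unop x x.2 w) }
    · ext U a
      refine Subtype.ext (funext fun x => ?_)
      have h1 := ConcreteCategory.congr_hom (hψ x)
        (TopCat.Presheaf.germ (X := TopCat.of X) A.obj (unop U) x x.2 a)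
      have e1 := TopCat.Presheaf.stalkFunctor_map_germ_apply (X := TopCat.of X) (unop U) x.1 x.2
        i.hom a
      have e2 := TopCat.Presheaf.stalkFunctor_map_germ_apply (X := TopCat.of X) (unop U) x.1 x.2
        f.hom a
      exact (congrArg (ψ x) e1).symm.trans (h1.trans ((congrArg (evalStalk M x) e2).trans
        (evalStalk_germ M (unop U) x.1 x.2 _)))

end GermSheaf

end GermSheaf

end

noncomputable section

/-! ### Fine sheaves are acyclic -/

namespace GermSheaf

open CategoryTheory Opposite TopologicalSpace

variable {X : Type u} [TopologicalSpace X]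

/-- The algebra `R` of real functions contains partitions of unity subordinate to any open
cover. -/
def HasPartitions (R : Subalgebra ℝ (X → ℝ)) : Prop :=
  ∀ U : X → Set X, (∀ x, IsOpen (U x)) → (∀ x, x ∈ U x) →
    ∃ ρ : X → R, LocallyFinite (fun i => Function.support (ρ i : X → ℝ)) ∧
      (∀ i, tsupport (ρ i : X → ℝ) ⊆ U i) ∧ ∀ x, ∑ᶠ i, (ρ i : X → ℝ) x = 1

variable {R : Subalgebra ℝ (X → ℝ)}

section Fine

/-- The sheaf `F` is a sheaf of modules over the functions in `R`, which act on germs. -/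
structure IsFine {M : X → Type u} [∀ x, AddCommGroup (M x)] [∀ x, Module R (M x)]
    (F : GermSheaf M) : Prop where
  smul_eq_zero : ∀ {x : X} {f : R}, (∀ᶠ y in 𝓝 x, (f : X → ℝ) y = 0) → ∀ m : M x, f • m = 0
  smul_good : ∀ {x : X} (f : R) {s : ∀ y, M y}, s ∈ F.good x → f • s ∈ F.good x

variable {M : X → Type u} [∀ x, AddCommGroup (M x)] [∀ x, Module R (M x)] {F : GermSheaf M}

/-- The arbitrary sections that belong to `F` near `x`. -/
def IsFine.germs (hF : F.IsFine (R := R)) (x : X) : Submodule R (∀ y, M y) where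
  carrier := {s | ∀ᶠ y in 𝓝 x, s ∈ F.good y}
  add_mem' hs ht := (hs.and ht).mono fun _ h => add_mem h.1 h.2
  zero_mem' := Filter.Eventually.of_forall fun _ => zero_mem _
  smul_mem' f _ hs := hs.mono fun _ h => hF.smul_good f h

lemma IsFine.mem_germs_of_eventually_eq_zero (hF : F.IsFine (R := R)) {x : X} {s : ∀ y, M y}
    (h : ∀ᶠ y in 𝓝 x, s y = 0) : s ∈ hF.germs x :=
  h.eventually_nhds.mono fun _ hy =>
    (F.good_congr (t := 0) hy).2 (zero_mem _)

/-- The germs of arbitrary sections modulo the germs of sections of `F`. -/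
def IsFine.Quot (hF : F.IsFine (R := R)) (x : X) : Type u := (∀ y, M y) ⧸ hF.germs x

instance (hF : F.IsFine (R := R)) (x : X) : AddCommGroup (hF.Quot x) :=
  Submodule.Quotient.addCommGroup _

instance (hF : F.IsFine (R := R)) (x : X) : Module R (hF.Quot x) :=
  Submodule.Quotient.module _

/-- The class of the germ at `x` of an arbitrary section. -/
def IsFine.cls (hF : F.IsFine (R := R)) (x : X) : (∀ y, M y) →ₗ[R] hF.Quot x := (hF.germs x).mkQ

lemma IsFine.cls_eq_zero (hF : F.IsFine (R := R)) {x : X} {s : ∀ y, M y} :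
    hF.cls x s = 0 ↔ s ∈ hF.germs x := Submodule.Quotient.mk_eq_zero _

lemma IsFine.cls_surjective (hF : F.IsFine (R := R)) (x : X) : Function.Surjective (hF.cls x) :=
  (hF.germs x).mkQ_surjective

lemma IsFine.cls_congr (hF : F.IsFine (R := R)) {x : X} {s t : ∀ y, M y}
    (h : ∀ᶠ y in 𝓝 x, s y = t y) : hF.cls x s = hF.cls x t := by
  rw [← sub_eq_zero, ← map_sub, hF.cls_eq_zero]
  exact hF.mem_germs_of_eventually_eq_zero (h.mono fun y hy => sub_eq_zero.2 hy)

/-- The quotient of the sheaf of arbitrary sections by `F`. -/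
def IsFine.quot (hF : F.IsFine (R := R)) : GermSheaf hF.Quot where
  good x :=
    { carrier := {t | ∃ s : ∀ y, M y, ∀ᶠ y in 𝓝 x, t y = hF.cls y s}
      add_mem' := by
        rintro t t' ⟨s, hs⟩ ⟨s', hs'⟩
        exact ⟨s + s', (hs.and hs').mono fun y h => by simp [h.1, h.2]⟩
      zero_mem' := ⟨0, Filter.Eventually.of_forall fun y => by simp⟩
      neg_mem' := by
        rintro t ⟨s, hs⟩
        exact ⟨-s, hs.mono fun y h => by simp [h]⟩ }
  congr := by
    rintro x t t' h ⟨s, hs⟩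
    exact ⟨s, (h.and hs).mono fun y h => h.1.symm.trans h.2⟩

/-- On the quotient, functions act through their germs and not through their values, which is why
`smul_eq_zero` asks for vanishing near the point. That the quotient is again fine makes the
induction in `IsFine.subsingleton_H` possible. -/
lemma IsFine.isFine_quot (hF : F.IsFine (R := R)) : hF.quot.IsFine (R := R) where
  smul_eq_zero {x f} h m := by
    obtain ⟨s, rfl⟩ := hF.cls_surjective x m
    rw [← map_smul, hF.cls_eq_zero]
    exact hF.mem_germs_of_eventually_eq_zero
      (h.eventually_nhds.mono fun y hy => hF.smul_eq_zero hy _)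
  smul_good {x} f t := by
    rintro ⟨s, hs⟩
    exact ⟨f • s, hs.mono fun y hy => by rw [Pi.smul_apply, hy, map_smul]⟩

/-- The projection to the quotient. -/
def IsFine.quotHom (hF : F.IsFine (R := R)) : Hom (all M) hF.quot where
  toFun s y := hF.cls y s
  congr' h := hF.cls_congr h
  map_good {_ s} _ := ⟨s, Filter.Eventually.of_forall fun _ => rfl⟩
  map_add _ _ := map_add _ _ _

lemma IsFine.isKernel (hF : F.IsFine (R := R)) :
    IsKernel (F := F) (G := all M) (fun _ _ _ => trivial) hF.quotHom where
  ker {x s} _ := by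
    constructor
    · intro h
      refine h.eventually_nhds.mono fun y hy => ?_
      exact hF.cls_eq_zero.2 hy
    · intro h
      exact hF.cls_eq_zero.1 h.self_of_nhds
  surj {x t} h := by
    obtain ⟨s, hs⟩ := h.self_of_nhds
    exact ⟨s, Filter.Eventually.of_forall fun _ => trivial, hs.mono fun _ h => h.symm⟩

/-- Local lifts are averaged by a partition of unity. Two lifts of the same section differ by a
section of `F`, and `F` is stable under multiplication by functions, so the average is still a lift.
-/
lemma IsFine.exists_global_lift (hF : F.IsFine (R := R)) (hR : HasPartitions R)
    (t : ∀ x, hF.Quot x) (ht : ∀ x, t ∈ hF.quot.good x) :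
    ∃ s : ∀ y, M y, ∀ x, hF.cls x s = t x := by
  choose s hs using ht
  choose U hU hUo hxU using fun x => eventually_nhds_iff.1 (hs x)
  obtain ⟨ρ, hfin, hsupp, hsum⟩ := hR U hUo hxU
  refine ⟨fun y => ∑ᶠ i, ρ i • s i y, fun x => ?_⟩
  obtain ⟨N, hN, hNfin⟩ := hfin x
  set T := hNfin.toFinset with hT
  have hzero : ∀ i ∉ T, ∀ y ∈ interior N, ∀ᶠ z in 𝓝 y, (ρ i : X → ℝ) z = 0 := by
    intro i hi y hy
    filter_upwards [isOpen_interior.mem_nhds hy] with z hz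
    by_contra h0
    exact hi (hNfin.mem_toFinset.2 ⟨z, h0, interior_subset hz⟩)
  have hNx : interior N ∈ 𝓝 x := interior_mem_nhds.2 hN
  have hsumT : ∀ y ∈ interior N, ∀ i, (i ∉ T → (ρ i : X → ℝ) y = 0) := fun y hy i hi =>
    (hzero i hi y hy).self_of_nhds
  have h1 : ∀ᶠ y in 𝓝 x, (∑ᶠ i, ρ i • s i y) = (∑ i ∈ T, ρ i • s i) y := by
    filter_upwards [hNx] with y hy
    rw [Finset.sum_apply]
    refine finsum_eq_sum_of_support_subset _ fun i hi => ?_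
    by_contra hiT
    exact hi (hF.smul_eq_zero (hzero i hiT y hy) _)
  -- The lift chosen at `x` is compared with its own average: `1 - ∑ ρ i` vanishes on a whole
  -- neighbourhood, hence acts as zero.
  have h2 : ∀ᶠ y in 𝓝 x, s x y = (∑ i ∈ T, ρ i • s x) y := by
    filter_upwards [hNx] with y hy
    rw [Finset.sum_apply]
    simp only [Pi.smul_apply]
    rw [← Finset.sum_smul, ← sub_eq_zero]
    have h3 : s x y - (∑ i ∈ T, ρ i) • s x y = (1 - ∑ i ∈ T, ρ i) • s x y := by
      rw [sub_smul, one_smul]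
    rw [h3]
    refine hF.smul_eq_zero ?_ _
    filter_upwards [isOpen_interior.mem_nhds hy] with z hz
    have h4 := hsum z
    rw [finsum_eq_sum_of_support_subset (s := T) _ fun i hi => by
      by_contra hiT
      exact hi (hsumT z hz i hiT)] at h4
    simp [h4]
  rw [hF.cls_congr h1, (hs x).self_of_nhds, hF.cls_congr h2]
  rw [map_sum, map_sum]
  refine Finset.sum_congr rfl fun i _ => ?_
  -- On the support of `ρ i` the lift `s i` represents `t x`, just as `s x` does; off it, `ρ i`
  -- kills both germs.
  by_cases hxi : x ∈ tsupport (ρ i : X → ℝ)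
  · rw [map_smul, map_smul, ← (hs x).self_of_nhds, ← hU i x (hsupp i hxi)]
  · refine hF.cls_congr ?_
    have h5 : ∀ᶠ y in 𝓝 x, (ρ i : X → ℝ) =ᶠ[𝓝 y] 0 :=
      (notMem_tsupport_iff_eventuallyEq.1 hxi).eventually_nhds
    filter_upwards [h5] with y hy
    rw [Pi.smul_apply, Pi.smul_apply, hF.smul_eq_zero hy, hF.smul_eq_zero hy]

/-- The constant functions 1/n belong to `R`. -/
lemma divisibleBy_int {A : Type u} [AddCommGroup A] [Module R A] : Nonempty (DivisibleBy A ℤ) :=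
  ⟨{ div a n := algebraMap ℝ R ((n : ℝ)⁻¹) • a
     div_zero a := by simp
     div_cancel {n} a hn := by
       have h : (n : ℤ) • algebraMap ℝ R ((n : ℝ)⁻¹) = 1 := by
         rw [← map_zsmul, zsmul_eq_mul, mul_inv_cancel₀ (by exact_mod_cast hn), map_one]
       rw [← smul_assoc, h, one_smul] }⟩

lemma IsFine.injective_all (_ : F.IsFine (R := R)) : Injective (all M).sheaf := by
  have (x : X) : DivisibleBy (M x) ℤ := (divisibleBy_int (R := R)).some
  exact GermSheaf.injective_all M

end Fine

/-! ### Global sections and the long exact cohomology sequence -/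

section

variable {M : X → Type u} [∀ x, AddCommGroup (M x)]

/-- The whole space is a terminal object. -/
def isTerminalTop : Limits.IsTerminal (⊤ : Opens (TopCat.of X)) := Limits.isTerminalTop

/-- The global sections. -/
def global (F : GermSheaf M) : AddSubgroup (∀ y, M y) where
  carrier := {s | ∀ x, s ∈ F.good x}
  add_mem' hs ht x := add_mem (hs x) (ht x)
  zero_mem' _ := zero_mem _
  neg_mem' hs x := neg_mem (hs x)

end

variable {M : X → Type u} [∀ x, AddCommGroup (M x)] {N : X → Type u} [∀ x, AddCommGroup (N x)]
  {P : X → Type u} [∀ x, AddCommGroup (P x)]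

section Ext

open Abelian

variable {C : Type*} [Category* C] [Abelian C] [HasExt.{u} C] {S S' : ShortComplex C} {Y : C}
  {n : ℕ}

lemma comp_comp_extClass (hS : S.ShortExact) (c : Ext.{u} Y S.X₂ n) :
    (c.comp (Ext.mk₀ S.g) (add_zero n)).comp hS.extClass (rfl : n + 1 = n + 1) = 0 := by
  rw [Ext.comp_assoc_of_second_deg_zero, hS.comp_extClass, Ext.comp_zero]

lemma comp_extClass_naturality (hS : S.ShortExact) (hS' : S'.ShortExact) (φ : S ⟶ S')
    (x : Ext.{u} Y S.X₃ n) :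
    (x.comp (Ext.mk₀ φ.τ₃) (add_zero n)).comp hS'.extClass (rfl : n + 1 = n + 1) =
      (x.comp hS.extClass (rfl : n + 1 = n + 1)).comp (Ext.mk₀ φ.τ₁) (add_zero (n + 1)) := by
  rw [Ext.comp_assoc_of_second_deg_zero, Ext.comp_assoc_of_third_deg_zero,
    ShortComplex.ShortExact.extClass_naturality hS hS' φ]

end Ext

/-- Global sections as sections over the whole space. -/
def sectionsTop (F : GermSheaf M) : F.sections Set.univ ≃+ F.global where
  toFun s := ⟨ext0 s.1, fun x => s.2 x trivial⟩
  invFun s := ⟨fun x => s.1 x, fun x _ => (F.good_congr (ext0_restrict isOpen_univ _ trivial)).2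
    (s.2 x)⟩
  left_inv _ := Subtype.ext (funext fun _ => ext0_of_mem _ _)
  right_inv _ := Subtype.ext (funext fun x => ext0_of_mem _ (Set.mem_univ x))
  map_add' _ _ := Subtype.ext (ext0_add _ _)

/-- The cohomology in degree zero is given by the global sections. -/
def H0 (F : GermSheaf M) : Sheaf.H.{u} F.sheaf 0 ≃+ F.global :=
  (Sheaf.H.equiv₀ F.sheaf isTerminalTop).trans F.sectionsTop

lemma H0_map {F : GermSheaf M} {G : GermSheaf N} (f : Hom F G) (a : Sheaf.H.{u} F.sheaf 0) :
    (G.H0 (Sheaf.H.map f.sheafHom 0 a)).1 = f.toFun (F.H0 a).1 := by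
  have h := Sheaf.H.equiv₀_naturality isTerminalTop f.sheafHom a
  have h' : (G.H0 (Sheaf.H.map f.sheafHom 0 a)) = G.sectionsTop
    (f.sheafHom.hom.app (op ⊤) (Sheaf.H.equiv₀ F.sheaf isTerminalTop a)) :=
    congrArg G.sectionsTop h.symm
  rw [h']
  exact funext fun x => ext0_of_mem _ (Set.mem_univ x)

variable {F G : GermSheaf M} {H : GermSheaf P} {le : ∀ x, F.good x ≤ G.good x} {g : Hom G H}

/-- The connecting homomorphism. -/
def IsKernel.δ (h : IsKernel le g) (n : ℕ) :
    Sheaf.H.{u} H.sheaf n →+ Sheaf.H.{u} F.sheaf (n + 1) :=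
  h.shortExact.extClass.postcomp _ rfl

lemma IsKernel.δ_surjective (h : IsKernel le g) (n : ℕ)
    (hG : Subsingleton (Sheaf.H.{u} G.sheaf (n + 1))) : Function.Surjective (h.δ n) := fun a =>
  Abelian.Ext.covariant_sequence_exact₁ _ h.shortExact a
    (Subsingleton.elim (α := Sheaf.H.{u} G.sheaf (n + 1)) _ _) rfl

lemma IsKernel.δ_eq_zero_iff (h : IsKernel le g) (n : ℕ) (b : Sheaf.H.{u} H.sheaf n) :
    h.δ n b = 0 ↔ ∃ c, Sheaf.H.map g.sheafHom n c = b := by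
  constructor
  · exact fun hb => Abelian.Ext.covariant_sequence_exact₃ _ h.shortExact b rfl hb
  · rintro ⟨c, rfl⟩
    exact comp_comp_extClass h.shortExact c

lemma IsKernel.δ_injective (h : IsKernel le g) (n : ℕ)
    (hG : Subsingleton (Sheaf.H.{u} G.sheaf n)) : Function.Injective (h.δ n) := by
  rw [injective_iff_map_eq_zero]
  intro b hb
  obtain ⟨c, rfl⟩ := (h.δ_eq_zero_iff n b).1 hb
  rw [Subsingleton.elim c 0, map_zero]

/-- The start of the long exact sequence, read on global sections. For ∂̄ it says that the first
connecting map kills exactly the ∂̄-exact forms. -/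
lemma IsKernel.δ_H0_eq_zero_iff (h : IsKernel le g) (b : Sheaf.H.{u} H.sheaf 0) :
    h.δ 0 b = 0 ↔ ∃ s ∈ G.global, g.toFun s = (H.H0 b).1 := by
  rw [h.δ_eq_zero_iff]
  constructor
  · rintro ⟨c, rfl⟩
    exact ⟨(G.H0 c).1, (G.H0 c).2, (H0_map g c).symm⟩
  · rintro ⟨s, hs, hsb⟩
    refine ⟨G.H0.symm ⟨s, hs⟩, H.H0.injective (Subtype.ext ?_)⟩
    rw [H0_map, AddEquiv.apply_symm_apply, hsb]

/-- The connecting homomorphism is natural. -/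
lemma IsKernel.δ_naturality {M' : X → Type u} [∀ x, AddCommGroup (M' x)] {P' : X → Type u}
    [∀ x, AddCommGroup (P' x)] {F' G' : GermSheaf M'} {H' : GermSheaf P'}
    {le' : ∀ x, F'.good x ≤ G'.good x} {g' : Hom G' H'} (h : IsKernel le g)
    (h' : IsKernel le' g') (a : F.sheaf ⟶ F'.sheaf) (b : G.sheaf ⟶ G'.sheaf)
    (c : H.sheaf ⟶ H'.sheaf) (hab : a ≫ (inclusion le').sheafHom = (inclusion le).sheafHom ≫ b)
    (hbc : b ≫ g'.sheafHom = g.sheafHom ≫ c) (n : ℕ) (x : Sheaf.H.{u} H.sheaf n) :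
    h'.δ n (Sheaf.H.map c n x) = Sheaf.H.map a (n + 1) (h.δ n x) := by
  exact comp_extClass_naturality h.shortExact h'.shortExact (ShortComplex.Hom.mk a b c hab hbc) x

/-- Dimension shifting along 0 → F → all sections → Q → 0, whose middle term is injective. H^1(F) is
the cokernel on global sections, which vanishes by `exists_global_lift`; in higher degrees a class
comes from H^{n+1}(Q), and Q is fine. -/
theorem IsFine.subsingleton_H (hR : HasPartitions R) (n : ℕ) :
    ∀ {M : X → Type u} [∀ x, AddCommGroup (M x)] [∀ x, Module R (M x)] {F : GermSheaf M},
      F.IsFine (R := R) → Subsingleton (Sheaf.H.{u} F.sheaf (n + 1)) := by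
  induction n with
  | zero =>
    intro M _ _ F hF
    have := hF.injective_all
    refine subsingleton_of_forall_eq 0 fun a => ?_
    obtain ⟨b, rfl⟩ := hF.isKernel.δ_surjective 0 inferInstance a
    rw [hF.isKernel.δ_H0_eq_zero_iff]
    obtain ⟨s, hs⟩ := hF.exists_global_lift hR _ (hF.quot.H0 b).2
    exact ⟨s, fun _ => trivial, funext hs⟩
  | succ n ih =>
    intro M _ _ F hF
    have := hF.injective_all
    refine subsingleton_of_forall_eq 0 fun a => ?_
    obtain ⟨b, rfl⟩ := hF.isKernel.δ_surjective (n + 1) inferInstance a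
    have := ih hF.isFine_quot
    rw [Subsingleton.elim b 0, map_zero]

end GermSheaf

end

noncomputable section

/-! ### The decomposition of alternating forms by type -/

/-! ### Coefficients of homogeneous polynomials in c and its conjugate -/

section Bihomogeneous

open Finset

variable {W : Type*} [AddCommGroup W] [Module ℂ W]

/-- The function `f` is a homogeneous polynomial of degree `k` in `c` and its conjugate, with
coefficients `a q`. -/
def IsBihom (k : ℕ) (a : ℕ → W) (f : ℂ → W) : Prop :=
  ∀ c, f c = ∑ q ∈ range (k + 1), (c ^ (k - q) * starRingEnd ℂ c ^ q) • a q

lemma IsBihom.add {k : ℕ} {a b : ℕ → W} {f g : ℂ → W} (hf : IsBihom k a f) (hg : IsBihom k b g) :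
    IsBihom k (a + b) (f + g) := fun c => by
  simp only [Pi.add_apply, hf c, hg c, smul_add, sum_add_distrib]

lemma IsBihom.smul_self {k : ℕ} {a : ℕ → W} {f : ℂ → W} (hf : IsBihom k a f) :
    IsBihom (k + 1) (fun q => if q ≤ k then a q else 0) (fun c => c • f c) := fun c => by
  rw [sum_range_succ]
  simp only [hf c, smul_sum, show ¬ (k + 1 ≤ k) by omega, if_false, smul_zero, add_zero]
  refine sum_congr rfl fun q hq => ?_
  have hq : q ≤ k := by simpa [Nat.lt_succ_iff] using hq
  rw [if_pos hq, smul_smul, Nat.sub_add_comm hq]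
  ring_nf

lemma IsBihom.smul_conj {k : ℕ} {a : ℕ → W} {f : ℂ → W} (hf : IsBihom k a f) :
    IsBihom (k + 1) (fun q => if q = 0 then 0 else a (q - 1))
      (fun c => starRingEnd ℂ c • f c) := fun c => by
  rw [sum_range_succ']
  simp only [hf c, smul_sum, if_true, smul_zero, add_zero]
  refine sum_congr rfl fun q _ => ?_
  rw [if_neg q.succ_ne_zero, smul_smul, Nat.add_sub_add_right, Nat.add_sub_cancel]
  ring_nf

/-- A discrete Fourier transform. At points z^m of the unit circle conjugation is inversion, so the
monomial with index q' takes the value z^{m(k - 2q')}, and orthogonality of characters isolates one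
index. -/
lemma exists_weights (k q : ℕ) : ∃ c w : Fin (k + 1) → ℂ, ∀ q' ≤ k,
    ∑ m, w m * (c m ^ (k - q') * starRingEnd ℂ (c m) ^ q') = if q' = q then 1 else 0 := by
  by_cases hq : q ≤ k
  swap
  · refine ⟨0, 0, fun q' hq' => ?_⟩
    rw [if_neg (by omega)]
    simp
  -- The exponents k - 2q' move in steps of two, so it is z² that has to be a primitive (k + 1)-th
  -- root of unity.
  obtain ⟨z, hz⟩ : ∃ z : ℂ, z ^ 2 = Complex.exp (2 * Real.pi * Complex.I / ((k + 1 : ℕ) : ℂ)) :=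
    IsAlgClosed.exists_pow_nat_eq _ two_pos
  have hω := Complex.isPrimitiveRoot_exp (k + 1) k.succ_ne_zero
  rw [← hz] at hω
  have hz1 : ‖z‖ = 1 := by
    have h1 : ‖z ^ 2‖ = 1 := Complex.norm_eq_one_of_pow_eq_one hω.pow_eq_one k.succ_ne_zero
    rw [norm_pow] at h1
    exact (pow_eq_one_iff_of_nonneg (norm_nonneg _) two_ne_zero).1 h1
  have hz0 : z ≠ 0 := norm_ne_zero_iff.1 (by rw [hz1]; exact one_ne_zero)
  have hconj : starRingEnd ℂ z = z⁻¹ := (Complex.inv_eq_conj hz1).symm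
  refine ⟨fun m => z ^ (m : ℕ), fun m => ((k + 1 : ℕ) : ℂ)⁻¹ * (z ^ (2 * q) * (z ^ k)⁻¹) ^ (m : ℕ),
    fun q' hq' => ?_⟩
  have hk : ((k + 1 : ℕ) : ℂ) ≠ 0 := Nat.cast_ne_zero.2 k.succ_ne_zero
  have h2 : ∀ m : ℕ, ((k + 1 : ℕ) : ℂ)⁻¹ * (z ^ (2 * q) * (z ^ k)⁻¹) ^ m *
      ((z ^ m) ^ (k - q') * starRingEnd ℂ (z ^ m) ^ q')
        = ((k + 1 : ℕ) : ℂ)⁻¹ * ((z ^ 2) ^ q * ((z ^ 2) ^ q')⁻¹) ^ m := by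
    intro m
    rw [map_pow, hconj, mul_assoc]
    congr 1
    have h3 : (z ^ m) ^ (k - q') * ((z⁻¹) ^ m) ^ q'
        = (z ^ (k - q') * (z ^ q')⁻¹) ^ m := by
      rw [mul_pow, ← pow_mul, ← pow_mul, mul_comm m, pow_mul z, mul_comm m, pow_mul, inv_pow,
        inv_pow]
    rw [h3, ← mul_pow]
    congr 1
    obtain ⟨r, rfl⟩ := Nat.exists_eq_add_of_le hq'
    rw [Nat.add_sub_cancel_left]
    field_simp
    ring
  rw [Fin.sum_univ_eq_sum_range (fun m => ((k + 1 : ℕ) : ℂ)⁻¹ * (z ^ (2 * q) * (z ^ k)⁻¹) ^ m *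
      ((z ^ m) ^ (k - q') * starRingEnd ℂ (z ^ m) ^ q')), sum_congr rfl fun m _ => h2 m,
      ← mul_sum]
  have hz20 : z ^ 2 ≠ 0 := pow_ne_zero _ hz0
  split_ifs with h
  · subst h
    rw [mul_inv_cancel₀ (pow_ne_zero _ hz20)]
    simp only [one_pow, sum_const, card_range, nsmul_eq_mul, mul_one]
    exact inv_mul_cancel₀ hk
  · set r := (z ^ 2) ^ q * ((z ^ 2) ^ q')⁻¹ with hr
    have hr1 : r ≠ 1 := fun h1 => h
      (hω.pow_inj (Nat.lt_succ_of_le hq) (Nat.lt_succ_of_le hq')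
        (by rwa [hr, mul_inv_eq_one₀ (pow_ne_zero _ hz20)] at h1)).symm
    have hrk : r ^ (k + 1) = 1 := by
      rw [hr, mul_pow, inv_pow, pow_right_comm _ q, pow_right_comm _ q', hω.pow_eq_one]
      simp
    -- For q' ≠ q the ratio r is a nontrivial (k + 1)-th root of unity, and its geometric sum
    -- vanishes.
    rw [geom_sum_eq hr1, hrk]
    simp

/-- Sampling points for the extraction of coefficients. -/
def typePoint (k q : ℕ) : Fin (k + 1) → ℂ := (exists_weights k q).choose

/-- Weights for the extraction of coefficients. -/
def typeWeight (k q : ℕ) : Fin (k + 1) → ℂ := (exists_weights k q).choose_spec.choose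

lemma IsBihom.coeff {k : ℕ} {a : ℕ → W} {f : ℂ → W} (hf : IsBihom k a f) {q : ℕ} (hq : q ≤ k) :
    ∑ m, typeWeight k q m • f (typePoint k q m) = a q := by
  have h := (exists_weights k q).choose_spec.choose_spec
  change ∀ q' ≤ k, ∑ m, typeWeight k q m * (typePoint k q m ^ (k - q') *
    starRingEnd ℂ (typePoint k q m) ^ q') = _ at h
  simp only [hf _, smul_sum, smul_smul]
  rw [sum_comm]
  simp only [← sum_smul]
  rw [sum_eq_single q]
  · rw [h q hq, if_pos rfl, one_smul]
  · intro q' hq' hne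
    rw [h q' (by simpa [Nat.lt_succ_iff] using hq'), if_neg hne, zero_smul]
  · intro h'
    exact absurd (mem_range.2 (Nat.lt_succ_of_le hq)) h'

lemma IsBihom.unique {k : ℕ} {a b : ℕ → W} {f : ℂ → W} (hf : IsBihom k a f) (hg : IsBihom k b f)
    {q : ℕ} (hq : q ≤ k) : a q = b q :=
  (hf.coeff hq).symm.trans (hg.coeff hq)

end Bihomogeneous

/-! ### The components of an alternating form by type -/

section Types

variable {V : Type*} [NormedAddCommGroup V] [NormedSpace ℂ V]
  {W : Type*} [AddCommGroup W] [Module ℂ W]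

/-- Induction on the number of slots. In the first slot a real linear map is the sum of a complex
linear part, which contributes a factor c, and an antilinear part, which contributes a factor conj
c. -/
lemma exists_isBihom (k : ℕ) (η : MultilinearMap ℝ (fun _ : Fin k => V) W) (m : Fin k → V) :
    ∃ a, IsBihom k a fun c => η fun i => c • m i := by
  induction k with
  | zero =>
    refine ⟨fun _ => η m, fun c => ?_⟩
    simp only [zero_add, Finset.range_one, Finset.sum_singleton, pow_zero, mul_one, one_smul, Nat.sub_self]
    exact congrArg η (Subsingleton.elim _ _)
  | succ k ih =>
    -- ε = -i gives the complex linear part in the first variable, ε = i the antilinear part.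
    have hpart : ∀ ε : ℂ, ∃ a, IsBihom k a fun c => (2⁻¹ : ℂ) •
        (η (Fin.cons (m 0) fun i => c • m i.succ)
          + ε • η (Fin.cons (Complex.I • m 0) fun i => c • m i.succ)) := by
      intro ε
      obtain ⟨a, ha⟩ := ih (η.curryLeft (m 0)) (Fin.tail m)
      obtain ⟨b, hb⟩ := ih (η.curryLeft (Complex.I • m 0)) (Fin.tail m)
      refine ⟨(2⁻¹ : ℂ) • (a + ε • b), fun c => ?_⟩
      have ha' := ha c
      have hb' := hb c
      simp only [MultilinearMap.curryLeft_apply] at ha' hb'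
      simp only [Fin.tail] at ha' hb'
      beta_reduce
      rw [ha', hb']
      simp only [Pi.smul_apply, Pi.add_apply, smul_add, Finset.sum_add_distrib, Finset.smul_sum]
      congr 1
      · exact Finset.sum_congr rfl fun q _ => smul_comm _ _ _
      · refine Finset.sum_congr rfl fun q _ => ?_
        rw [smul_comm ε, smul_comm (2⁻¹ : ℂ)]
    obtain ⟨a, ha⟩ := hpart (-Complex.I)
    obtain ⟨b, hb⟩ := hpart Complex.I
    refine ⟨_, fun c => Eq.trans ?_ ((ha.smul_self.add hb.smul_conj) c)⟩
    · have hsplit : (fun i => c • m i) = Fin.cons (c.re • m 0 + c.im • (Complex.I • m 0))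
          fun i => c • m i.succ := by
        funext i
        refine Fin.cases ?_ (fun i => ?_) i
        · simp only [Fin.cons_zero]
          conv_lhs => rw [← Complex.re_add_im c]
          rw [add_smul, mul_smul]
          rfl
        · simp
      beta_reduce
      rw [hsplit]
      have h1 := η.cons_add (fun i => c • m i.succ) (c.re • m 0) (c.im • (Complex.I • m 0))
      rw [h1, η.cons_smul, η.cons_smul]
      simp only [Pi.add_apply]
      generalize η (Fin.cons (m 0) fun i => c • m i.succ) = A
      generalize η (Fin.cons (Complex.I • m 0) fun i => c • m i.succ) = B
      have hA : c.re • A = (c.re : ℂ) • A := rfl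
      have hB : c.im • B = (c.im : ℂ) • B := rfl
      rw [hA, hB, Complex.re_eq_add_conj, Complex.im_eq_sub_conj]
      have hI : (2 * Complex.I)⁻¹ = -(2⁻¹ * Complex.I) := by
        rw [mul_inv, Complex.inv_I]; ring
      rw [div_eq_mul_inv, div_eq_mul_inv, hI]
      module

section Topological

variable [TopologicalSpace W] [IsTopologicalAddGroup W] [ContinuousSMul ℂ W]
  {W' : Type*} [AddCommGroup W'] [Module ℂ W'] [TopologicalSpace W'] [IsTopologicalAddGroup W']
  [ContinuousSMul ℂ W'] {k : ℕ}

/-- The alternating form `η` is of type `(p, q)`. -/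
def OfType (η : V [⋀^Fin k]→L[ℝ] W) (p q : ℕ) : Prop :=
  ∀ (c : ℂ) (m : Fin k → V), η (fun i => c • m i) = (c ^ p * starRingEnd ℂ c ^ q) • η m

lemma OfType.add {η η' : V [⋀^Fin k]→L[ℝ] W} {p q : ℕ} (h : OfType η p q) (h' : OfType η' p q) :
    OfType (η + η') p q := fun c m => by
  simp [h c m, h' c m]

lemma OfType.neg {η : V [⋀^Fin k]→L[ℝ] W} {p q : ℕ} (h : OfType η p q) :
    OfType (-η) p q := fun c m => by
  simp [h c m]

lemma OfType.zero {p q : ℕ} : OfType (0 : V [⋀^Fin k]→L[ℝ] W) p q := fun c m => by simp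

lemma OfType.smul {η : V [⋀^Fin k]→L[ℝ] W} {p q : ℕ} (h : OfType η p q) (a : ℂ) :
    OfType (a • η) p q := fun c m => by
  simp only [ContinuousAlternatingMap.smul_apply, h c m]
  exact smul_comm _ _ _

/-- The component of type `(k - q, q)` of a `k`-form. -/
def typeProj (k q : ℕ) : (V [⋀^Fin k]→L[ℝ] W) →ₗ[ℂ] (V [⋀^Fin k]→L[ℝ] W) where
  toFun η := ∑ m, typeWeight k q m • η.compContinuousLinearMap
    (typePoint k q m • ContinuousLinearMap.id ℝ V)
  map_add' η η' := by
    ext v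
    simp [Finset.sum_add_distrib]
  map_smul' c η := by
    ext v
    simp only [ContinuousAlternatingMap.sum_apply, ContinuousAlternatingMap.smul_apply,
      ContinuousAlternatingMap.compContinuousLinearMap_apply, RingHom.id_apply, Finset.smul_sum]
    exact Finset.sum_congr rfl fun _ _ => smul_comm _ _ _

lemma typeProj_apply (q : ℕ) (η : V [⋀^Fin k]→L[ℝ] W) (v : Fin k → V) :
    typeProj k q η v = ∑ m, typeWeight k q m • η fun i => typePoint k q m • v i := by
  simp only [typeProj, LinearMap.coe_mk, AddHom.coe_mk, ContinuousAlternatingMap.sum_apply,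
    ContinuousAlternatingMap.smul_apply, ContinuousAlternatingMap.compContinuousLinearMap_apply]
  rfl

lemma exists_isBihom_typeProj (η : V [⋀^Fin k]→L[ℝ] W) (v : Fin k → V) :
    IsBihom k (fun q => typeProj k q η v) fun c => η fun i => c • v i := by
  obtain ⟨a, ha⟩ := exists_isBihom k η.toMultilinearMap v
  intro c
  refine (ha c).trans (Finset.sum_congr rfl fun q hq => ?_)
  beta_reduce
  rw [typeProj_apply]
  exact congrArg _ (ha.coeff (by simpa [Nat.lt_succ_iff] using hq)).symm

lemma sum_typeProj (η : V [⋀^Fin k]→L[ℝ] W) :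
    ∑ q ∈ Finset.range (k + 1), typeProj k q η = η := by
  ext v
  have h := exists_isBihom_typeProj η v 1
  simp only [one_smul, one_pow, map_one, mul_one] at h
  rw [ContinuousAlternatingMap.sum_apply]
  exact h.symm

/-- The map b ↦ η(b c v) has two expansions, one about the vectors c v and one about v at the point
b c; uniqueness of coefficients compares them. -/
lemma ofType_typeProj (η : V [⋀^Fin k]→L[ℝ] W) {q : ℕ} (hq : q ≤ k) :
    OfType (typeProj k q η) (k - q) q := by
  intro c v
  have h1 := exists_isBihom_typeProj η fun i => c • v i
  have h2 : IsBihom k (fun q => (c ^ (k - q) * starRingEnd ℂ c ^ q) • typeProj k q η v)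
      fun b => η fun i => b • c • v i := fun b => by
    have h3 := exists_isBihom_typeProj η v (b * c)
    have h4 : (fun i => (b * c) • v i) = fun i => b • c • v i := funext fun i => mul_smul _ _ _
    beta_reduce at h3
    rw [h4] at h3
    refine h3.trans (Finset.sum_congr rfl fun q _ => ?_)
    beta_reduce
    rw [smul_smul, map_mul, mul_pow, mul_pow]
    congr 1
    ring
  exact h1.unique h2 hq

lemma OfType.typeProj_eq {η : V [⋀^Fin k]→L[ℝ] W} {p q : ℕ} (h : OfType η p q) (hpq : p + q = k)
    {q' : ℕ} (hq' : q' ≤ k) : typeProj k q' η = if q' = q then η else 0 := by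
  ext v
  have h1 := exists_isBihom_typeProj η v
  have h2 : IsBihom k (fun q' => if q' = q then η v else 0) fun c => η fun i => c • v i :=
    fun c => by
      simp only [smul_ite, smul_zero, Finset.sum_ite_eq']
      rw [if_pos (Finset.mem_range.2 (by omega)), h c v, show k - q = p by omega]
  rw [h1.unique h2 hq']
  split_ifs <;> simp

lemma typeProj_comp (q : ℕ) (A : W →L[ℂ] W') (η : V [⋀^Fin k]→L[ℝ] W) :
    typeProj k q ((A.restrictScalars ℝ).compContinuousAlternatingMap η) =
      (A.restrictScalars ℝ).compContinuousAlternatingMap (typeProj k q η) := by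
  ext v
  simp [typeProj_apply, map_sum]

/-- Pullback by a complex linear map commutes with scalar multiplication of the arguments, and
`typeProj` is built from nothing else. -/
lemma typeProj_pullback {V' : Type*} [NormedAddCommGroup V'] [NormedSpace ℂ V'] (q : ℕ)
    (A : V' →L[ℂ] V) (η : V [⋀^Fin k]→L[ℝ] W) :
    typeProj k q (η.compContinuousLinearMap (A.restrictScalars ℝ)) =
      (typeProj k q η).compContinuousLinearMap (A.restrictScalars ℝ) := by
  ext v
  simp [typeProj_apply, Function.comp_def]

/-- A form of type `(k + 1, 0)` is complex linear in the first variable. -/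
lemma OfType.cons_I_smul {η : V [⋀^Fin (k + 1)]→L[ℝ] W} (h : OfType η (k + 1) 0) (v : V)
    (m : Fin k → V) : η (Fin.cons (Complex.I • v) m) = Complex.I • η (Fin.cons v m) := by
  obtain ⟨a, ha⟩ := exists_isBihom k (η.toMultilinearMap.curryLeft v) m
  obtain ⟨b, hb⟩ := exists_isBihom k (η.toMultilinearMap.curryLeft (Complex.I • v)) m
  set A := η (Fin.cons v m) with hA
  set B := η (Fin.cons (Complex.I • v) m) with hB
  have hab : IsBihom k (a + Complex.I • b) fun c =>
      η (Fin.cons v fun i => c • m i) + Complex.I • η (Fin.cons (Complex.I • v) fun i => c • m i) :=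
    ha.add (fun c => by
      refine (congrArg (Complex.I • ·) (hb c)).trans ?_
      simp only [Finset.smul_sum]
      exact Finset.sum_congr rfl fun _ _ => smul_comm _ _ _)
  -- Write C, D for the values at (v, c m) and (iv, c m). The type condition at (v, m) and (iv, m)
  -- gives conj c · (C + iD) = c^{k+1} (A + iB). The left side is divisible by conj c, the right
  -- side contains only the monomial with q = 0, so A + iB = 0.
  have h1 : IsBihom (k + 1) (fun q => if q = 0 then A + Complex.I • B else 0) fun c =>
      starRingEnd ℂ c • (η (Fin.cons v fun i => c • m i)
        + Complex.I • η (Fin.cons (Complex.I • v) fun i => c • m i)) := fun c => by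
    simp only [smul_ite, smul_zero, Finset.sum_ite_eq']
    rw [if_pos (Finset.mem_range.2 (by omega)), Nat.sub_zero, pow_zero, mul_one]
    have e1 := h c (Fin.cons v m)
    have e2 := h c (Fin.cons (Complex.I • v) m)
    have e3 : ∀ w : V, (fun i => c • (Fin.cons w m : Fin (k + 1) → V) i)
        = Fin.cons (c.re • w + c.im • (Complex.I • w)) fun i => c • m i := by
      intro w
      funext i
      refine Fin.cases ?_ (fun i => ?_) i
      · simp only [Fin.cons_zero]
        conv_lhs => rw [← Complex.re_add_im c]
        rw [add_smul, mul_smul]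
        rfl
      · simp
    have hI : Complex.I • Complex.I • v = (-1 : ℝ) • v := by
      rw [smul_smul, Complex.I_mul_I]
      simp
    have hadd := η.toMultilinearMap.cons_add (fun i => c • m i)
    have hsm := fun (t : ℝ) w => η.toMultilinearMap.cons_smul (fun i => c • m i) t w
    change ∀ x y, η (Fin.cons (x + y) _) = η (Fin.cons x _) + η (Fin.cons y _) at hadd
    change ∀ t w, η (Fin.cons (t • w) _) = t • η (Fin.cons w _) at hsm
    rw [e3, hadd, hsm, hsm] at e1 e2
    rw [hI, hsm] at e2
    rw [pow_zero, mul_one] at e1 e2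
    rw [smul_add (c ^ (k + 1)), smul_comm (c ^ (k + 1)), hA, hB, ← e1, ← e2]
    generalize η (Fin.cons v fun i => c • m i) = C
    generalize η (Fin.cons (Complex.I • v) fun i => c • m i) = D
    have r1 : ∀ (t : ℝ) (w : W), t • w = (t : ℂ) • w := fun _ _ => rfl
    have hc : starRingEnd ℂ c = c.re - c.im * Complex.I := by
      apply Complex.ext <;> simp
    simp only [r1, hc]
    match_scalars
    · ring
    · linear_combination (-(c.im : ℂ)) * Complex.I_sq
  have h2 := h1.unique hab.smul_conj (Nat.zero_le _)
  simp only [if_true] at h2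
  have h3 : Complex.I • (A + Complex.I • B) = 0 := by rw [h2, smul_zero]
  rw [smul_add, smul_smul, Complex.I_mul_I, neg_one_smul, add_neg_eq_zero] at h3
  exact h3.symm

/-- Any slot can be moved to the front at the cost of a sign. -/
lemma map_update_I_smul {η : V [⋀^Fin (k + 1)]→L[ℝ] W}
    (h : ∀ v m, η (Fin.cons (Complex.I • v) m) = Complex.I • η (Fin.cons v m))
    (m : Fin (k + 1) → V) (i : Fin (k + 1)) (v : V) :
    η (Function.update m i (Complex.I • v)) = Complex.I • η (Function.update m i v) := by
  have key : ∀ w, η (Function.update m i w) =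
      ((-1 : ℤ) ^ (i : ℕ)) • η (Fin.cons w (i.removeNth m)) := fun w => by
    rw [← Fin.insertNth_removeNth]
    exact η.toAlternatingMap.map_insertNth i w _
  rw [key, key, h, smul_comm]

/-- A real alternating form that is complex linear in the first variable is a complex alternating
form. -/
def complexForm (η : V [⋀^Fin (k + 1)]→L[ℝ] W)
    (h : ∀ v m, η (Fin.cons (Complex.I • v) m) = Complex.I • η (Fin.cons v m)) :
    V [⋀^Fin (k + 1)]→L[ℂ] W where
  toFun m := η m
  map_update_add' {inst} m i x y := by
    obtain rfl : inst = instDecidableEqFin (k + 1) := Subsingleton.elim _ _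
    exact η.map_update_add m i x y
  map_update_smul' {inst} m i c x := by
    obtain rfl : inst = instDecidableEqFin (k + 1) := Subsingleton.elim _ _
    have hc : c • x = c.re • x + c.im • (Complex.I • x) := by
      conv_lhs => rw [← Complex.re_add_im c]
      rw [add_smul, mul_smul]
      rfl
    have r1 : ∀ (t : ℝ) (w : W), t • w = (t : ℂ) • w := fun _ _ => rfl
    rw [hc, η.map_update_add, η.map_update_smul, η.map_update_smul, map_update_I_smul h, r1, r1,
      smul_smul, ← add_smul, Complex.re_add_im]
  map_eq_zero_of_eq' m i j hm hij := η.map_eq_zero_of_eq m hm hij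
  cont := η.cont

lemma ofType_restrictScalars (η : V [⋀^Fin k]→L[ℂ] W) : OfType (η.restrictScalars ℝ) k 0 := by
  intro c m
  have := η.map_smul_univ (fun _ => c) m
  simpa using this

/-- Together with `ofType_restrictScalars` this identifies the forms of type (k, 0) with the complex
alternating forms, the fibres of Ω^k. -/
lemma exists_restrictScalars_eq {η : V [⋀^Fin k]→L[ℝ] W} (h : OfType η k 0) :
    ∃ ξ : V [⋀^Fin k]→L[ℂ] W, ξ.restrictScalars ℝ = η := by
  cases k with
  | zero => exact ⟨ContinuousAlternatingMap.constOfIsEmpty ℂ V (Fin 0) (η ![]), by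
      ext m
      exact congrArg η (Subsingleton.elim _ _)⟩
  | succ k => exact ⟨complexForm η h.cons_I_smul, rfl⟩

lemma ofType_of_cons_I_smul {η : V [⋀^Fin (k + 1)]→L[ℝ] W}
    (h : ∀ v m, η (Fin.cons (Complex.I • v) m) = Complex.I • η (Fin.cons v m)) :
    OfType η (k + 1) 0 :=
  ofType_restrictScalars (complexForm η h)

end Topological

/-! ### Contraction with antiholomorphic tangent vectors -/

section Contraction

variable {V W : Type*} [NormedAddCommGroup V] [NormedSpace ℂ V] [NormedAddCommGroup W]
  [NormedSpace ℂ W] {k : ℕ}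

/-- The contraction of a form with the antiholomorphic part of the tangent vector `v`. -/
def contractBar (v : V) : (V [⋀^Fin (k + 1)]→L[ℝ] W) →L[ℝ] V [⋀^Fin k]→L[ℝ] W :=
  (1 / 2 : ℂ) • ((ContinuousLinearMap.apply ℝ _ v
      + Complex.I • ContinuousLinearMap.apply ℝ _ (Complex.I • v)) ∘L
    (ContinuousAlternatingMap.curryLeftLI (𝕜 := ℝ) (E := V) (F := W) (n := k)).toContinuousLinearMap)

lemma contractBar_apply (v : V) (η : V [⋀^Fin (k + 1)]→L[ℝ] W) (m : Fin k → V) :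
    contractBar v η m = (1 / 2 : ℂ) • (η (Fin.cons v m)
      + Complex.I • η (Fin.cons (Complex.I • v) m)) := rfl

lemma cons_I_smul_I_smul (η : V [⋀^Fin (k + 1)]→L[ℝ] W) (v : V) (m : Fin k → V) :
    η (Fin.cons (Complex.I • Complex.I • v) m) = -η (Fin.cons v m) := by
  have hI : Complex.I • Complex.I • v = (-1 : ℝ) • v := by
    rw [smul_smul, Complex.I_mul_I]
    simp
  have := η.toMultilinearMap.cons_smul m (-1 : ℝ) v
  rw [hI]
  exact this.trans (by simp)

lemma contractBar_eq_zero_iff {v : V} {η : V [⋀^Fin (k + 1)]→L[ℝ] W} :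
    contractBar v η = 0 ↔ ∀ m, η (Fin.cons (Complex.I • v) m) = Complex.I • η (Fin.cons v m) := by
  rw [ContinuousAlternatingMap.ext_iff]
  refine forall_congr' fun m => ?_
  rw [contractBar_apply]
  change (1 / 2 : ℂ) • _ = (0 : W) ↔ _
  rw [smul_eq_zero, or_iff_right (by norm_num)]
  generalize η (Fin.cons (Complex.I • v) m) = B
  generalize η (Fin.cons v m) = A
  constructor
  · intro h
    have h3 : Complex.I • (A + Complex.I • B) = 0 := by rw [h, smul_zero]
    rw [smul_add, smul_smul, Complex.I_mul_I, neg_one_smul, add_neg_eq_zero] at h3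
    exact h3.symm
  · rintro rfl
    rw [smul_smul, Complex.I_mul_I, neg_one_smul, add_neg_cancel]

lemma contractBar_add (v w : V) (η : V [⋀^Fin (k + 1)]→L[ℝ] W) :
    contractBar (v + w) η = contractBar v η + contractBar w η := by
  ext m
  simp only [contractBar_apply, ContinuousAlternatingMap.add_apply, smul_add,
    ContinuousAlternatingMap.cons_add]
  abel

lemma contractBar_real_smul (t : ℝ) (v : V) (η : V [⋀^Fin (k + 1)]→L[ℝ] W) :
    contractBar (t • v) η = t • contractBar v η := by
  ext m
  rw [ContinuousAlternatingMap.smul_apply, contractBar_apply, contractBar_apply,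
    smul_comm Complex.I t v, ContinuousAlternatingMap.cons_smul,
    ContinuousAlternatingMap.cons_smul, smul_comm Complex.I t, ← smul_add, smul_comm t]

lemma contractBar_I_smul (v : V) (η : V [⋀^Fin (k + 1)]→L[ℝ] W) :
    contractBar (Complex.I • v) η = -(Complex.I • contractBar v η) := by
  ext m
  rw [ContinuousAlternatingMap.neg_apply, ContinuousAlternatingMap.smul_apply, contractBar_apply,
    contractBar_apply, cons_I_smul_I_smul]
  generalize η (Fin.cons (Complex.I • v) m) = B
  generalize η (Fin.cons v m) = A
  match_scalars
  · linear_combination (1 / 2 : ℂ) * Complex.I_sq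
  · ring

lemma contractBar_smul (c : ℂ) (v : V) (η : V [⋀^Fin (k + 1)]→L[ℝ] W) :
    contractBar (c • v) η = starRingEnd ℂ c • contractBar v η := by
  have hc : c • v = c.re • v + c.im • (Complex.I • v) := by
    conv_lhs => rw [← Complex.re_add_im c]
    rw [add_smul, mul_smul]
    rfl
  have hc' : starRingEnd ℂ c = c.re - c.im * Complex.I := by
    apply Complex.ext <;> simp
  rw [hc, contractBar_add, contractBar_real_smul, contractBar_real_smul, contractBar_I_smul, hc',
    sub_smul, mul_smul, smul_neg, sub_eq_add_neg]
  rfl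

lemma contractBar_anticomm (v w : V) (η : V [⋀^Fin (k + 2)]→L[ℝ] W) :
    contractBar v (contractBar w η) = -contractBar w (contractBar v η) := by
  have hs : ∀ (a b : V) (m : Fin k → V),
      η (Fin.cons a (Fin.cons b m)) = -η (Fin.cons b (Fin.cons a m)) := by
    intro a b m
    have h := η.toAlternatingMap.map_swap (Fin.cons b (Fin.cons a m)) (i := 0) (j := 1)
      (by simp)
    have h2 : (Fin.cons b (Fin.cons a m) : Fin (k + 2) → V) ∘ Equiv.swap 0 1
        = Fin.cons a (Fin.cons b m) := by
      funext i
      refine Fin.cases ?_ (fun i => Fin.cases ?_ (fun i => ?_) i) i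
      · simp
      · have : (Fin.succ (0 : Fin (k + 1))) = 1 := rfl
        simp [this]
      · rw [Function.comp_apply, Equiv.swap_apply_of_ne_of_ne (by simp)
          (by simp [Fin.ext_iff])]
        rfl
    rw [h2] at h
    exact h
  ext m
  simp only [contractBar_apply, ContinuousAlternatingMap.neg_apply]
  rw [hs w v, hs (Complex.I • w) v, hs w (Complex.I • v), hs (Complex.I • w) (Complex.I • v)]
  module

lemma contractBar_self (v : V) (η : V [⋀^Fin (k + 2)]→L[ℝ] W) :
    contractBar v (contractBar v η) = 0 := by
  have h := eq_neg_iff_add_eq_zero.1 (contractBar_anticomm v v η)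
  have h2 : contractBar v (contractBar v η) =
      (1 / 2 : ℂ) • (contractBar v (contractBar v η) + contractBar v (contractBar v η)) := by
    module
  rw [h2, h, smul_zero]

lemma removeNth_succ_cons {A : Type*} (i : Fin (k + 1)) (a : A) (m : Fin (k + 1) → A) :
    i.succ.removeNth (Fin.cons a m : Fin (k + 2) → A) = Fin.cons a (i.removeNth m) := by
  funext j
  refine Fin.cases ?_ (fun j => ?_) j <;> simp [Fin.removeNth]

/-- A Cartan formula for the contraction of an alternatization. -/
lemma contractBar_alternatize (v : V) (L : V →L[ℝ] V [⋀^Fin (k + 1)]→L[ℝ] W)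
    (hL : L (Complex.I • v) = -(Complex.I • L v)) :
    contractBar v (ContinuousAlternatingMap.alternatizeUncurryFin L)
      = L v - ContinuousAlternatingMap.alternatizeUncurryFin (contractBar v ∘L L) := by
  ext m
  -- In the alternating sum the index 0 feeds `w` to `L`; every other index keeps `w` in the first
  -- slot of the form and has its sign reversed by the shift.
  have key : ∀ w, ContinuousAlternatingMap.alternatizeUncurryFin L (Fin.cons w m)
      = L w m - ∑ i : Fin (k + 1), (-1 : ℤ) ^ (i : ℕ) • L (m i) (Fin.cons w (i.removeNth m)) := by
    intro w
    rw [ContinuousAlternatingMap.alternatizeUncurryFin_apply, Fin.sum_univ_succ, sub_eq_add_neg,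
      ← Finset.sum_neg_distrib]
    congr 1
    · simp
    · refine Finset.sum_congr rfl fun i _ => ?_
      rw [Fin.val_succ, pow_succ, mul_neg_one, neg_smul, Fin.cons_succ,
        removeNth_succ_cons]
  rw [contractBar_apply, key, key, hL, ContinuousAlternatingMap.sub_apply,
    ContinuousAlternatingMap.alternatizeUncurryFin_apply]
  simp only [ContinuousLinearMap.comp_apply, contractBar_apply,
    ContinuousAlternatingMap.neg_apply, ContinuousAlternatingMap.smul_apply]
  have e : ∑ i : Fin (k + 1), (-1 : ℤ) ^ (i : ℕ) • (1 / 2 : ℂ) •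
      (L (m i) (Fin.cons v (i.removeNth m))
        + Complex.I • L (m i) (Fin.cons (Complex.I • v) (i.removeNth m)))
      = (1 / 2 : ℂ) • ((∑ i : Fin (k + 1), (-1 : ℤ) ^ (i : ℕ) •
          L (m i) (Fin.cons v (i.removeNth m))) + Complex.I • ∑ i : Fin (k + 1),
            (-1 : ℤ) ^ (i : ℕ) • L (m i) (Fin.cons (Complex.I • v) (i.removeNth m))) := by
    rw [Finset.smul_sum, ← Finset.sum_add_distrib, Finset.smul_sum]
    refine Finset.sum_congr rfl fun i _ => ?_
    rw [smul_comm _ (1 / 2 : ℂ), smul_add, smul_comm _ Complex.I]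
  rw [e]
  match_scalars
  · linear_combination (-1 / 2 : ℂ) * Complex.I_sq
  · ring
  · ring

/-- The Cartan formula in degree 0, where the second term is absent because a function has nothing
to contract. -/
lemma contractBar_alternatize_zero (v : V) (L : V →L[ℝ] V [⋀^Fin 0]→L[ℝ] W)
    (hL : L (Complex.I • v) = -(Complex.I • L v)) :
    contractBar v (ContinuousAlternatingMap.alternatizeUncurryFin L) = L v := by
  ext m
  rw [contractBar_apply]
  simp only [ContinuousAlternatingMap.alternatizeUncurryFin_apply, Fin.sum_univ_succ,
    Finset.univ_eq_empty, Finset.sum_empty, Fin.val_zero, pow_zero, one_smul, add_zero,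
    Fin.cons_zero, Fin.removeNth_zero, Fin.tail_cons, hL]
  simp only [ContinuousAlternatingMap.neg_apply, ContinuousAlternatingMap.smul_apply]
  match_scalars
  linear_combination (-1 / 2 : ℂ) * Complex.I_sq

lemma ofType_alternatize {p q : ℕ} (L : V →L[ℝ] V [⋀^Fin k]→L[ℝ] W)
    (hL : ∀ v, L (Complex.I • v) = -(Complex.I • L v)) (h : ∀ v, OfType (L v) p q) :
    OfType (ContinuousAlternatingMap.alternatizeUncurryFin L) p (q + 1) := by
  have hc : ∀ (c : ℂ) v, L (c • v) = starRingEnd ℂ c • L v := by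
    intro c v
    have hc : c • v = c.re • v + c.im • (Complex.I • v) := by
      conv_lhs => rw [← Complex.re_add_im c]
      rw [add_smul, mul_smul]
      rfl
    have hc' : starRingEnd ℂ c = c.re - c.im * Complex.I := by
      apply Complex.ext <;> simp
    rw [hc, map_add, map_smul, map_smul, hL, hc', sub_smul, mul_smul, smul_neg, sub_eq_add_neg]
    rfl
  intro c m
  simp only [ContinuousAlternatingMap.alternatizeUncurryFin_apply, Finset.smul_sum, hc]
  refine Finset.sum_congr rfl fun i _ => ?_
  have := h (m i) c (i.removeNth m)
  rw [ContinuousAlternatingMap.smul_apply]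
  change _ • starRingEnd ℂ c • L (m i) (fun j => c • i.removeNth m j) = _
  rw [this, smul_comm _ ((-1 : ℤ) ^ (i : ℕ)), smul_smul (starRingEnd ℂ c)]
  congr 2
  ring

/-- The projection to the component of type `(k - q, q)` as a continuous linear map. -/
def typeProjL (k q : ℕ) : (V [⋀^Fin k]→L[ℝ] W) →L[ℝ] (V [⋀^Fin k]→L[ℝ] W) :=
  ∑ m, typeWeight k q m • ContinuousAlternatingMap.compContinuousLinearMapCLM
    (typePoint k q m • ContinuousLinearMap.id ℝ V)

lemma typeProjL_apply (q : ℕ) (η : V [⋀^Fin k]→L[ℝ] W) : typeProjL k q η = typeProj k q η := by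
  simp only [typeProjL, sum_apply]
  rfl

end Contraction

end Types

end

noncomputable section

/-! ### Parametric integrals and the Cauchy transform along a complex line -/

section Parametric

variable {V W : Type u} [NormedAddCommGroup V] [NormedSpace ℝ V] [FiniteDimensional ℝ V]
  [NormedAddCommGroup W] [NormedSpace ℝ W] [CompleteSpace W]

/-- Differentiation under the integral: the derivative is bounded on the compact set (closed unit
ball about z) × [a, b], and that bound dominates. -/
lemma hasFDerivAt_intervalIntegral {F : V × ℝ → W} (hF : ContDiff ℝ 1 F) (a b : ℝ) (z : V) :
    HasFDerivAt (fun z => ∫ t in a..b, F (z, t))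
      (∫ t in a..b, (fderiv ℝ F (z, t)).comp (ContinuousLinearMap.inl ℝ V ℝ)) z := by
  have hc : Continuous F := hF.continuous
  have hc' : Continuous fun p : V × ℝ => (fderiv ℝ F p).comp (ContinuousLinearMap.inl ℝ V ℝ) :=
    (hF.continuous_fderiv one_ne_zero).clm_comp continuous_const
  have : ProperSpace V := FiniteDimensional.proper ℝ V
  obtain ⟨C, hC⟩ := ((isCompact_closedBall z 1).prod (isCompact_uIcc (a := a) (b := b))
    ).exists_bound_of_continuousOn hc'.continuousOn
  refine intervalIntegral.hasFDerivAt_integral_of_dominated_of_fderiv_le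
    (F := fun z t => F (z, t))
    (F' := fun z t => (fderiv ℝ F (z, t)).comp (ContinuousLinearMap.inl ℝ V ℝ))
    (bound := fun _ => C) (Metric.closedBall_mem_nhds z one_pos) ?_ ?_ ?_ ?_ ?_ ?_
  · exact Filter.Eventually.of_forall fun x =>
      (hc.comp (Continuous.prodMk_right x)).aestronglyMeasurable
  · exact (hc.comp (Continuous.prodMk_right z)).intervalIntegrable _ _
  · exact (hc'.comp (Continuous.prodMk_right z)).aestronglyMeasurable
  · exact Filter.Eventually.of_forall fun t ht x hx =>
      hC (x, t) ⟨hx, Set.uIoc_subset_uIcc ht⟩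
  · exact intervalIntegrable_const
  · refine Filter.Eventually.of_forall fun t _ x _ => ?_
    exact ((hF.differentiable one_ne_zero (x, t)).hasFDerivAt).comp x (hasFDerivAt_prodMk_left x t)

/-- The derivative of a parametric integral is again one, with values in V →L W. The target
therefore varies in the induction, and V and W share a universe so that the target stays in it. -/
lemma contDiff_intervalIntegral_nat (n : ℕ) : ∀ {W : Type u} [NormedAddCommGroup W]
    [NormedSpace ℝ W] [CompleteSpace W] {F : V × ℝ → W} (_ : ContDiff ℝ ∞ F) (a b : ℝ),
    ContDiff ℝ n fun z => ∫ t in a..b, F (z, t) := by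
  induction n with
  | zero =>
    intro W _ _ _ F hF a b
    refine contDiff_zero.2 ?_
    exact continuous_iff_continuousAt.2 fun z =>
      (hasFDerivAt_intervalIntegral (hF.of_le (by norm_cast)) a b z).continuousAt
  | succ n ih =>
    intro W _ _ _ F hF a b
    refine contDiff_succ_iff_hasFDerivAt.2 ⟨_, ?_, fun z =>
      hasFDerivAt_intervalIntegral (hF.of_le (by norm_cast)) a b z⟩
    refine ih (F := fun p => (fderiv ℝ F p).comp (ContinuousLinearMap.inl ℝ V ℝ)) ?_ a b
    exact (hF.fderiv_right (m := ∞) (by simp)).clm_comp contDiff_const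

lemma ContDiff.intervalIntegral_param {F : V × ℝ → W} (hF : ContDiff ℝ ∞ F) (a b : ℝ) :
    ContDiff ℝ ∞ fun z => ∫ t in a..b, F (z, t) :=
  contDiff_infty.2 fun n => contDiff_intervalIntegral_nat n hF a b

end Parametric

/-! ### The Cauchy transform along a complex line -/

section CauchyTransform

variable {V W W' : Type u} [NormedAddCommGroup V] [NormedSpace ℂ V]
  [NormedAddCommGroup W] [NormedSpace ℂ W] [CompleteSpace W]
  [NormedAddCommGroup W'] [NormedSpace ℂ W'] [CompleteSpace W']

open Complex MeasureTheory

/-- The integrand, in polar coordinates, of the Cauchy transform. -/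
def cauchyIntegrand (v : V) (f : V → W) (z : V) (θ r : ℝ) : W :=
  exp (-(θ * I)) • f (z - (r * exp (θ * I)) • v)

/-- The convolution of `f` with the Cauchy kernel along the complex line spanned by `v`,
truncated at radius `R`. -/
def cauchyT (R : ℝ) (v : V) (f : V → W) (z : V) : W :=
  (Real.pi⁻¹ : ℂ) • ∫ θ in (0 : ℝ)..(2 * Real.pi), ∫ r in (0 : ℝ)..R, cauchyIntegrand v f z θ r

/-- With ζ = r e^{iθ}, the area element r dr dθ cancels the pole of 1/ζ and leaves the factor
e^{-iθ}. The integrand is as smooth as `f`, and no singular integral occurs. -/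
lemma contDiff_cauchyIntegrand {n : WithTop ℕ∞} {f : V → W} (hf : ContDiff ℝ n f) (v : V) :
    ContDiff ℝ n fun p : (V × ℝ) × ℝ => cauchyIntegrand v f p.1.1 p.1.2 p.2 := by
  have hθ : ContDiff ℝ n fun p : (V × ℝ) × ℝ => ((p.1.2 : ℝ) : ℂ) :=
    ofRealCLM.contDiff.comp (contDiff_snd.comp contDiff_fst)
  have hr : ContDiff ℝ n fun p : (V × ℝ) × ℝ => ((p.2 : ℝ) : ℂ) :=
    ofRealCLM.contDiff.comp contDiff_snd
  have he : ContDiff ℝ n fun p : (V × ℝ) × ℝ => exp (p.1.2 * I) :=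
    (hθ.mul contDiff_const).cexp
  have he' : ContDiff ℝ n fun p : (V × ℝ) × ℝ => exp (-(p.1.2 * I)) :=
    (hθ.mul contDiff_const).neg.cexp
  exact he'.smul (hf.comp ((contDiff_fst.comp contDiff_fst).sub
    ((hr.mul he).smul contDiff_const)))

lemma continuous_cauchyIntegrand {f : V → W} (hf : Continuous f) (v : V) :
    Continuous fun p : (V × ℝ) × ℝ => cauchyIntegrand v f p.1.1 p.1.2 p.2 :=
  (contDiff_cauchyIntegrand (n := 0) (contDiff_zero.2 hf) v).continuous

lemma continuous_integral_cauchyIntegrand {f : V → W} (hf : Continuous f) (v z : V) (R : ℝ) :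
    Continuous fun θ => ∫ r in (0 : ℝ)..R, cauchyIntegrand v f z θ r :=
  intervalIntegral.continuous_parametric_intervalIntegral_of_continuous'
    (f := fun θ r => cauchyIntegrand v f z θ r) (by
      exact (continuous_cauchyIntegrand hf v).comp
        (((continuous_const (y := z)).prodMk continuous_fst).prodMk continuous_snd)) 0 R

lemma continuous_cauchyIntegrand_right {f : V → W} (hf : Continuous f) (v z : V) (θ : ℝ) :
    Continuous fun r => cauchyIntegrand v f z θ r :=
  (continuous_cauchyIntegrand hf v).comp (Continuous.prodMk_right (z, θ))

/-- The Cauchy transform commutes with linear maps. -/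
lemma cauchyT_comp (A : W →L[ℂ] W') {f : V → W} (hf : Continuous f) (R : ℝ) (v z : V) :
    cauchyT R v (fun z => A (f z)) z = A (cauchyT R v f z) := by
  simp only [cauchyT, map_smul]
  congr 1
  rw [← A.intervalIntegral_comp_comm
    ((continuous_integral_cauchyIntegrand hf v z R).intervalIntegrable _ _)]
  refine intervalIntegral.integral_congr fun θ _ => ?_
  rw [← A.intervalIntegral_comp_comm
    ((continuous_cauchyIntegrand_right hf v z θ).intervalIntegrable _ _)]
  refine intervalIntegral.integral_congr fun r _ => ?_
  simp [cauchyIntegrand]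

lemma cauchyT_zero (R : ℝ) (v z : V) : cauchyT R v (fun _ => (0 : W)) z = 0 := by
  simp [cauchyT, cauchyIntegrand]

variable [FiniteDimensional ℂ V]

lemma contDiff_cauchyT {f : V → W} (hf : ContDiff ℝ ∞ f) (R : ℝ) (v : V) :
    ContDiff ℝ ∞ (cauchyT R v f) := by
  have := FiniteDimensional.complexToReal V
  exact (ContDiff.intervalIntegral_param (F := fun p : V × ℝ => ∫ r in (0 : ℝ)..R,
    cauchyIntegrand v f p.1 p.2 r)
    (ContDiff.intervalIntegral_param (V := V × ℝ) (contDiff_cauchyIntegrand hf v) _ _) _ _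
    ).const_smul _

lemma fderiv_cauchyIntegrand {f : V → W} (hf : ContDiff ℝ 1 f) (v z : V) (θ r : ℝ) :
    HasFDerivAt (fun z => cauchyIntegrand v f z θ r)
      (cauchyIntegrand v (fderiv ℝ f) z θ r) z := by
  have h := ((hf.differentiable one_ne_zero (z - (r * exp (θ * I)) • v)).hasFDerivAt).comp z
    ((hasFDerivAt_id z).sub_const _)
  have h' := h.const_smul (exp (-(θ * I)))
  exact h'

lemma fderiv_cauchyT {f : V → W} (hf : ContDiff ℝ ∞ f) (R : ℝ) (v z : V) :
    fderiv ℝ (cauchyT R v f) z = cauchyT R v (fderiv ℝ f) z := by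
  have := FiniteDimensional.complexToReal V
  have hf1 : ContDiff ℝ 1 f := hf.of_le (by norm_cast)
  have h1 := ContDiff.intervalIntegral_param (V := V × ℝ) (contDiff_cauchyIntegrand hf v) 0 R
  have h2 := hasFDerivAt_intervalIntegral
    (h1.of_le (by norm_cast) : ContDiff ℝ 1 _) 0 (2 * Real.pi) z
  have h3 := (h2.const_smul (Real.pi⁻¹ : ℂ)).fderiv
  refine h3.trans ?_
  simp only [cauchyT]
  congr 1
  refine intervalIntegral.integral_congr fun θ _ => ?_
  -- `hA` differentiates the inner integral in (z, θ) jointly, `hB` in z alone; uniqueness of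
  -- derivatives identifies the restriction of the first with the second.
  have hA := hasFDerivAt_intervalIntegral (V := V × ℝ)
    (contDiff_cauchyIntegrand hf1 v) 0 R (z, θ)
  have hB := hasFDerivAt_intervalIntegral (V := V) (F := fun p : V × ℝ =>
    cauchyIntegrand v f p.1 θ p.2) (by
      exact (contDiff_cauchyIntegrand hf1 v).comp
        ((contDiff_fst.prodMk contDiff_const).prodMk contDiff_snd)) 0 R z
  have hC := HasFDerivAt.comp (f := fun e : V => (e, θ)) z hA (hasFDerivAt_prodMk_left z θ)
  rw [hA.fderiv]
  refine (hC.unique hB).trans ?_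
  refine intervalIntegral.integral_congr fun r _ => ?_
  have hD : HasFDerivAt (fun p : V × ℝ => cauchyIntegrand v f p.1 θ p.2) _ (z, r) :=
    (((contDiff_cauchyIntegrand hf1 v).comp
        ((contDiff_fst.prodMk contDiff_const).prodMk contDiff_snd)).differentiable one_ne_zero
        (z, r)).hasFDerivAt
  exact (HasFDerivAt.comp (f := fun e : V => (e, r)) z hD (hasFDerivAt_prodMk_left z r)).unique (fderiv_cauchyIntegrand hf1 v z θ r)

/-- The map `L ↦ antilinearPart L w`. -/
def antilinearPartL (V W : Type*) [NormedAddCommGroup V] [NormedSpace ℂ V]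
    [NormedAddCommGroup W] [NormedSpace ℂ W] (w : V) : (V →L[ℝ] W) →L[ℂ] W where
  toFun L := antilinearPart L w
  map_add' L M := by rw [antilinearPart_add]; rfl
  map_smul' c L := by rw [antilinearPart_smul]; rfl
  cont := by
    simp only [antilinearPart_apply]
    fun_prop

lemma antilinearPartL_apply (w : V) (L : V →L[ℝ] W) :
    antilinearPartL V W w L = antilinearPart L w := rfl

/-- The Cauchy transform commutes with the antiholomorphic derivatives. -/
lemma antilinearPart_fderiv_cauchyT {f : V → W} (hf : ContDiff ℝ ∞ f) (R : ℝ) (v z w : V) :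
    antilinearPart (fderiv ℝ (cauchyT R v f) z) w
      = cauchyT R v (fun z => antilinearPart (fderiv ℝ f z) w) z := by
  rw [fderiv_cauchyT hf, ← antilinearPartL_apply, ← cauchyT_comp _ (hf.continuous_fderiv (by simp))]
  rfl

/-- A Cauchy transform inverts the antiholomorphic derivative in the same direction. -/
lemma cauchyT_antilinearPart_fderiv {f : V → W} (hf : ContDiff ℝ ∞ f) {R : ℝ} (hR : 0 < R)
    (v z : V) (h0 : ∀ θ : ℝ, f (z - (R * exp (θ * I)) • v) = 0) :
    cauchyT R v (fun z => antilinearPart (fderiv ℝ f z) v) z = f z := by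
  have hf1 : ContDiff ℝ 1 f := hf.of_le (by norm_cast)
  let w : ℝ → ℝ → V := fun θ r => z - (r * exp (θ * I)) • v
  -- Along the circles z - r e^{iθ} v, `P` is the radial derivative of `f` and r · `H` the angular
  -- one. `hint` is the expression of ∂̄ along `v` in polar coordinates.
  let P : ℝ → ℝ → W := fun θ r => fderiv ℝ f (w θ r) (-(exp (θ * I) • v))
  let H : ℝ → ℝ → W := fun θ r => fderiv ℝ f (w θ r) (-((I * exp (θ * I)) • v))
  have hw : Continuous fun p : ℝ × ℝ => w p.1 p.2 := by fun_prop
  have hf' : Continuous (fderiv ℝ f) := hf1.continuous_fderiv one_ne_zero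
  have hP : Continuous fun p : ℝ × ℝ => P p.1 p.2 := (hf'.comp hw).clm_apply (by fun_prop)
  have hH : Continuous fun p : ℝ × ℝ => H p.1 p.2 := (hf'.comp hw).clm_apply (by fun_prop)
  have hint : ∀ θ r, cauchyIntegrand v (fun z => antilinearPart (fderiv ℝ f z) v) z θ r
      = -(1 / 2 : ℂ) • (P θ r + I • H θ r) := by
    intro θ r
    have hL : ∀ L : V →L[ℝ] W, exp (-(θ * I)) • antilinearPart L v
        = (1 / 2 : ℂ) • (L (exp (θ * I) • v) + I • L ((I * exp (θ * I)) • v)) := by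
      intro L
      have he : exp (θ * I) = (Real.cos θ : ℂ) + (Real.sin θ : ℂ) * I := by
        rw [exp_mul_I, ofReal_cos, ofReal_sin]
      have he' : exp (-(θ * I)) = (Real.cos θ : ℂ) - (Real.sin θ : ℂ) * I := by
        rw [← neg_mul, exp_mul_I, cos_neg, sin_neg, ofReal_cos, ofReal_sin]
        ring
      have h1 : exp (θ * I) • v = Real.cos θ • v + Real.sin θ • (I • v) := by
        rw [he, add_smul, mul_smul]; rfl
      have h2 : (I * exp (θ * I)) • v = Real.cos θ • (I • v) - Real.sin θ • v := by
        rw [he, show I * ((Real.cos θ : ℂ) + (Real.sin θ : ℂ) * I)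
          = (Real.cos θ : ℂ) * I - (Real.sin θ : ℂ) by
            linear_combination (Real.sin θ : ℂ) * I_mul_I, sub_smul, mul_smul]
        rfl
      have hr : ∀ (a : ℝ) (x : W), a • x = (a : ℂ) • x := fun a x => rfl
      rw [h1, h2, he', antilinearPart_apply]
      simp only [map_add, map_sub, map_smul, hr]
      generalize Real.sin θ = s
      match_scalars
      · ring
      · linear_combination (-(1 / 2 : ℂ) * (s : ℂ)) * I_mul_I
    simp only [cauchyIntegrand, hL, P, H, w, map_neg]
    module
  have hdP : ∀ θ r, HasDerivAt (fun r : ℝ => f (w θ r)) (P θ r) r := by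
    intro θ r
    refine ((hf1.differentiable one_ne_zero (w θ r)).hasFDerivAt).comp_hasDerivAt r ?_
    have := ((((hasDerivAt_id r).ofReal_comp).mul_const (exp (θ * I))).smul_const v).const_sub z
    simpa using this
  have hdH : ∀ r θ, HasDerivAt (fun θ : ℝ => f (w θ r)) (r • H θ r) θ := by
    intro r θ
    have h1 : HasDerivAt (fun θ : ℝ => w θ r) (r • (-((I * exp (θ * I)) • v))) θ := by
      have := ((((((hasDerivAt_id θ).ofReal_comp).mul_const I).cexp).const_mul
        (r : ℂ)).smul_const v).const_sub z
      convert! this using 1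
      rw [smul_neg, ← coe_smul, smul_smul]
      simp only [id, ofReal_one]
      congr 2
      ring
    have := ((hf1.differentiable one_ne_zero (w θ r)).hasFDerivAt).comp_hasDerivAt θ h1
    rwa [map_smul] at this
  -- The radial integral telescopes to f at radius R minus f(z), and the outer value is zero by
  -- `h0`.
  have hPi : ∀ θ, ∫ r in (0 : ℝ)..R, P θ r = - f z := by
    intro θ
    rw [intervalIntegral.integral_eq_sub_of_hasDerivAt (fun r _ => hdP θ r)
      ((hP.comp (Continuous.prodMk_right θ)).intervalIntegrable _ _)]
    simp [w, h0]
  have hHi : ∀ r ≠ 0, ∫ θ in (0 : ℝ)..(2 * Real.pi), H θ r = 0 := by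
    intro r hr
    have h1 := intervalIntegral.integral_eq_sub_of_hasDerivAt (a := 0) (b := 2 * Real.pi)
      (fun θ _ => hdH r θ)
      (((hH.comp (Continuous.prodMk_left r)).const_smul r).intervalIntegrable _ _)
    rw [intervalIntegral.integral_smul] at h1
    have h2 : w (2 * Real.pi) r = w 0 r := by
      simp [w]
    rw [h2, sub_self, smul_eq_zero] at h1
    exact h1.resolve_left hr
  -- After exchanging the integrals the angular one vanishes by periodicity. That argument divides
  -- by r, which is harmless since the radial integral runs over (0, R].
  have hHi' : ∫ θ in (0 : ℝ)..(2 * Real.pi), ∫ r in (0 : ℝ)..R, H θ r = 0 := by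
    rw [intervalIntegral_intervalIntegral_swap]
    · refine (intervalIntegral.integral_congr_ae (g := fun _ => (0 : W)) ?_).trans (by simp)
      refine Filter.Eventually.of_forall fun r hr => hHi r ?_
      rw [Set.uIoc_of_le hR.le] at hr
      exact hr.1.ne'
    · exact (hH.continuousOn.integrableOn_compact (isCompact_uIcc.prod isCompact_uIcc)).mono_set
        (Set.prod_mono Set.uIoc_subset_uIcc Set.uIoc_subset_uIcc)
  have hPc : Continuous fun θ => ∫ r in (0 : ℝ)..R, P θ r :=
    intervalIntegral.continuous_parametric_intervalIntegral_of_continuous' hP 0 R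
  have hHc : Continuous fun θ => ∫ r in (0 : ℝ)..R, H θ r :=
    intervalIntegral.continuous_parametric_intervalIntegral_of_continuous' hH 0 R
  have hin : ∀ θ, ∫ r in (0 : ℝ)..R,
      cauchyIntegrand v (fun z => antilinearPart (fderiv ℝ f z) v) z θ r
      = -(1 / 2 : ℂ) • ((∫ r in (0 : ℝ)..R, P θ r) + I • ∫ r in (0 : ℝ)..R, H θ r) := by
    intro θ
    simp only [hint]
    have h1 : Continuous fun r => P θ r := hP.comp (Continuous.prodMk_right θ)
    have h2 : Continuous fun r => I • H θ r :=
      (hH.comp (Continuous.prodMk_right θ)).const_smul I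
    rw [intervalIntegral.integral_smul, intervalIntegral.integral_add
      (h1.intervalIntegrable _ _) (h2.intervalIntegrable _ _),
      intervalIntegral.integral_smul]
  have hHc' : Continuous fun θ => I • ∫ r in (0 : ℝ)..R, H θ r := hHc.const_smul I
  simp only [cauchyT, hin]
  rw [intervalIntegral.integral_smul, intervalIntegral.integral_add
      (hPc.intervalIntegrable _ _) (hHc'.intervalIntegrable _ _),
      intervalIntegral.integral_smul, hHi']
  simp only [hPi, intervalIntegral.integral_const, smul_zero, add_zero, sub_zero]
  -- The constants combine as π⁻¹ · (-1/2) · 2π · (-f z) = f z.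
  rw [← coe_smul, smul_neg, smul_smul, smul_neg, smul_smul, ← neg_smul]
  convert! one_smul ℂ (f z) using 2
  have : (Real.pi : ℂ) ≠ 0 := ofReal_ne_zero.2 Real.pi_ne_zero
  push_cast
  field_simp

end CauchyTransform

end

noncomputable section

/-! ### The operator `∂̄` on vector spaces -/

section DbarFlat

variable {V W W' : Type*} [NormedAddCommGroup V] [NormedSpace ℂ V]
  [NormedAddCommGroup W] [NormedSpace ℂ W] [NormedAddCommGroup W'] [NormedSpace ℂ W'] {k : ℕ}

instance instNormedAddCommGroupCLMAlternating : NormedAddCommGroup (V →L[ℝ] V [⋀^Fin k]→L[ℝ] W) :=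
  ContinuousLinearMap.toNormedAddCommGroup

lemma antilinearPart_I_smul (L : V →L[ℝ] W) (v : V) :
    antilinearPart L (Complex.I • v) = -(Complex.I • antilinearPart L v) := by
  have hI : Complex.I • Complex.I • v = -v := by
    rw [smul_smul, Complex.I_mul_I]
    simp
  rw [antilinearPart_apply, antilinearPart_apply, hI, map_neg]
  generalize L (Complex.I • v) = B
  generalize L v = A
  match_scalars
  · linear_combination (1 / 2 : ℂ) * Complex.I_mul_I
  · ring

lemma antilinearPart_comp (A : W →L[ℂ] W') (L : V →L[ℝ] W) :
    antilinearPart (A.restrictScalars ℝ ∘L L) = A.restrictScalars ℝ ∘L antilinearPart L := by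
  ext v
  simp [antilinearPart_apply]

@[simp] lemma antilinearPart_zero : antilinearPart (0 : V →L[ℝ] W) = 0 := by
  ext v
  simp [antilinearPart_apply]

lemma antilinearPart_restrictScalars (L : V →L[ℂ] W) :
    antilinearPart (L.restrictScalars ℝ) = 0 := by
  ext v
  simp [antilinearPart_apply, smul_smul]

/-- The complex antilinear part as a continuous linear map. -/
def antilinearPartCLM (V W : Type*) [NormedAddCommGroup V] [NormedSpace ℂ V]
    [NormedAddCommGroup W] [NormedSpace ℂ W] : (V →L[ℝ] W) →L[ℝ] (V →L[ℝ] W) :=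
  (1 / 2 : ℂ) • (ContinuousLinearMap.id ℝ _ + Complex.I •
    (ContinuousLinearMap.compL ℝ V V W).flip (Complex.I • ContinuousLinearMap.id ℝ V))

lemma antilinearPartCLM_apply (L : V →L[ℝ] W) : antilinearPartCLM V W L = antilinearPart L := rfl

/-- Alternatization as a complex linear map. -/
def alternatizeC (V W : Type*) [NormedAddCommGroup V] [NormedSpace ℂ V]
    [NormedAddCommGroup W] [NormedSpace ℂ W] (k : ℕ) :
    (V →L[ℝ] V [⋀^Fin k]→L[ℝ] W) →L[ℂ] V [⋀^Fin (k + 1)]→L[ℝ] W where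
  toFun := ContinuousAlternatingMap.alternatizeUncurryFin
  map_add' _ _ := ContinuousAlternatingMap.alternatizeUncurryFin_add _ _
  map_smul' _ _ := alternatizeUncurryFin_smul_complex _ _
  cont := (ContinuousAlternatingMap.alternatizeUncurryFinCLM ℝ V W).continuous

/-- `contractBar` as a complex linear map. -/
def contractBarC (v : V) : (V [⋀^Fin (k + 1)]→L[ℝ] W) →L[ℂ] V [⋀^Fin k]→L[ℝ] W where
  toFun := contractBar v
  map_add' := map_add _
  map_smul' c η := by
    ext m
    simp only [contractBar_apply, ContinuousAlternatingMap.smul_apply, RingHom.id_apply]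
    module
  cont := (contractBar v).continuous

/-- `typeProj` as a continuous complex linear map. -/
def typeProjC (k q : ℕ) : (V [⋀^Fin k]→L[ℝ] W) →L[ℂ] (V [⋀^Fin k]→L[ℝ] W) where
  toLinearMap := typeProj k q
  cont := by
    refine ((typeProjL (V := V) (W := W) k q).continuous).congr fun η => ?_
    exact typeProjL_apply q η

lemma typeProjC_apply (q : ℕ) (η : V [⋀^Fin k]→L[ℝ] W) : typeProjC k q η = typeProj k q η := rfl

lemma dbarFlat_def (η : V → V [⋀^Fin k]→L[ℝ] W) (z : V) :
    dbarFlat η z = ContinuousAlternatingMap.alternatizeUncurryFin (antilinearPart (fderiv ℝ η z)) := rfl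

lemma dbarFlat_congr {η η' : V → V [⋀^Fin k]→L[ℝ] W} {z : V} (h : η =ᶠ[𝓝 z] η') :
    dbarFlat η z = dbarFlat η' z := by
  rw [dbarFlat_def, h.fderiv_eq]; rfl

lemma dbarFlat_add {η η' : V → V [⋀^Fin k]→L[ℝ] W} {z : V} (h : DifferentiableAt ℝ η z)
    (h' : DifferentiableAt ℝ η' z) :
    dbarFlat (fun z => η z + η' z) z = dbarFlat η z + dbarFlat η' z := by
  simp only [dbarFlat_def]
  rw [fderiv_fun_add h h', antilinearPart_add, ContinuousAlternatingMap.alternatizeUncurryFin_add]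

lemma dbarFlat_smul (c : ℂ) (η : V → V [⋀^Fin k]→L[ℝ] W) (z : V) :
    dbarFlat (fun z => c • η z) z = c • dbarFlat η z := by
  have h := congrFun (fderiv_const_smul_field (𝕜 := ℝ) (f := η) c) z
  rw [dbarFlat_def]
  erw [h]
  rw [Pi.smul_apply, antilinearPart_smul, alternatizeUncurryFin_smul_complex]
  rfl

lemma dbarFlat_sub {η η' : V → V [⋀^Fin k]→L[ℝ] W} {z : V} (h : DifferentiableAt ℝ η z)
    (h' : DifferentiableAt ℝ η' z) :
    dbarFlat (fun z => η z - η' z) z = dbarFlat η z - dbarFlat η' z := by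
  have h1 := dbarFlat_add h (h'.const_smul (-1 : ℂ))
  have h2 := dbarFlat_smul (-1) η' z
  simp only [neg_smul, one_smul] at h1 h2
  simp only [sub_eq_add_neg]
  rw [← h2]
  exact h1

lemma dbarFlat_sum {ι : Type*} (s : Finset ι) {η : ι → V → V [⋀^Fin k]→L[ℝ] W} {z : V}
    (h : ∀ i ∈ s, DifferentiableAt ℝ (η i) z) :
    dbarFlat (fun z => ∑ i ∈ s, η i z) z = ∑ i ∈ s, dbarFlat (η i) z := by
  simp only [dbarFlat_def]
  rw [fderiv_fun_sum h]
  simp only [← antilinearPartCLM_apply, map_sum]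
  exact map_sum (ContinuousAlternatingMap.alternatizeUncurryFinCLM ℝ V W) _ _

lemma ContDiffAt.dbarFlat {η : V → V [⋀^Fin k]→L[ℝ] W} {z : V} (h : ContDiffAt ℝ ∞ η z) :
    ContDiffAt ℝ ∞ (dbarFlat η) z :=
  ((ContinuousAlternatingMap.alternatizeUncurryFinCLM ℝ V W) ∘L antilinearPartCLM V _).contDiff.contDiffAt.comp z
    (h.fderiv_right (m := ∞) (by simp))

/-- Second derivatives are symmetric, hence so is the part antilinear in both variables; alternating
it twice gives zero. -/
lemma dbarFlat_dbarFlat {η : V → V [⋀^Fin k]→L[ℝ] W} {z : V} (h : ContDiffAt ℝ ∞ η z) :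
    dbarFlat (dbarFlat η) z = 0 := by
  have h1 : DifferentiableAt ℝ (fderiv ℝ η) z :=
    (h.fderiv_right (m := 1) (by norm_cast)).differentiableAt one_ne_zero
  have h2 : fderiv ℝ (dbarFlat η) z = ((alternatizeC V W k).restrictScalars ℝ) ∘L
      (antilinearPartCLM V _ ∘L fderiv ℝ (fderiv ℝ η) z) :=
    (((ContinuousAlternatingMap.alternatizeUncurryFinCLM ℝ V W) ∘L antilinearPartCLM V _).hasFDerivAt.comp z
      h1.hasFDerivAt).fderiv
  have hs : IsSymmSndFDerivAt ℝ η z :=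
    h.isSymmSndFDerivAt (by
      rw [minSmoothness_of_isRCLikeNormedField]
      norm_cast)
  have h3 := antilinearPart_comp (W := V →L[ℝ] V [⋀^Fin k]→L[ℝ] W) (alternatizeC V W k)
    (antilinearPartCLM V _ ∘L fderiv ℝ (fderiv ℝ η) z)
  rw [dbarFlat_def, h2, h3]
  refine ContinuousAlternatingMap.alternatizeUncurryFin_alternatizeUncurryFinCLM_comp_of_symmetric (𝕜 := ℝ) (E := V) (F := W)
    fun v w => ?_
  simp only [antilinearPart_apply, ContinuousLinearMap.comp_apply, antilinearPartCLM_apply,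
    _root_.add_apply, _root_.smul_apply]
  rw [hs.eq w v, hs.eq w (Complex.I • v), hs.eq (Complex.I • w) v,
    hs.eq (Complex.I • w) (Complex.I • v)]
  module

lemma fderiv_comp_complexLinear (A : W →L[ℂ] W') {f : V → W} {z : V} (h : DifferentiableAt ℝ f z) :
    fderiv ℝ (fun z => A (f z)) z = A.restrictScalars ℝ ∘L fderiv ℝ f z :=
  ((A.restrictScalars ℝ).hasFDerivAt.comp z h.hasFDerivAt).fderiv

/-- The Cartan formula for `∂̄` (for forms of positive degree). -/
lemma contractBar_dbarFlat {η : V → V [⋀^Fin (k + 1)]→L[ℝ] W} {z : V}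
    (h : DifferentiableAt ℝ η z) (v : V) :
    contractBar v (dbarFlat η z) =
      antilinearPart (fderiv ℝ η z) v - dbarFlat (fun z => contractBar v (η z)) z := by
  have h1 : fderiv ℝ (fun z => contractBar v (η z)) z
      = (contractBarC v).restrictScalars ℝ ∘L fderiv ℝ η z := fderiv_comp_complexLinear (contractBarC v) h
  rw [dbarFlat_def, contractBar_alternatize v _ (antilinearPart_I_smul _ v), dbarFlat_def, h1,
    antilinearPart_comp]
  rfl

lemma contractBar_dbarFlat_zero (η : V → V [⋀^Fin 0]→L[ℝ] W) (z v : V) :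
    contractBar v (dbarFlat η z) = antilinearPart (fderiv ℝ η z) v :=
  contractBar_alternatize_zero v _ (antilinearPart_I_smul _ v)

/-- Consequently a closed form without component along `v` has coefficients that are holomorphic in
the direction `v`, which is what each step of the Dolbeault lemma exploits. -/
lemma contractBar_dbarFlat_of_eq_zero {η : V → V [⋀^Fin (k + 1)]→L[ℝ] W} {z : V}
    (h : DifferentiableAt ℝ η z) {v : V} (h0 : ∀ᶠ z in 𝓝 z, contractBar v (η z) = 0) :
    contractBar v (dbarFlat η z) = antilinearPart (fderiv ℝ η z) v := by
  have h2 : (fun z => contractBar v (η z)) =ᶠ[𝓝 z] fun _ => 0 := h0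
  have hz : ContinuousAlternatingMap.alternatizeUncurryFin (0 : V →L[ℝ] V [⋀^Fin k]→L[ℝ] W) = 0 :=
    map_zero (ContinuousAlternatingMap.alternatizeUncurryFinCLM ℝ V W)
  rw [contractBar_dbarFlat h, dbarFlat_congr h2, dbarFlat_def, fderiv_const_apply,
    antilinearPart_zero, hz, sub_zero]

/-- Being of type (p, q) means being fixed by a continuous linear projection, a condition that
passes to derivatives. -/
lemma OfType.fderiv_apply {η : V → V [⋀^Fin k]→L[ℝ] W} {z : V} (h : DifferentiableAt ℝ η z)
    {p q : ℕ} (hpq : p + q = k) (ht : ∀ᶠ z in 𝓝 z, OfType (η z) p q) (w : V) :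
    OfType (fderiv ℝ η z w) p q := by
  have h1 : typeProjC k q (fderiv ℝ η z w) = fderiv ℝ η z w := by
    have h2 : (fun z => typeProjC k q (η z)) =ᶠ[𝓝 z] η := by
      filter_upwards [ht] with z hz
      rw [typeProjC_apply, hz.typeProj_eq hpq (by omega), if_pos rfl]
    have h3 := h2.fderiv_eq (𝕜 := ℝ)
    rw [fderiv_comp_complexLinear _ h] at h3
    exact congrFun (congrArg DFunLike.coe h3) w
  rw [← h1, typeProjC_apply]
  have := ofType_typeProj (fderiv ℝ η z w) (show q ≤ k by omega)
  rwa [show k - q = p by omega] at this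

lemma OfType.antilinearPart_fderiv_apply {η : V → V [⋀^Fin k]→L[ℝ] W} {z : V}
    (h : DifferentiableAt ℝ η z) {p q : ℕ} (hpq : p + q = k)
    (ht : ∀ᶠ z in 𝓝 z, OfType (η z) p q) (w : V) :
    OfType (antilinearPart (fderiv ℝ η z) w) p q := by
  rw [antilinearPart_apply]
  exact ((OfType.fderiv_apply h hpq ht _).add ((OfType.fderiv_apply h hpq ht _).smul _)).smul _

lemma OfType.dbarFlat {η : V → V [⋀^Fin k]→L[ℝ] W} {z : V} (h : DifferentiableAt ℝ η z) {p q : ℕ}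
    (hpq : p + q = k) (ht : ∀ᶠ z in 𝓝 z, OfType (η z) p q) :
    OfType (dbarFlat η z) p (q + 1) :=
  ofType_alternatize _ (antilinearPart_I_smul _) (OfType.antilinearPart_fderiv_apply h hpq ht)

/-- Decompose η by type: the component of index q contributes to ∂̄η a form of index q + 1 and
nothing else. -/
lemma typeProj_dbarFlat {η : V → V [⋀^Fin k]→L[ℝ] W} {z : V} (h : DifferentiableAt ℝ η z) {q : ℕ}
    (hq : q ≤ k) :
    typeProj (k + 1) (q + 1) (dbarFlat η z) = dbarFlat (fun z => typeProj k q (η z)) z := by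
  have hd : ∀ q, DifferentiableAt ℝ (fun z => typeProj k q (η z)) z := fun q =>
    ((typeProjC (V := V) (W := W) k q).restrictScalars ℝ).differentiableAt.comp z h
  have h1 : dbarFlat η z =
      ∑ q ∈ Finset.range (k + 1), dbarFlat (fun z => typeProj k q (η z)) z := by
    rw [← dbarFlat_sum _ fun q _ => hd q]
    simp only [sum_typeProj]
  have ht : ∀ q ≤ k, OfType (dbarFlat (fun z => typeProj k q (η z)) z) (k - q) (q + 1) :=
    fun q hq => OfType.dbarFlat (hd q) (by omega)
      (Filter.Eventually.of_forall fun z => ofType_typeProj _ hq)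
  rw [h1, map_sum, Finset.sum_eq_single q]
  · rw [(ht q hq).typeProj_eq (by omega) (by omega), if_pos rfl]
  · intro q' hq' hne
    have hq'k : q' ≤ k := by simpa [Nat.lt_succ_iff] using hq'
    rw [(ht q' hq'k).typeProj_eq (by omega) (by omega), if_neg (by omega)]
  · intro hn
    exact absurd (Finset.mem_range.2 (by omega)) hn

/-- The components of positive index already add up to the whole of ∂̄η. -/
lemma typeProj_zero_dbarFlat {η : V → V [⋀^Fin k]→L[ℝ] W} {z : V} (h : DifferentiableAt ℝ η z) :
    typeProj (k + 1) 0 (dbarFlat η z) = 0 := by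
  have h1 := sum_typeProj (dbarFlat η z)
  have hd : ∀ q, DifferentiableAt ℝ (fun z => typeProj k q (η z)) z := fun q =>
    ((typeProjC (V := V) (W := W) k q).restrictScalars ℝ).differentiableAt.comp z h
  rw [Finset.sum_range_succ'] at h1
  have h2 : dbarFlat η z =
      ∑ q ∈ Finset.range (k + 1), dbarFlat (fun z => typeProj k q (η z)) z := by
    rw [← dbarFlat_sum _ fun q _ => hd q]
    simp only [sum_typeProj]
  have h3 : ∑ q ∈ Finset.range (k + 1), typeProj (k + 1) (q + 1) (dbarFlat η z)
      = dbarFlat η z := by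
    refine Eq.trans ?_ h2.symm
    refine Finset.sum_congr rfl fun q hq => typeProj_dbarFlat h ?_
    simpa [Nat.lt_succ_iff] using hq
  rw [h3] at h1
  exact left_eq_add.1 h1.symm

end DbarFlat

end

noncomputable section

/-! ### The Dolbeault lemma on a complex vector space -/

section LocalDolbeault

variable {V F : Type u} [NormedAddCommGroup V] [NormedSpace ℂ V] [FiniteDimensional ℂ V]
  [NormedAddCommGroup F] [NormedSpace ℂ F] [CompleteSpace F] {k : ℕ}

open Complex

/-- A smooth cutoff function at `z₀`, adapted to the splitting of `V` into the line spanned by `v`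
and the kernel of `φ`. -/
lemma exists_cutoff (z₀ v : V) (φ : V →L[ℂ] ℂ) (hφ : φ v = 1) {U : Set V} (hU : U ∈ 𝓝 z₀) :
    ∃ (χ : V → ℝ) (R : ℝ), 0 < R ∧ ContDiff ℝ ∞ χ ∧ tsupport χ ⊆ U ∧ (∀ᶠ z in 𝓝 z₀, χ z = 1) ∧
      (∀ᶠ z in 𝓝 z₀, ∀ θ : ℝ, χ (z - (R * exp (θ * I)) • v) = 0) ∧
      (∀ᶠ z in 𝓝 z₀, ∀ w, φ w = 0 → ∀ c : ℂ, fderiv ℝ χ (z + c • v) w = 0) := by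
  have := FiniteDimensional.complexToReal V
  obtain ⟨ε, hε, hεU⟩ := Metric.mem_nhds_iff.1 hU
  -- δ is such that the product of the δ-disc in the line and the δ-ball in the kernel lies in the
  -- ε-ball.
  obtain ⟨δ, hδ, hδε⟩ : ∃ δ > 0, δ * ‖v‖ + δ < ε := by
    refine ⟨ε / (2 * (‖v‖ + 1)), by positivity, ?_⟩
    have : ε / (2 * (‖v‖ + 1)) * ‖v‖ + ε / (2 * (‖v‖ + 1)) = ε / 2 := by
      have := norm_nonneg v
      field_simp
    linarith
  let P : V →L[ℂ] V := ContinuousLinearMap.id ℂ V - φ.smulRight v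
  have hPv : ∀ (z : V) (c : ℂ), P (z + c • v) = P z := fun z c => by
    simp [P, hφ, add_smul]
  have hP0 : ∀ w, φ w = 0 → P w = w := fun w hw => by simp [P, hw]
  let χ₁ : ContDiffBump (φ z₀) := ⟨δ / 2, δ, by positivity, by linarith⟩
  let χ₂ : ContDiffBump (P z₀) := ⟨δ / 2, δ, by positivity, by linarith⟩
  have hφd : ContDiff ℝ ∞ φ := (φ.restrictScalars ℝ).contDiff
  have hPd : ContDiff ℝ ∞ P := (P.restrictScalars ℝ).contDiff
  -- The cutoff is a product of bumps in the two factors. With R = 2δ, a circle of radius R in the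
  -- line, centred within δ of φ(z₀), avoids the δ-disc that carries the first bump.
  refine ⟨fun z => χ₁ (φ z) * χ₂ (P z), 2 * δ, by positivity,
    (χ₁.contDiff.comp hφd).mul (χ₂.contDiff.comp hPd), ?_, ?_, ?_, ?_⟩
  · have hcl : IsClosed {z : V | ‖φ z - φ z₀‖ ≤ δ ∧ ‖P z - P z₀‖ ≤ δ} :=
      IsClosed.inter (s₁ := {z : V | ‖φ z - φ z₀‖ ≤ δ}) (s₂ := {z : V | ‖P z - P z₀‖ ≤ δ})
        (isClosed_le (by fun_prop) continuous_const) (isClosed_le (by fun_prop) continuous_const)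
    refine (closure_minimal (t := {z : V | ‖φ z - φ z₀‖ ≤ δ ∧ ‖P z - P z₀‖ ≤ δ})
      (fun z hz => ?_) hcl).trans fun z hz => hεU ?_
    · have h1 := left_ne_zero_of_mul hz
      have h2 := right_ne_zero_of_mul hz
      constructor
      · by_contra hlt
        exact h1 (χ₁.zero_of_le_dist (by rw [dist_eq_norm]; exact (not_le.1 hlt).le))
      · by_contra hlt
        exact h2 (χ₂.zero_of_le_dist (by rw [dist_eq_norm]; exact (not_le.1 hlt).le))
    · have h3 : z - z₀ = (φ z - φ z₀) • v + (P z - P z₀) := by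
        simp only [P, sub_apply, ContinuousLinearMap.id_apply, ContinuousLinearMap.smulRight_apply,
          sub_smul]
        abel
      rw [Metric.mem_ball, dist_eq_norm, h3]
      calc _ ≤ ‖(φ z - φ z₀) • v‖ + ‖P z - P z₀‖ := norm_add_le _ _
        _ ≤ δ * ‖v‖ + δ := by
          rw [norm_smul]
          gcongr
          · exact hz.1
          · exact hz.2
        _ < ε := hδε
  · have h1 := φ.continuous.continuousAt.eventually (χ₁.eventuallyEq_one)
    have h2 := P.continuous.continuousAt.eventually (χ₂.eventuallyEq_one)
    filter_upwards [h1, h2] with z hz1 hz2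
    simp [hz1, hz2]
  · have h1 := φ.continuous.continuousAt.eventually (Metric.ball_mem_nhds (φ z₀) hδ)
    filter_upwards [h1] with z hz θ
    have hz : dist (φ z) (φ z₀) < δ := hz
    have h2 : φ (z - ((2 * δ : ℝ) * exp (θ * I)) • v) = φ z - (2 * δ : ℝ) * exp (θ * I) := by
      simp [hφ]
    have h3 : χ₁ (φ (z - ((2 * δ : ℝ) * exp (θ * I)) • v)) = 0 := by
      refine χ₁.zero_of_le_dist ?_
      rw [h2]
      have h4 : dist (φ z - (2 * δ : ℝ) * exp (θ * I)) (φ z) = 2 * δ := by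
        rw [dist_eq_norm, sub_sub_cancel_left, norm_neg, norm_mul, norm_exp_ofReal_mul_I, mul_one,
          norm_real, Real.norm_of_nonneg (by positivity)]
      have h5 := dist_triangle_right (φ z) (φ z - (2 * δ : ℝ) * exp (θ * I)) (φ z₀)
      have h6 := dist_triangle (φ z - (2 * δ : ℝ) * exp (θ * I)) (φ z₀) (φ z)
      rw [dist_comm (φ z₀)] at h6
      change δ ≤ _
      linarith
    simp only [h3, zero_mul]
  · have h2 := P.continuous.continuousAt.eventually (χ₂.eventuallyEq_one.eventuallyEq_nhds)
    -- The projection `P` is constant on the line z + ℂv, so the second bump is 1 near the whole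
    -- line. There the cutoff is a function of φ alone, and its derivatives along ker φ vanish.
    filter_upwards [h2] with z hz w hw c
    have h3 : χ₂ ∘ P =ᶠ[𝓝 (z + c • v)] fun _ => 1 := by
      rw [← hPv z c] at hz
      exact P.continuous.continuousAt.eventually hz
    have h4 : (fun z => χ₁ (φ z) * χ₂ (P z)) =ᶠ[𝓝 (z + c • v)] fun z => χ₁ (φ z) := by
      filter_upwards [h3] with y hy
      have hy : χ₂ (P y) = 1 := hy
      rw [hy, mul_one]
    rw [h4.fderiv_eq]
    have h5 : HasFDerivAt (fun z => χ₁ (φ z)) _ (z + c • v) :=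
      (((χ₁.contDiff (n := 1)).differentiable one_ne_zero _).hasFDerivAt).comp _
        ((φ.restrictScalars ℝ).hasFDerivAt (x := z + c • v))
    rw [h5.fderiv]
    simp [hw]

lemma contDiff_smul_of_tsupport_subset {W : Type*} [NormedAddCommGroup W] [NormedSpace ℝ W]
    [NormedSpace ℝ V] {χ : V → ℝ} (hχ : ContDiff ℝ ∞ χ) {η : V → W}
    (h : ∀ z ∈ tsupport χ, ContDiffAt ℝ ∞ η z) :
    ContDiff ℝ ∞ fun z => χ z • η z := by
  refine contDiff_iff_contDiffAt.2 fun z => ?_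
  by_cases hz : z ∈ tsupport χ
  · exact hχ.contDiffAt.smul (h z hz)
  · have h0 : (fun z => χ z • η z) =ᶠ[𝓝 z] fun _ => 0 := by
      filter_upwards [notMem_tsupport_iff_eventuallyEq.1 hz] with y hy
      simp [hy]
    exact contDiffAt_const.congr_of_eventuallyEq h0

lemma antilinearPart_fderiv_smul {W : Type*} [NormedAddCommGroup W] [NormedSpace ℂ W]
    {χ : V → ℝ} {η : V → W} {z : V} (hχ : DifferentiableAt ℝ χ z) (hη : DifferentiableAt ℝ η z)
    {w : V} (h : fderiv ℝ χ z w = 0) (h' : fderiv ℝ χ z (I • w) = 0) :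
    antilinearPart (fderiv ℝ (fun z => χ z • η z) z) w
      = χ z • antilinearPart (fderiv ℝ η z) w := by
  rw [fderiv_fun_smul hχ hη]
  simp only [antilinearPart_apply, add_apply, smul_apply, ContinuousLinearMap.smulRight_apply, h,
    h', zero_smul, add_zero]
  module

/-- One step of the Dolbeault lemma: a closed form without components along `S` can be modified
by an exact form in such a way that the components along `v` disappear as well. -/
lemma exists_dbarFlat_contractBar_sub_eq_zero {η : V → V [⋀^Fin (k + 1)]→L[ℝ] F} {z₀ : V}
    (hη : ∀ᶠ z in 𝓝 z₀, ContDiffAt ℝ ∞ η z) (hd : ∀ᶠ z in 𝓝 z₀, dbarFlat η z = 0) (S : Set V)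
    (hS : ∀ᶠ z in 𝓝 z₀, ∀ w ∈ S, contractBar w (η z) = 0) (v : V) (φ : V →L[ℂ] ℂ) (hφ : φ v = 1)
    (hφS : ∀ w ∈ S, φ w = 0) :
    ∃ γ : V → V [⋀^Fin k]→L[ℝ] F, ContDiff ℝ ∞ γ ∧ ∀ᶠ z in 𝓝 z₀,
      contractBar v (η z - dbarFlat γ z) = 0 ∧
      ∀ w ∈ S, contractBar w (η z - dbarFlat γ z) = 0 := by
  obtain ⟨U, hUall, hUo, hzU⟩ := mem_nhds_iff.1 (hη.and (hd.and hS))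
  obtain ⟨χ, R, hR, hχ, hsupp, hone, hcirc, hder⟩ :=
    exists_cutoff z₀ v φ hφ (hUo.mem_nhds hzU)
  let f : V → V [⋀^Fin (k + 1)]→L[ℝ] F := fun z => χ z • η z
  have hf : ContDiff ℝ ∞ f :=
    contDiff_smul_of_tsupport_subset hχ fun z hz => (hUall (hsupp hz)).1
  have hfS : ∀ w ∈ S, ∀ z, contractBar w (f z) = 0 := by
    intro w hw z
    by_cases hz : χ z = 0
    · simp [f, hz]
    · have h1 := (hUall (hsupp (subset_tsupport χ hz))).2.2 w hw
      simp only [f, map_smul, h1, smul_zero]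
  let T := cauchyT R v f
  have hT : ContDiff ℝ ∞ T := contDiff_cauchyT hf R v
  have hTC : ∀ w z, contractBar w (T z) = cauchyT R v (fun z => contractBar w (f z)) z :=
    fun w z => (cauchyT_comp (contractBarC w) hf.continuous R v z).symm
  -- The Cauchy transform solves ∂̄ along `v` coefficientwise; contracting it with the
  -- antiholomorphic part of `v` gives a form one degree lower whose ∂̄ has the right component
  -- along `v`.
  let γ : V → V [⋀^Fin k]→L[ℝ] F := fun z => contractBar v (T z)
  have hγ : ContDiff ℝ ∞ γ := (contractBar (W := F) (k := k) v).contDiff.comp hT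
  have hγd : ∀ z, DifferentiableAt ℝ γ z := hγ.differentiable (by simp)
  have hdγ : ∀ w z, antilinearPart (fderiv ℝ γ z) w
      = contractBar v (cauchyT R v (fun z => antilinearPart (fderiv ℝ f z) w) z) := by
    intro w z
    have h1 : fderiv ℝ γ z = (contractBarC v).restrictScalars ℝ ∘L fderiv ℝ T z :=
      fderiv_comp_complexLinear (contractBarC v) (hT.differentiable (by simp) z)
    rw [h1, antilinearPart_comp]
    exact congrArg (contractBar v) (antilinearPart_fderiv_cauchyT hf R v z w)
  -- The Cartan formula for degree 0 and for positive degree at once; the transport `▸` lets the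
  -- hypothesis speak of a contraction of γ only when k is a successor.
  have hcar : ∀ w, (∀ j (h : k = j + 1) z, contractBar w (h ▸ γ z : V [⋀^Fin (j + 1)]→L[ℝ] F) = 0) →
      ∀ z, contractBar w (dbarFlat γ z) = antilinearPart (fderiv ℝ γ z) w := by
    intro w hw z
    clear hdγ
    clear_value γ
    cases k with
    | zero => exact contractBar_dbarFlat_zero γ z w
    | succ j =>
      exact contractBar_dbarFlat_of_eq_zero (hγd z) (Filter.Eventually.of_forall (hw j rfl))
  have hv := hcar v (by
    rintro j rfl z
    exact contractBar_self v (T z))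
  have hw : ∀ w ∈ S, ∀ z, contractBar w (dbarFlat γ z) = antilinearPart (fderiv ℝ γ z) w := by
    intro w hwS
    refine hcar w ?_
    rintro j rfl z
    change contractBar w (contractBar v (T z)) = 0
    rw [contractBar_anticomm, hTC]
    simp only [hfS w hwS, cauchyT_zero, map_zero, neg_zero]
  refine ⟨γ, hγ, ?_⟩
  filter_upwards [hone, hcirc, hder, hUo.mem_nhds hzU] with z h1 h2 h3 hzU'
  refine ⟨?_, fun w hwS => ?_⟩
  -- Along `v`: contracting ∂̄γ gives the contraction of T(∂̄_v f) = f, and f = η near z₀.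
  · rw [map_sub, hv, hdγ, cauchyT_antilinearPart_fderiv hf hR v z fun θ => by simp only [f, h2 θ, zero_smul]]
    simp [f, h1]
  · rw [map_sub, hw w hwS, hdγ, (hUall hzU').2.2 w hwS]
    -- Along w ∈ S: the integrand only sees the line z + ℂv. There η is holomorphic in the direction
    -- w by closedness, and the cutoff is constant in the directions w and iw, both in ker φ.
    have h4 : cauchyT R v (fun z => antilinearPart (fderiv ℝ f z) w) z = 0 := by
      have h5 : ∀ c : ℂ, antilinearPart (fderiv ℝ f (z + c • v)) w = 0 := by
        intro c
        by_cases hz : z + c • v ∈ tsupport χ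
        · have hzc := hUall (hsupp hz)
          have hnear := hUo.eventually_mem (hsupp hz)
          rw [antilinearPart_fderiv_smul (hχ.differentiable (by simp) _)
            (hzc.1.differentiableAt (by simp)) (h3 w (hφS w hwS) c)
            (h3 (I • w) (by rw [map_smul, hφS w hwS, smul_zero]) c)]
          have h6 := contractBar_dbarFlat_of_eq_zero (v := w) (hzc.1.differentiableAt (by simp))
            (by filter_upwards [hnear] with y hy using (hUall hy).2.2 w hwS)
          rw [← h6, hzc.2.1, map_zero, smul_zero]
        · have h0 : f =ᶠ[𝓝 (z + c • v)] fun _ => 0 := by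
            filter_upwards [notMem_tsupport_iff_eventuallyEq.1 hz] with y hy
            simp [f, hy]
          rw [h0.fderiv_eq]
          simp
      have h6 : ∀ θ r, cauchyIntegrand v (fun z => antilinearPart (fderiv ℝ f z) w) z θ r = 0 := by
        intro θ r
        simp only [cauchyIntegrand]
        rw [sub_eq_add_neg, ← neg_smul, h5, smul_zero]
      simp [cauchyT, h6]
    rw [h4, map_zero, sub_zero]

/-- Basis vectors are treated one at a time: `S` is the set of those already treated and φ the
coordinate of the new one. Each correction keeps the form closed because ∂̄² = 0. -/
lemma exists_dbarFlat_contractBar_sub_eq_zero_of_finset {η : V → V [⋀^Fin (k + 1)]→L[ℝ] F} {z₀ : V}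
    (hη : ∀ᶠ z in 𝓝 z₀, ContDiffAt ℝ ∞ η z) (hd : ∀ᶠ z in 𝓝 z₀, dbarFlat η z = 0)
    {ι : Type*} [Fintype ι] (b : Module.Basis ι ℂ V) (s : Finset ι) :
    ∃ γ : V → V [⋀^Fin k]→L[ℝ] F, ContDiff ℝ ∞ γ ∧ ∀ᶠ z in 𝓝 z₀, ∀ i ∈ s,
      contractBar (b i) (η z - dbarFlat γ z) = 0 := by
  classical
  induction s using Finset.induction_on with
  | empty => exact ⟨0, contDiff_const, by simp⟩
  | insert i s hi ih =>
    obtain ⟨γ, hγ, h⟩ := ih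
    have h1 : ∀ᶠ z in 𝓝 z₀, ContDiffAt ℝ ∞ (fun z => η z - dbarFlat γ z) z := by
      filter_upwards [hη] with z hz using hz.sub hγ.contDiffAt.dbarFlat
    have h2 : ∀ᶠ z in 𝓝 z₀, dbarFlat (fun z => η z - dbarFlat γ z) z = 0 := by
      filter_upwards [hη, hd] with z hz hz'
      rw [dbarFlat_sub (hz.differentiableAt (by simp))
        (hγ.contDiffAt.dbarFlat.differentiableAt (by simp)), hz', dbarFlat_dbarFlat hγ.contDiffAt,
        sub_zero]
    obtain ⟨γ', hγ', h'⟩ := exists_dbarFlat_contractBar_sub_eq_zero h1 h2 (b '' (s : Set ι))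
      (by
        filter_upwards [h] with z hz
        rintro _ ⟨j, hj, rfl⟩
        exact hz j hj) (b i) (LinearMap.toContinuousLinearMap (b.coord i)) (by simp) (by
        rintro _ ⟨j, hj, rfl⟩
        have hji : j ≠ i := fun h => hi (h ▸ hj)
        simp [Finsupp.single_eq_of_ne' hji])
    refine ⟨fun z => γ z + γ' z, hγ.add hγ', ?_⟩
    filter_upwards [h'] with z hz j hj
    have h3 : η z - dbarFlat (fun z => γ z + γ' z) z = η z - dbarFlat γ z - dbarFlat γ' z := by
      rw [dbarFlat_add (hγ.differentiable (by simp) z) (hγ'.differentiable (by simp) z)]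
      abel
    rw [h3]
    rcases Finset.mem_insert.1 hj with rfl | hj
    · exact hz.1
    · exact hz.2 _ ⟨j, hj, rfl⟩

/-- The Dolbeault lemma: a `∂̄`-closed form of type `(p, q + 1)` is locally `∂̄`-exact. -/
theorem exists_dbarFlat_eq {η : V → V [⋀^Fin (k + 1)]→L[ℝ] F} {z₀ : V} {p q : ℕ} (hpq : p + q = k)
    (hη : ∀ᶠ z in 𝓝 z₀, ContDiffAt ℝ ∞ η z) (hd : ∀ᶠ z in 𝓝 z₀, dbarFlat η z = 0)
    (ht : ∀ᶠ z in 𝓝 z₀, OfType (η z) p (q + 1)) :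
    ∃ γ : V → V [⋀^Fin k]→L[ℝ] F, ContDiff ℝ ∞ γ ∧ (∀ z, OfType (γ z) p q) ∧
      ∀ᶠ z in 𝓝 z₀, dbarFlat γ z = η z := by
  obtain ⟨γ, hγ, h⟩ := exists_dbarFlat_contractBar_sub_eq_zero_of_finset hη hd
    (Module.finBasis ℂ V) Finset.univ
  refine ⟨fun z => typeProjC k q (γ z),
    ((typeProjC (V := V) (W := F) k q).restrictScalars ℝ).contDiff.comp hγ, fun z => ?_, ?_⟩
  · have := ofType_typeProj (γ z) (show q ≤ k by omega)
    rwa [show k - q = p by omega] at this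
  filter_upwards [h, ht] with z hz htz
  -- Contraction is conjugate linear in the vector, so vanishing on a basis suffices.
  have h1 : ∀ v, contractBar v (η z - dbarFlat γ z) = 0 := by
    intro v
    have hv : v ∈ Submodule.span ℂ (Set.range (Module.finBasis ℂ V)) := by
      rw [Module.Basis.span_eq]; trivial
    induction hv using Submodule.span_induction with
    | mem x hx =>
      obtain ⟨i, rfl⟩ := hx
      exact hz i (Finset.mem_univ i)
    | zero =>
      have := contractBar_real_smul 0 (0 : V) (η z - dbarFlat γ z)
      rwa [zero_smul, zero_smul] at this
    | add x y _ _ hx hy => rw [contractBar_add, hx, hy, add_zero]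
    | smul c x _ hx => rw [contractBar_smul, hx, smul_zero]
  -- With no antiholomorphic component left, η - ∂̄γ has type (k + 1, 0). Its component of type (p,
  -- q + 1) is zero, so η is ∂̄ of the (p, q)-component of γ.
  have h2 : OfType (η z - dbarFlat γ z) (k + 1) 0 :=
    ofType_of_cons_I_smul fun v => contractBar_eq_zero_iff.1 (h1 v)
  have h3 := h2.typeProj_eq (q' := q + 1) rfl (by omega)
  rw [if_neg (by omega), map_sub, sub_eq_zero, htz.typeProj_eq (by omega) (by omega), if_pos rfl,
    typeProj_dbarFlat (hγ.differentiable (by simp) z) (by omega)] at h3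
  exact h3.symm

end LocalDolbeault

end

noncomputable section

/-! ### Smooth solutions of the Cauchy-Riemann equations are analytic -/

section CauchyRiemann

variable {V : Type u} [NormedAddCommGroup V] [NormedSpace ℂ V]

open Complex

/-- The complex linear part `v ↦ (L v - i L (i v)) / 2` of a real linear map. -/
def complexLinearMap {W : Type*} [NormedAddCommGroup W] [NormedSpace ℂ W] (L : V →L[ℝ] W) :
    V →L[ℂ] W where
  toFun v := (1 / 2 : ℂ) • (L v - I • L (I • v))
  map_add' v w := by simp only [smul_add, map_add]; module
  map_smul' c v := by
    have hc : c • v = c.re • v + c.im • (I • v) := by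
      conv_lhs => rw [← re_add_im c]
      rw [add_smul, mul_smul]
      rfl
    have hc' : I • c • v = c.re • (I • v) - c.im • v := by
      rw [hc, smul_add, smul_comm I c.re, smul_comm I c.im, smul_smul I I, I_mul_I, neg_smul,
        one_smul, smul_neg, sub_eq_add_neg]
    have h1 : ∀ (a : ℝ) (w : V), L (a • w) = (a : ℂ) • L w := fun a w => L.map_smul a w
    rw [hc', hc, map_add, map_sub, h1, h1, h1, h1, RingHom.id_apply]
    generalize L (I • v) = B
    generalize L v = A
    have hcc : c = c.re + c.im * I := (re_add_im c).symm
    generalize c.re = a at *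
    generalize c.im = b at *
    subst hcc
    match_scalars
    · ring
    · linear_combination ((1 / 2 : ℂ) * b) * I_mul_I
  cont := by fun_prop

lemma complexLinearMap_apply {W : Type*} [NormedAddCommGroup W] [NormedSpace ℂ W]
    (L : V →L[ℝ] W) (v : V) :
    complexLinearMap L v = (1 / 2 : ℂ) • (L v - I • L (I • v)) := rfl

/-- The projection of a real linear map to its complex linear part. -/
def complexLinearPart (V W : Type*) [NormedAddCommGroup V] [NormedSpace ℂ V]
    [NormedAddCommGroup W] [NormedSpace ℂ W] : (V →L[ℝ] W) →L[ℝ] (V →L[ℂ] W) :=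
  LinearMap.mkContinuous
    { toFun := complexLinearMap
      map_add' L M := by
        ext v
        simp only [complexLinearMap_apply, add_apply]
        module
      map_smul' c L := by
        ext v
        simp only [complexLinearMap_apply, smul_apply, RingHom.id_apply]
        rw [smul_comm I c, ← smul_sub, smul_comm c] } 1 (fun L => by
      rw [one_mul]
      refine ContinuousLinearMap.opNorm_le_bound _ (norm_nonneg _) fun v => ?_
      change ‖(1 / 2 : ℂ) • (L v - I • L (I • v))‖ ≤ _
      rw [norm_smul]
      have h1 : ‖L v - I • L (I • v)‖ ≤ ‖L‖ * ‖v‖ + ‖L‖ * ‖v‖ := by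
        refine (norm_sub_le _ _).trans (add_le_add (L.le_opNorm v) ?_)
        rw [norm_smul, norm_I, one_mul]
        refine (L.le_opNorm _).trans ?_
        rw [norm_smul, norm_I, one_mul]
      have h2 : ‖(1 / 2 : ℂ)‖ = 1 / 2 := by norm_num
      rw [h2]
      linarith)

lemma complexLinearPart_apply {W : Type*} [NormedAddCommGroup W] [NormedSpace ℂ W]
    (L : V →L[ℝ] W) (v : V) :
    complexLinearPart V W L v = (1 / 2 : ℂ) • (L v - I • L (I • v)) := rfl

lemma antilinearPart_eq_zero_iff {W : Type*} [NormedAddCommGroup W] [NormedSpace ℂ W]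
    {L : V →L[ℝ] W} : antilinearPart L = 0 ↔ ∀ v, L (I • v) = I • L v := by
  rw [ContinuousLinearMap.ext_iff]
  refine forall_congr' fun v => ?_
  rw [antilinearPart_apply]
  change (1 / 2 : ℂ) • _ = (0 : W) ↔ _
  rw [smul_eq_zero, or_iff_right (by norm_num)]
  constructor
  · intro h
    have := congrArg (I • ·) h
    simp only [smul_add, smul_smul, I_mul_I, smul_zero, neg_smul, one_smul] at this
    rw [← sub_eq_add_neg, sub_eq_zero] at this
    exact this.symm
  · intro h
    rw [h, smul_smul, I_mul_I, neg_smul, one_smul, add_neg_cancel]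

lemma complexLinearPart_of_antilinearPart_eq_zero {W : Type*} [NormedAddCommGroup W]
    [NormedSpace ℂ W] {L : V →L[ℝ] W} (h : antilinearPart L = 0) :
    (complexLinearPart V W L).restrictScalars ℝ = L := by
  ext v
  rw [ContinuousLinearMap.coe_restrictScalars', complexLinearPart_apply,
    antilinearPart_eq_zero_iff.1 h v, smul_smul, I_mul_I]
  module

/-- A smooth solution of the Cauchy-Riemann equations is continuously differentiable over `ℂ`. -/
lemma contDiffAt_complex_of_antilinearPart (n : ℕ) : ∀ {W : Type u} [NormedAddCommGroup W]
    [NormedSpace ℂ W] {g : V → W} {z₀ : V}, (∀ᶠ z in 𝓝 z₀, ContDiffAt ℝ ∞ g z) →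
    (∀ᶠ z in 𝓝 z₀, antilinearPart (fderiv ℝ g z) = 0) → ContDiffAt ℂ n g z₀ := by
  induction n with
  | zero =>
    intro W _ _ g z₀ hg _
    refine contDiffAt_zero.2 ⟨{z | ContDiffAt ℝ ∞ g z}, hg, fun z hz => ?_⟩
    exact (ContDiffAt.continuousAt (𝕜 := ℝ) (n := ∞) hz).continuousWithinAt
  | succ n ih =>
    intro W _ _ g z₀ hg hCR
    have hderiv : ∀ᶠ z in 𝓝 z₀, HasFDerivAt g (complexLinearPart V W (fderiv ℝ g z)) z := by
      filter_upwards [hg, hCR] with z hz hz'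
      refine hasFDerivAt_of_restrictScalars ℝ ((hz.differentiableAt (by simp)).hasFDerivAt) ?_
      exact complexLinearPart_of_antilinearPart_eq_zero hz'
    refine contDiffAt_succ_iff_hasFDerivAt.2 ⟨_, ⟨_, hderiv, fun z hz => hz⟩, ih ?_ ?_⟩
    · filter_upwards [hg] with z hz
      exact (complexLinearPart V W).contDiff.contDiffAt.comp z
        (hz.fderiv_right (m := ∞) (by simp))
    · filter_upwards [hg, hCR.eventually_nhds] with z hz hz'
      rw [antilinearPart_eq_zero_iff]
      have hd : DifferentiableAt ℝ (fderiv ℝ g) z :=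
        (hz.fderiv_right (m := 1) (by norm_cast)).differentiableAt one_ne_zero
      have h1 : fderiv ℝ (fun z => complexLinearPart V W (fderiv ℝ g z)) z
          = complexLinearPart V W ∘L fderiv ℝ (fderiv ℝ g) z :=
        ((complexLinearPart V W).hasFDerivAt.comp z hd.hasFDerivAt).fderiv
      have hs : IsSymmSndFDerivAt ℝ g z := hz.isSymmSndFDerivAt (by
        rw [minSmoothness_of_isRCLikeNormedField]
        norm_cast)
      -- Differentiating the Cauchy-Riemann equations makes the second derivative complex linear in
      -- its last argument; by symmetry it is so in the first, and the complex derivative of g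
      -- solves the equations too.
      have h2 : ∀ u w, fderiv ℝ (fderiv ℝ g) z u (I • w) = I • fderiv ℝ (fderiv ℝ g) z u w := by
        intro u
        rw [← antilinearPart_eq_zero_iff]
        have h3 : (fun z => antilinearPartCLM V W (fderiv ℝ g z)) =ᶠ[𝓝 z] fun _ => 0 := hz'
        have h4 := ((antilinearPartCLM V W).hasFDerivAt.comp z hd.hasFDerivAt).fderiv
        have h5 : fderiv ℝ (fun z => antilinearPartCLM V W (fderiv ℝ g z)) z = 0 := by
          rw [h3.fderiv_eq, fderiv_const_apply]
        have h6 := h4.symm.trans h5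
        exact congrFun (congrArg DFunLike.coe h6) u
      intro v
      rw [h1]
      ext w
      simp only [ContinuousLinearMap.comp_apply, complexLinearPart_apply, smul_apply]
      rw [hs.eq (I • v) w, hs.eq (I • v) (I • w), h2, h2, hs.eq w v, hs.eq (I • w) v]
      module

/-- The one-variable Cauchy estimate on the line t ↦ z + t w, for every radius ρ' < ρ. -/
lemma norm_fderiv_le_of_forall_mem_ball {W : Type*} [NormedAddCommGroup W] [NormedSpace ℂ W]
    {g : V → W} {z : V} {ρ C : ℝ} (hρ : 0 < ρ) (hg : ∀ y ∈ Metric.ball z ρ, DifferentiableAt ℂ g y)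
    (hC : ∀ y ∈ Metric.ball z ρ, ‖g y‖ ≤ C) : ‖fderiv ℂ g z‖ ≤ C / ρ := by
  have hC0 : 0 ≤ C := (norm_nonneg _).trans (hC z (Metric.mem_ball_self hρ))
  have key : ∀ ρ', 0 < ρ' → ρ' < ρ → ‖fderiv ℂ g z‖ ≤ C / ρ' := by
    intro ρ' h0 hlt
    refine ContinuousLinearMap.opNorm_le_bound _ (by positivity) fun w => ?_
    by_cases hw : w = 0
    · simp [hw]
    have hw : 0 < ‖w‖ := norm_pos_iff.2 hw
    have hmem : ∀ t ∈ Metric.closedBall (0 : ℂ) (ρ' / ‖w‖), z + t • w ∈ Metric.ball z ρ := by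
      intro t ht
      rw [mem_closedBall_zero_iff, le_div_iff₀ hw] at ht
      rw [Metric.mem_ball, dist_eq_norm, add_sub_cancel_left, norm_smul]
      exact ht.trans_lt hlt
    have hline : ∀ t : ℂ, HasDerivAt (fun t : ℂ => z + t • w) w t := fun t => by
      simpa using ((hasDerivAt_id t).smul_const w).const_add z
    have hdiff : ∀ t ∈ Metric.closedBall (0 : ℂ) (ρ' / ‖w‖),
        HasDerivAt (fun t : ℂ => g (z + t • w)) (fderiv ℂ g (z + t • w) w) t := fun t ht =>
      (hg _ (hmem t ht)).hasFDerivAt.comp_hasDerivAt t (hline t)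
    have h1 := norm_deriv_le_of_forall_mem_sphere_norm_le (c := 0) (R := ρ' / ‖w‖) (C := C)
      (f := fun t : ℂ => g (z + t • w)) (by positivity)
      (DifferentiableOn.diffContOnCl (fun t ht => by
        rw [closure_ball _ (by positivity)] at ht
        exact (hdiff t ht).differentiableAt.differentiableWithinAt))
      (fun t ht => hC _ (hmem t (Metric.sphere_subset_closedBall ht)))
    rw [(hdiff 0 (Metric.mem_closedBall_self (by positivity))).deriv, zero_smul, add_zero] at h1
    refine h1.trans (le_of_eq ?_)
    field_simp
  refine le_of_forall_gt_imp_ge_of_dense ?_ |>.trans le_rfl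
  intro a ha
  by_cases ha0 : C = 0
  · have := key (ρ / 2) (by positivity) (by linarith)
    rw [ha0, zero_div] at this ha
    exact this.trans ha.le
  have hCpos : 0 < C := lt_of_le_of_ne hC0 (Ne.symm ha0)
  have hapos : 0 < a := lt_of_le_of_lt (by positivity) ha
  -- For a > C/ρ, the radius ρ' = C/a is admissible and gives the bound a.
  have := key (C / a) (by positivity) (by rwa [div_lt_comm₀ hapos hρ])
  rwa [div_div_cancel₀ hCpos.ne'] at this

/-- The Cauchy estimates for the iterated derivatives. -/
lemma norm_iteratedFDeriv_le_of_forall_mem_ball {W : Type*} [NormedAddCommGroup W]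
    [NormedSpace ℂ W] {g : V → W} {z₀ : V} {r M ρ : ℝ} (hρ : 0 < ρ)
    (hg : ∀ n : ℕ, ∀ z ∈ Metric.ball z₀ r, ContDiffAt ℂ n g z)
    (hM : ∀ z ∈ Metric.ball z₀ r, ‖g z‖ ≤ M) (n : ℕ) :
    ∀ z ∈ Metric.ball z₀ (r - n * ρ), ‖iteratedFDeriv ℂ n g z‖ ≤ M / ρ ^ n := by
  induction n with
  | zero => simpa using hM
  | succ n ih =>
    intro z hz
    rw [Metric.mem_ball] at hz
    push_cast at hz
    -- Each differentiation divides the bound by ρ and shrinks the ball by ρ.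
    have hball : ∀ y ∈ Metric.ball z ρ, y ∈ Metric.ball z₀ (r - n * ρ) := by
      intro y hy
      have := dist_triangle y z z₀
      rw [Metric.mem_ball] at hy ⊢
      linarith
    have hsub : Metric.ball z₀ (r - n * ρ) ⊆ Metric.ball z₀ r :=
      Metric.ball_subset_ball (by have : 0 ≤ n * ρ := by positivity
                                  linarith)
    rw [← norm_fderiv_iteratedFDeriv]
    have h1 := norm_fderiv_le_of_forall_mem_ball hρ (g := iteratedFDeriv ℂ n g) (z := z)
      (fun y hy => (hg (n + 1) y (hsub (hball y hy))).differentiableAt_iteratedFDeriv (by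
        exact_mod_cast Nat.lt_succ_self n)) (fun y hy => ih y (hball y hy))
    rwa [div_div, ← pow_succ] at h1

lemma iteratedDeriv_line {W : Type*} [NormedAddCommGroup W] [NormedSpace ℂ W] {g : V → W}
    {z₀ : V} {r : ℝ} (hg : ∀ n : ℕ, ∀ z ∈ Metric.ball z₀ r, ContDiffAt ℂ n g z) (y : V) (n : ℕ) :
    ∀ t : ℂ, z₀ + t • y ∈ Metric.ball z₀ r →
      iteratedDeriv n (fun t : ℂ => g (z₀ + t • y)) t
        = iteratedFDeriv ℂ n g (z₀ + t • y) fun _ => y := by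
  induction n with
  | zero => simp
  | succ n ih =>
    intro t ht
    have hc : Continuous fun t : ℂ => z₀ + t • y := by fun_prop
    have h1 : iteratedDeriv n (fun t : ℂ => g (z₀ + t • y)) =ᶠ[𝓝 t]
        fun t => iteratedFDeriv ℂ n g (z₀ + t • y) fun _ => y := by
      filter_upwards [hc.continuousAt.eventually (Metric.isOpen_ball.eventually_mem ht)] with s hs
      exact ih s hs
    have hline : HasDerivAt (fun t : ℂ => z₀ + t • y) y t := by
      simpa using ((hasDerivAt_id t).smul_const y).const_add z₀
    have h2 := (((hg (n + 1) _ ht).differentiableAt_iteratedFDeriv (m := n) (by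
        exact_mod_cast Nat.lt_succ_self n)).hasFDerivAt).comp_hasDerivAt t hline
    have h3 := (ContinuousMultilinearMap.apply ℂ (fun _ : Fin n => V) W
      (fun _ => y)).hasFDerivAt.comp_hasDerivAt t h2
    rw [iteratedDeriv_succ, h1.deriv_eq]
    refine h3.deriv.trans ?_
    rw [iteratedFDeriv_succ_apply_left]
    rfl

/-- A smooth solution of the Cauchy-Riemann equations is analytic (Osgood's lemma). -/
theorem analyticAt_of_antilinearPart_fderiv_eq_zero {W : Type u} [NormedAddCommGroup W]
    [NormedSpace ℂ W] [CompleteSpace W] {g : V → W} {z₀ : V}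
    (hg : ∀ᶠ z in 𝓝 z₀, ContDiffAt ℝ ∞ g z)
    (hCR : ∀ᶠ z in 𝓝 z₀, antilinearPart (fderiv ℝ g z) = 0) : AnalyticAt ℂ g z₀ := by
  have hgc : ∀ᶠ z in 𝓝 z₀, ‖g z‖ < ‖g z₀‖ + 1 :=
    hg.self_of_nhds.continuousAt.norm.eventually (gt_mem_nhds (lt_add_one _))
  obtain ⟨r, hr, hball⟩ := Metric.eventually_nhds_iff_ball.1
    (hg.eventually_nhds.and (hCR.eventually_nhds.and hgc))
  have hgn : ∀ n : ℕ, ∀ z ∈ Metric.ball z₀ r, ContDiffAt ℂ n g z := fun n z hz =>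
    contDiffAt_complex_of_antilinearPart n (hball z hz).1 (hball z hz).2.1
  set M := ‖g z₀‖ + 1 with hM
  have hM0 : 0 < M := by positivity
  let p : FormalMultilinearSeries ℂ V W := fun n => ((n.factorial : ℂ)⁻¹) • iteratedFDeriv ℂ n g z₀
  let s : NNReal := ⟨r / 3, by positivity⟩
  have hs : 0 < s := by
    change 0 < r / 3
    positivity
  have hbound : ∀ n, ‖p n‖ * (s : ℝ) ^ n ≤ M * Real.exp 1 := by
    intro n
    have hn1 : (0 : ℝ) < n + 1 := by positivity
    -- With ρ = r/(n + 1), n derivatives still leave a ball of radius r/(n + 1) about z₀. Since (n +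
    -- 1)^n / n! ≤ e^{n+1} and e < 3, the Taylor series has radius of convergence at least r/3.
    have h1 := norm_iteratedFDeriv_le_of_forall_mem_ball (ρ := r / (n + 1)) (by positivity) hgn
      (fun z hz => (hball z hz).2.2.le) n z₀ (Metric.mem_ball_self (by
        have : r - n * (r / (n + 1)) = r / (n + 1) := by field_simp; ring
        rw [this]; positivity))
    have h2 := Real.pow_div_factorial_le_exp _ hn1.le n
    have hf : (0 : ℝ) < n.factorial := by exact_mod_cast n.factorial_pos
    have h3 : ‖p n‖ ≤ M * Real.exp (n + 1) / r ^ n := by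
      have : ‖p n‖ = (n.factorial : ℝ)⁻¹ * ‖iteratedFDeriv ℂ n g z₀‖ := by
        simp [p, norm_smul]
      rw [this]
      calc _ ≤ (n.factorial : ℝ)⁻¹ * (M / (r / (n + 1)) ^ n) := by gcongr
        _ = M * (((n : ℝ) + 1) ^ n / n.factorial) / r ^ n := by
          rw [div_pow]; field_simp
        _ ≤ _ := by gcongr
    have hs' : (s : ℝ) = r / 3 := rfl
    have he : Real.exp 1 ≤ 3 := Real.exp_one_lt_three.le
    calc ‖p n‖ * (s : ℝ) ^ n ≤ M * Real.exp (n + 1) / r ^ n * (s : ℝ) ^ n := by gcongr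
      _ = M * Real.exp 1 * (Real.exp 1 / 3) ^ n := by
        rw [hs', Real.exp_add, ← Real.exp_one_pow n, div_pow, div_pow]
        field_simp
      _ ≤ M * Real.exp 1 * 1 := by
        gcongr
        exact pow_le_one₀ (by positivity) (by rw [div_le_one (by norm_num)]; exact he)
      _ = _ := mul_one _
  refine ⟨p, s, ?_, ?_, ?_⟩
  · exact p.le_radius_of_bound _ hbound
  · exact_mod_cast hs
  · intro y hy
    have hy : ‖y‖ < r / 3 := by
      rw [Metric.eball_coe, mem_ball_zero_iff] at hy
      exact hy
    have hmem : ∀ t ∈ Metric.ball (0 : ℂ) 2, z₀ + t • y ∈ Metric.ball z₀ r := by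
      intro t ht
      rw [mem_ball_zero_iff] at ht
      rw [Metric.mem_ball, dist_eq_norm, add_sub_cancel_left, norm_smul]
      nlinarith [norm_nonneg y, norm_nonneg t]
    have hline : ∀ t : ℂ, DifferentiableAt ℂ (fun t : ℂ => z₀ + t • y) t := fun t => by fun_prop
    have hd : DifferentiableOn ℂ (fun t : ℂ => g (z₀ + t • y)) (Metric.ball 0 2) := fun t ht =>
      (((hgn 1 _ (hmem t ht)).differentiableAt one_ne_zero).comp t
        (hline t)).differentiableWithinAt
    -- Convergence to g is a one-variable fact: t ↦ g(z₀ + t y) is holomorphic on the disc of radius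
    -- 2, because ‖y‖ < r/3, and its Taylor series is evaluated at t = 1.
    have h1 := hasSum_taylorSeries_on_ball hd (z := 1) (by simp)
    simp only [sub_zero, one_pow, one_smul] at h1
    convert! h1 using 2 with n
    rw [iteratedDeriv_line hgn y n 0 (hmem 0 (by simp)), zero_smul, add_zero]
    rfl

end CauchyRiemann

end

noncomputable section

/-! ### Invariance of `∂̄` under holomorphic changes of coordinates -/

section Pullback

variable {V F : Type*} [NormedAddCommGroup V] [NormedSpace ℂ V]
  [NormedAddCommGroup F] [NormedSpace ℂ F] {k : ℕ}

/-- Induction on the degree through currying: fixing the first argument v turns pullback of η by A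
into pullback of η(Av, ·), one degree lower, and a form is (k + 1)⁻¹ times the alternatization of
its currying. -/
lemma contDiff_compContinuousLinearMap [FiniteDimensional ℂ V] (n : WithTop ℕ∞) (k : ℕ) :
    ContDiff ℝ n fun p : (V [⋀^Fin k]→L[ℝ] F) × (V →L[ℝ] V) => p.1.compContinuousLinearMap p.2 := by
  have := FiniteDimensional.complexToReal V
  induction k with
  | zero =>
    have h : (fun p : (V [⋀^Fin 0]→L[ℝ] F) × (V →L[ℝ] V) => p.1.compContinuousLinearMap p.2)
        = Prod.fst := by
      ext p m
      exact congrArg p.1 (Subsingleton.elim _ _)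
    rw [h]
    exact contDiff_fst
  | succ k ih =>
    have h1 : ContDiff ℝ n fun p : (V [⋀^Fin (k + 1)]→L[ℝ] F) × (V →L[ℝ] V) =>
        (p.1.compContinuousLinearMap p.2).curryLeft := by
      refine contDiff_clm_apply_iff.2 fun v => ?_
      simp only [ContinuousAlternatingMap.curryLeft_compContinuousLinearMap]
      have h2 : ContDiff ℝ n fun p : (V [⋀^Fin (k + 1)]→L[ℝ] F) × (V →L[ℝ] V) =>
          p.1.curryLeft (p.2 v) :=
        ((ContinuousAlternatingMap.curryLeftLI (𝕜 := ℝ) (E := V) (F := F)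
          (n := k)).toContinuousLinearMap.contDiff.comp contDiff_fst).clm_apply
          (contDiff_snd.clm_apply contDiff_const)
      exact ih.comp (h2.prodMk contDiff_snd)
    have h3 : (fun p : (V [⋀^Fin (k + 1)]→L[ℝ] F) × (V →L[ℝ] V) =>
        p.1.compContinuousLinearMap p.2) = fun p => ((k + 1 : ℝ)⁻¹) •
          ContinuousAlternatingMap.alternatizeUncurryFinCLM ℝ V F
            (p.1.compContinuousLinearMap p.2).curryLeft := by
      funext p
      rw [ContinuousAlternatingMap.alternatizeUncurryFinCLM_apply,
        ContinuousAlternatingMap.alternatizeUncurryFin_curryLeft, ← Nat.cast_smul_eq_nsmul ℝ,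
        smul_smul]
      push_cast
      rw [inv_mul_cancel₀ (by positivity), one_smul]
    rw [h3]
    exact (contDiff_const (c := (k + 1 : ℝ)⁻¹)).smul
      (ContDiff.comp (g := ContinuousAlternatingMap.alternatizeUncurryFinCLM ℝ V F)
        (ContinuousLinearMap.contDiff _) h1)

lemma OfType.pullback {η : V [⋀^Fin k]→L[ℝ] F} {p q : ℕ} (h : OfType η p q) (A : V →L[ℂ] V) :
    OfType (η.compContinuousLinearMap (A.restrictScalars ℝ)) p q := fun c m => by
  have := h c fun i => A (m i)
  simpa [Function.comp_def] using this

lemma ofType_alternatize_linear {p q : ℕ} (L : V →L[ℝ] V [⋀^Fin k]→L[ℝ] F)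
    (hL : ∀ v, L (Complex.I • v) = Complex.I • L v) (h : ∀ v, OfType (L v) p q) :
    OfType (ContinuousAlternatingMap.alternatizeUncurryFin L) (p + 1) q := by
  have hc : ∀ (c : ℂ) v, L (c • v) = c • L v := by
    intro c v
    have hc : c • v = c.re • v + c.im • (Complex.I • v) := by
      conv_lhs => rw [← Complex.re_add_im c]
      rw [add_smul, mul_smul]
      rfl
    have h1 : ∀ (a : ℝ) (w : V), L (a • w) = (a : ℂ) • L w := fun a w => L.map_smul a w
    rw [hc, map_add, h1, h1, hL, smul_smul, ← add_smul, Complex.re_add_im]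
  intro c m
  simp only [ContinuousAlternatingMap.alternatizeUncurryFin_apply, Finset.smul_sum, hc]
  refine Finset.sum_congr rfl fun i _ => ?_
  have := h (m i) c (i.removeNth m)
  rw [ContinuousAlternatingMap.smul_apply]
  change _ • c • L (m i) (fun j => c • i.removeNth m j) = _
  rw [this, smul_comm _ ((-1 : ℤ) ^ (i : ℕ)), smul_smul c]
  congr 2
  ring

/-- On forms of type `(p, q)`, the operator `∂̄` is the component of type `(p, q + 1)` of the
exterior derivative. -/
lemma dbarFlat_eq_typeProj_extDeriv {η : V → V [⋀^Fin k]→L[ℝ] F} {z : V}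
    (h : DifferentiableAt ℝ η z) {p q : ℕ} (hpq : p + q = k)
    (ht : ∀ᶠ z in 𝓝 z, OfType (η z) p q) :
    dbarFlat η z = typeProj (k + 1) (q + 1) (extDeriv η z) := by
  set L := fderiv ℝ η z with hL
  have h1 : extDeriv η z = ContinuousAlternatingMap.alternatizeUncurryFin (antilinearPart L)
      + ContinuousAlternatingMap.alternatizeUncurryFin (L - antilinearPart L) := by
    rw [← ContinuousAlternatingMap.alternatizeUncurryFin_add, add_sub_cancel]
    rfl
  -- The remaining part of the derivative is complex linear, so its alternatization raises p and not
  -- q.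
  have h2 : OfType (ContinuousAlternatingMap.alternatizeUncurryFin (L - antilinearPart L))
      (p + 1) q := by
    refine ofType_alternatize_linear _ (fun v => ?_) fun v => ?_
    · simp only [sub_apply, antilinearPart_I_smul]
      rw [antilinearPart_apply]
      generalize L (Complex.I • v) = B
      generalize L v = A
      match_scalars
      · linear_combination Complex.I_mul_I
      · ring
    · rw [sub_apply, sub_eq_add_neg]
      exact (OfType.fderiv_apply h hpq ht v).add
        (OfType.antilinearPart_fderiv_apply h hpq ht v).neg
  have h3 := OfType.dbarFlat h hpq ht
  rw [dbarFlat_def] at h3 ⊢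
  rw [h1, map_add, h3.typeProj_eq (by omega) (by omega), if_pos rfl,
    h2.typeProj_eq (by omega) (by omega), if_neg (by omega), add_zero]

variable [FiniteDimensional ℂ V]

lemma differentiableAt_pullback {η : V → V [⋀^Fin k]→L[ℝ] F} {f : V → V} {z : V}
    (hf : AnalyticAt ℂ f z) (hη : DifferentiableAt ℝ η (f z)) : DifferentiableAt ℝ
      (fun z => (η (f z)).compContinuousLinearMap ((fderiv ℂ f z).restrictScalars ℝ)) z := by
  have hA : DifferentiableAt ℝ (fun y => (fderiv ℂ f y).restrictScalars ℝ) z :=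
    (ContinuousLinearMap.restrictScalarsL ℂ V V ℝ ℝ).differentiableAt.comp z
      (hf.fderiv.restrictScalars (𝕜 := ℝ)).differentiableAt
  have h1 : DifferentiableAt ℝ (fun z => (η (f z), (fderiv ℂ f z).restrictScalars ℝ)) z :=
    (hη.comp z (hf.restrictScalars (𝕜 := ℝ)).differentiableAt).prodMk hA
  exact ((contDiff_compContinuousLinearMap 1 k).differentiable one_ne_zero _).comp z h1

/-- On each type component ∂̄ is a type component of d. The exterior derivative commutes with
pullback, and holomorphic pullback preserves types. -/
lemma dbarFlat_pullback {η : V → V [⋀^Fin k]→L[ℝ] F} {f : V → V} {z : V} (hf : AnalyticAt ℂ f z)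
    (hη : DifferentiableAt ℝ η (f z)) :
    dbarFlat (fun z => (η (f z)).compContinuousLinearMap ((fderiv ℂ f z).restrictScalars ℝ)) z
      = (dbarFlat η (f z)).compContinuousLinearMap ((fderiv ℂ f z).restrictScalars ℝ) := by
  have hfR : ContDiffAt ℝ ω f z := (hf.restrictScalars (𝕜 := ℝ)).contDiffAt
  have hfderiv : ∀ᶠ y in 𝓝 z, (fderiv ℂ f y).restrictScalars ℝ = fderiv ℝ f y := by
    filter_upwards [hf.eventually_analyticAt] with y hy
    exact (hy.differentiableAt.hasFDerivAt.restrictScalars ℝ).fderiv.symm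
  have hdq : ∀ q y, DifferentiableAt ℝ η y → DifferentiableAt ℝ (fun z => typeProj k q (η z)) y :=
    fun q y h => ((typeProjC (V := V) (W := F) k q).restrictScalars ℝ).differentiableAt.comp y h
  have key : ∀ q ≤ k, dbarFlat (fun z => (typeProj k q (η (f z))).compContinuousLinearMap
      ((fderiv ℂ f z).restrictScalars ℝ)) z =
      (dbarFlat (fun z => typeProj k q (η z)) (f z)).compContinuousLinearMap
        ((fderiv ℂ f z).restrictScalars ℝ) := by
    intro q hq
    have ht : ∀ z, OfType (typeProj k q (η z)) (k - q) q := fun z => ofType_typeProj _ hq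
    rw [dbarFlat_eq_typeProj_extDeriv (differentiableAt_pullback hf (hdq q _ hη)) (Nat.sub_add_cancel hq)
      (Filter.Eventually.of_forall fun z => (ht _).pullback _),
      dbarFlat_eq_typeProj_extDeriv (hdq q _ hη) (Nat.sub_add_cancel hq)
      (Filter.Eventually.of_forall ht), ← typeProj_pullback]
    congr 1
    have h1 : (fun z => (typeProj k q (η (f z))).compContinuousLinearMap
        ((fderiv ℂ f z).restrictScalars ℝ)) =ᶠ[𝓝 z] fun z =>
        (typeProj k q (η (f z))).compContinuousLinearMap (fderiv ℝ f z) := by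
      filter_upwards [hfderiv] with y hy
      rw [hy]
    rw [h1.extDeriv_eq, hfderiv.self_of_nhds]
    exact extDeriv_pullback (hdq q _ hη) hfR (by simp)
  have hs : ∀ y, ∑ q ∈ Finset.range (k + 1), typeProj k q (η y) = η y := fun y => sum_typeProj _
  have hcomp : ∀ (j : ℕ) (s : Finset ℕ) (g : ℕ → V [⋀^Fin j]→L[ℝ] F) (A : V →L[ℝ] V),
      (∑ q ∈ s, g q).compContinuousLinearMap A = ∑ q ∈ s, (g q).compContinuousLinearMap A := by
    intro j s g A
    ext m
    simp [ContinuousAlternatingMap.sum_apply]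
  have h1 := dbarFlat_sum (Finset.range (k + 1)) fun q _ => differentiableAt_pullback hf (hdq q _ hη)
  have h2 := dbarFlat_sum (Finset.range (k + 1)) fun q _ => hdq q _ hη
  simp only [hs] at h2
  simp only [← hcomp, hs] at h1
  rw [h1, h2, hcomp]
  exact Finset.sum_congr rfl fun q hq => key q (by simpa [Nat.lt_succ_iff] using hq)

/-- In the Leibniz rule the term with the derivative of `G` is complex linear, so it disappears from
the antilinear part. -/
lemma dbarFlat_compBilin {F' : Type*} [NormedAddCommGroup F'] [NormedSpace ℂ F']
    {G : V → F →L[ℂ] F'} {η : V → V [⋀^Fin k]→L[ℝ] F} {z : V}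
    (hG : DifferentiableAt ℂ G z) (hη : DifferentiableAt ℝ η z) :
    dbarFlat (fun z => compBilin V F F' k (G z) (η z)) z
      = compBilin V F F' (k + 1) (G z) (dbarFlat η z) := by
  have hd := ((isBoundedBilinearMap_compBilin V F F' k).hasFDerivAt _).comp z
    ((hG.hasFDerivAt.restrictScalars ℝ).prodMk hη.hasFDerivAt)
  ext m
  refine alternatizeUncurryFin_comp (G z) _ _ (fun v m => ?_) m
  erw [hd.fderiv]
  have hI : (2⁻¹ * Complex.I * Complex.I : ℂ) = -2⁻¹ := by
    rw [mul_assoc, Complex.I_mul_I]; ring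
  simp only [one_div, antilinearPart_apply, ContinuousLinearMap.coe_comp,
    Function.comp_apply, ContinuousLinearMap.prod_apply,
    ContinuousLinearMap.coe_restrictScalars', IsBoundedBilinearMap.deriv_apply, compBilin_apply,
    map_smul, smul_add, smul_smul, ContinuousAlternatingMap.add_apply,
    ContinuousAlternatingMap.smul_apply, map_add, _root_.smul_apply, hI,
    ContinuousLinearMap.compContinuousAlternatingMap_coe]
  module

end Pullback

end

noncomputable section

/-! ### Smooth forms on the manifold -/

section Manifold

variable {V X : Type u} [NormedAddCommGroup V] [NormedSpace ℂ V]
  [TopologicalSpace X] [ChartedSpace V X] [IsManifold 𝓘(ℂ, V) ω X]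

/-- The change of coordinates between the preferred charts at `x₁` and `x₂`. -/
def chartChange (x₁ x₂ : X) (z : V) : V := chartAt V x₂ ((chartAt V x₁).symm z)

lemma analyticAt_chartChange [FiniteDimensional ℂ V] {x₁ x₂ y : X}
    (h₁ : y ∈ (chartAt V x₁).source) (h₂ : y ∈ (chartAt V x₂).source) :
    AnalyticAt ℂ (chartChange x₁ x₂) (chartAt V x₁ y) := by
  have := FiniteDimensional.complete ℂ V
  have h := contDiffWithinAt_ext_coord_change (I := 𝓘(ℂ, V)) (n := ω) x₂ x₁
    (y := chartAt V x₁ y) (by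
      simp only [mfld_simps, PartialEquiv.trans_source]
      simp [h₁, h₂])
  simp only [mfld_simps] at h
  exact (contDiffWithinAt_univ.1 h).analyticAt

lemma hasFDerivAt_chartChange {x₁ x₂ y : X}
    (h₁ : y ∈ (chartAt V x₁).source) (h₂ : y ∈ (chartAt V x₂).source) :
    HasFDerivAt (chartChange x₁ x₂) (tangentCoordChange 𝓘(ℂ, V) x₁ x₂ y : V →L[ℂ] V)
      (chartAt V x₁ y) := by
  have h := hasFDerivWithinAt_tangentCoordChange (I := 𝓘(ℂ, V)) (x := x₁) (y := x₂) (z := y)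
    (by simp [h₁, h₂])
  simp only [mfld_simps] at h
  exact hasFDerivWithinAt_univ.1 h

lemma eventually_chart_symm {x y : X} (h : y ∈ (chartAt V x).source) {p : X → Prop}
    (hp : ∀ᶠ y in 𝓝 y, p y) : ∀ᶠ z in 𝓝 (chartAt V x y), p ((chartAt V x).symm z) := by
  have hc := (chartAt V x).continuousAt_symm ((chartAt V x).map_source h)
  rw [ContinuousAt, (chartAt V x).left_inv h] at hc
  exact hc.eventually hp

lemma eventually_chart {x y : X} (h : y ∈ (chartAt V x).source) {p : V → Prop}
    (hp : ∀ᶠ z in 𝓝 (chartAt V x y), p z) : ∀ᶠ y in 𝓝 y, p (chartAt V x y) :=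
  ((chartAt V x).continuousAt h).eventually hp

namespace HolomorphicVectorBundle

variable (𝓔 : HolomorphicVectorBundle V X)

/-- The domain around `x` in which both the preferred chart and the preferred trivialization are
defined. -/
def domain (x : X) : Set X :=
  (chartAt V x).source ∩ (trivializationAt 𝓔.F 𝓔.E x).baseSet

lemma isOpen_domain (x : X) : IsOpen (𝓔.domain x) :=
  (chartAt V x).open_source.inter (trivializationAt 𝓔.F 𝓔.E x).open_baseSet

lemma mem_domain (x : X) : x ∈ 𝓔.domain x :=
  ⟨mem_chart_source V x, mem_baseSet_trivializationAt 𝓔.F 𝓔.E x⟩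

lemma domain_mem_nhds {x y : X} (h : y ∈ 𝓔.domain x) : 𝓔.domain x ∈ 𝓝 y :=
  (𝓔.isOpen_domain x).mem_nhds h

/-- The transition functions of the bundle in local coordinates. -/
def fibreChange (x₁ x₂ : X) (z : V) : 𝓔.F →L[ℂ] 𝓔.F :=
  ((trivializationAt 𝓔.F 𝓔.E x₂).coordChangeL ℂ (trivializationAt 𝓔.F 𝓔.E x₁)
    ((chartAt V x₁).symm z) : 𝓔.F →L[ℂ] 𝓔.F)

lemma analyticAt_fibreChange {x₁ x₂ y : X} (h₁ : y ∈ 𝓔.domain x₁) (h₂ : y ∈ 𝓔.domain x₂) :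
    AnalyticAt ℂ (𝓔.fibreChange x₁ x₂) (chartAt V x₁ y) := by
  have := FiniteDimensional.complete ℂ 𝓔.F
  have h : ContMDiffAt 𝓘(ℂ, V) 𝓘(ℂ, 𝓔.F →L[ℂ] 𝓔.F) ω
      (fun b : X => ((trivializationAt 𝓔.F 𝓔.E x₂).coordChangeL ℂ
        (trivializationAt 𝓔.F 𝓔.E x₁) b : 𝓔.F →L[ℂ] 𝓔.F)) y :=
    contMDiffAt_coordChangeL h₂.2 h₁.2
  have hs : ContMDiffAt 𝓘(ℂ, V) 𝓘(ℂ, V) ω (chartAt V x₁).symm (chartAt V x₁ y) :=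
    (contMDiffOn_chart_symm (I := 𝓘(ℂ, V)) (x := x₁)).contMDiffAt
      ((chartAt V x₁).open_target.mem_nhds ((chartAt V x₁).map_source h₁.1))
  rw [← (chartAt V x₁).left_inv h₁.1] at h
  exact (contMDiffAt_iff_contDiffAt.1 (h.comp _ hs)).analyticAt

lemma continuousLinearMapAt_eq_coordChangeL {x₁ x₂ y : X}
    (h₁ : y ∈ (trivializationAt 𝓔.F 𝓔.E x₁).baseSet)
    (h₂ : y ∈ (trivializationAt 𝓔.F 𝓔.E x₂).baseSet) (e : 𝓔.E y) :
    (trivializationAt 𝓔.F 𝓔.E x₁).continuousLinearMapAt ℂ y e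
      = (trivializationAt 𝓔.F 𝓔.E x₂).coordChangeL ℂ (trivializationAt 𝓔.F 𝓔.E x₁) y
        ((trivializationAt 𝓔.F 𝓔.E x₂).continuousLinearMapAt ℂ y e) := by
  rw [Trivialization.coordChangeL_apply _ _ ⟨h₂, h₁⟩, ← Trivialization.symmL_apply (R := ℂ) _ h₂,
    Trivialization.symmL_continuousLinearMapAt _ h₂]
  simp [Trivialization.continuousLinearMapAt_apply, Trivialization.coe_linearMapAt_of_mem _ h₁]

lemma localRep_chart {k : ℕ} (η : 𝓔.Form k) {x y : X} (h : y ∈ (chartAt V x).source)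
    (m : Fin k → V) : 𝓔.localRep η x (chartAt V x y) m =
      (trivializationAt 𝓔.F 𝓔.E x).continuousLinearMapAt ℂ y
        (η y fun i => tangentCoordChange 𝓘(ℂ, V) x y y (m i)) := by
  rw [localRep_apply, (chartAt V x).left_inv h]

/-- The change of coordinates for the local expressions of a form. -/
lemma localRep_eq_of_mem {k : ℕ} (η : 𝓔.Form k) {x₁ x₂ : X} {y : X} (h₁ : y ∈ 𝓔.domain x₁)
    (h₂ : y ∈ 𝓔.domain x₂) :
    𝓔.localRep η x₁ (chartAt V x₁ y) =
      compBilin V 𝓔.F 𝓔.F k (𝓔.fibreChange x₁ x₂ (chartAt V x₁ y))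
        ((𝓔.localRep η x₂ (chartChange x₁ x₂ (chartAt V x₁ y))).compContinuousLinearMap
          ((fderiv ℂ (chartChange x₁ x₂) (chartAt V x₁ y)).restrictScalars ℝ)) := by
  rw [(hasFDerivAt_chartChange h₁.1 h₂.1).fderiv, chartChange, (chartAt V x₁).left_inv h₁.1]
  ext m
  rw [𝓔.localRep_chart η h₁.1, 𝓔.continuousLinearMapAt_eq_coordChangeL h₁.2 h₂.2]
  simp only [compBilin_apply, ContinuousLinearMap.compContinuousAlternatingMap_coe,
    Function.comp_apply, ContinuousAlternatingMap.compContinuousLinearMap_apply, fibreChange,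
    𝓔.localRep_chart η h₂.1, (chartAt V x₁).left_inv h₁.1]
  simp only [ContinuousLinearMap.coe_restrictScalars', ContinuousLinearEquiv.coe_coe]
  congr 3
  funext i
  exact (tangentCoordChange_comp (by simp [h₁.1, h₂.1])).symm

lemma localRep_eventuallyEq {k : ℕ} (η : 𝓔.Form k) {x₁ x₂ : X} {y : X} (h₁ : y ∈ 𝓔.domain x₁)
    (h₂ : y ∈ 𝓔.domain x₂) :
    𝓔.localRep η x₁ =ᶠ[𝓝 (chartAt V x₁ y)] fun z =>
      compBilin V 𝓔.F 𝓔.F k (𝓔.fibreChange x₁ x₂ z)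
        ((𝓔.localRep η x₂ (chartChange x₁ x₂ z)).compContinuousLinearMap
          ((fderiv ℂ (chartChange x₁ x₂) z).restrictScalars ℝ)) := by
  filter_upwards [eventually_chart_symm h₁.1 (𝓔.domain_mem_nhds h₁),
    eventually_chart_symm h₁.1 (𝓔.domain_mem_nhds h₂),
    (chartAt V x₁).open_target.mem_nhds ((chartAt V x₁).map_source h₁.1)] with z hz₁ hz₂ hz
  have := 𝓔.localRep_eq_of_mem η hz₁ hz₂
  rwa [(chartAt V x₁).right_inv hz] at this

/-- Smoothness of a form at a point. -/
def SmoothAt {k : ℕ} (η : 𝓔.Form k) (x : X) : Prop :=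
  ContDiffAt ℝ ∞ (𝓔.localRep η x) (chartAt V x x)

variable {𝓔} [FiniteDimensional ℂ V]

/-- Charts and trivializations change holomorphically, hence smoothly over ℝ. Smoothness thus does
not depend on the chart, although `SmoothAt` uses the one at the point. -/
lemma contDiffAt_localRep {k : ℕ} {η : 𝓔.Form k} {x₁ x₂ y : X} (h₁ : y ∈ 𝓔.domain x₁)
    (h₂ : y ∈ 𝓔.domain x₂) (h : ContDiffAt ℝ ∞ (𝓔.localRep η x₂) (chartAt V x₂ y)) :
    ContDiffAt ℝ ∞ (𝓔.localRep η x₁) (chartAt V x₁ y) := by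
  refine ContDiffAt.congr_of_eventuallyEq ?_ (𝓔.localRep_eventuallyEq η h₁ h₂)
  have hf := analyticAt_chartChange h₁.1 h₂.1
  have hG := 𝓔.analyticAt_fibreChange h₁ h₂
  have hf0 : chartChange x₁ x₂ (chartAt V x₁ y) = chartAt V x₂ y := by
    rw [chartChange, (chartAt V x₁).left_inv h₁.1]
  have hfR : ContDiffAt ℝ ∞ (chartChange x₁ x₂) (chartAt V x₁ y) :=
    (hf.restrictScalars (𝕜 := ℝ)).contDiffAt
  have hA : ContDiffAt ℝ ∞ (fun z => (fderiv ℂ (chartChange x₁ x₂) z).restrictScalars ℝ)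
      (chartAt V x₁ y) :=
    (ContinuousLinearMap.restrictScalarsL ℂ V V ℝ ℝ).contDiff.contDiffAt.comp _
      ((hf.fderiv.restrictScalars (𝕜 := ℝ)).contDiffAt)
  have h1 : ContDiffAt ℝ ∞ (fun z => 𝓔.localRep η x₂ (chartChange x₁ x₂ z)) (chartAt V x₁ y) :=
    ContDiffAt.comp (g := 𝓔.localRep η x₂) _ (by rwa [hf0]) hfR
  have h2 := (contDiff_compContinuousLinearMap (F := 𝓔.F) ∞ k).contDiffAt.comp _ (h1.prodMk hA)
  exact (isBoundedBilinearMap_compBilin V 𝓔.F 𝓔.F k).contDiff.contDiffAt.comp _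
    (((hG.restrictScalars (𝕜 := ℝ)).contDiffAt).prodMk h2)

lemma smoothAt_iff {k : ℕ} {η : 𝓔.Form k} {x y : X} (h : y ∈ 𝓔.domain x) :
    𝓔.SmoothAt η y ↔ ContDiffAt ℝ ∞ (𝓔.localRep η x) (chartAt V x y) :=
  ⟨contDiffAt_localRep h (𝓔.mem_domain y), contDiffAt_localRep (𝓔.mem_domain y) h⟩

variable (𝓔) in
lemma localRep_self {k : ℕ} (η : 𝓔.Form k) (x : X) :
    𝓔.localRep η x (chartAt V x x) =
      ((𝓔.fibreIso x).toContinuousLinearMap.restrictScalars ℝ).compContinuousAlternatingMap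
        (η x) := by
  ext m
  rw [localRep_apply, (chartAt V x).left_inv (mem_chart_source V x)]
  have h : (fun i => tangentCoordChange 𝓘(ℂ, V) x x x (m i)) = m := by
    funext i
    exact tangentCoordChange_self (by simp)
  rw [h]
  simp only [ContinuousLinearMap.compContinuousAlternatingMap_coe, Function.comp_apply,
    ContinuousLinearMap.coe_restrictScalars', ContinuousLinearEquiv.coe_coe, fibreIso]
  rw [← Trivialization.coe_continuousLinearEquivAt_eq _
      (mem_baseSet_trivializationAt 𝓔.F 𝓔.E x)]

/-- The local expressions of `∂̄η`. -/
lemma localRep_dbar {k : ℕ} {η : 𝓔.Form k} {x y : X} (h : y ∈ 𝓔.domain x) (hη : 𝓔.SmoothAt η y) :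
    𝓔.localRep (𝓔.dbar η) x (chartAt V x y) = dbarFlat (𝓔.localRep η x) (chartAt V x y) := by
  have hy := 𝓔.mem_domain y
  have h1 : 𝓔.localRep (𝓔.dbar η) y (chartAt V y y)
      = dbarFlat (𝓔.localRep η y) (chartAt V y y) := by
    rw [localRep_self]
    ext m
    simp [dbar]
  have hf0 : chartChange x y (chartAt V x y) = chartAt V y y := by
    rw [chartChange, (chartAt V x).left_inv h.1]
  have hf := analyticAt_chartChange h.1 hy.1
  have hd : DifferentiableAt ℝ (𝓔.localRep η y) (chartChange x y (chartAt V x y)) := by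
    rw [hf0]
    exact ContDiffAt.differentiableAt hη (by simp)
  rw [𝓔.localRep_eq_of_mem _ h hy, dbarFlat_congr (𝓔.localRep_eventuallyEq η h hy),
    dbarFlat_compBilin (𝓔.analyticAt_fibreChange h hy).differentiableAt
      (differentiableAt_pullback hf hd), dbarFlat_pullback hf hd, hf0, h1]

end HolomorphicVectorBundle

end Manifold

end

noncomputable section

/-! ### Smooth functions and the Dolbeault lemma on the manifold -/

section SmoothFunctions

variable {V X : Type u} [NormedAddCommGroup V] [NormedSpace ℂ V]
  [TopologicalSpace X] [ChartedSpace V X] [IsManifold 𝓘(ℂ, V) ω X]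

/-- The smooth manifold underlying a complex manifold. -/
lemma isManifold_real [FiniteDimensional ℂ V] : IsManifold 𝓘(ℝ, V) ∞ X := by
  refine isManifold_of_contDiffOn _ _ _ fun e e' he he' => ?_
  have h := (contDiffGroupoid ω 𝓘(ℂ, V)).compatible he he'
  have h' := (contDiffGroupoid ω 𝓘(ℂ, V)).mem_of_eqOnSource h (Setoid.refl _)
  rw [contDiffGroupoid, mem_groupoid_of_pregroupoid] at h
  have h1 := h.1
  simp only [contDiffPregroupoid, mfld_simps] at h1 ⊢
  exact (h1.restrict_scalars ℝ).of_le le_top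

/-- The smooth real functions. -/
def smoothFunctions (V X : Type u) [NormedAddCommGroup V] [NormedSpace ℂ V]
    [TopologicalSpace X] [ChartedSpace V X] : Subalgebra ℝ (X → ℝ) where
  carrier := {f | ContMDiff 𝓘(ℝ, V) 𝓘(ℝ) ∞ f}
  mul_mem' hf hg := ContMDiff.mul hf hg
  add_mem' hf hg := ContMDiff.add hf hg
  algebraMap_mem' _ := contMDiff_const

lemma hasPartitions_smoothFunctions [FiniteDimensional ℂ V] [T2Space X] [SigmaCompactSpace X] :
    GermSheaf.HasPartitions (smoothFunctions V X) := by
  have : IsManifold 𝓘(ℝ, V) ∞ X := isManifold_real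
  have := FiniteDimensional.complexToReal V
  intro U hU hx
  obtain ⟨f, hf⟩ := SmoothPartitionOfUnity.exists_isSubordinate 𝓘(ℝ, V) isClosed_univ U hU
    (fun x _ => Set.mem_iUnion.2 ⟨x, hx x⟩)
  exact ⟨fun i => ⟨f i, (f i).contMDiff⟩, f.locallyFinite, hf, fun x => f.sum_eq_one (Set.mem_univ x)⟩

lemma contDiffAt_smoothFunctions [FiniteDimensional ℂ V] (f : smoothFunctions V X) (x : X) :
    ContDiffAt ℝ ∞ (fun z => (f : X → ℝ) ((chartAt V x).symm z)) (chartAt V x x) := by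
  have : IsManifold 𝓘(ℝ, V) ∞ X := isManifold_real
  have hs : ContMDiffAt 𝓘(ℝ, V) 𝓘(ℝ, V) ∞ (chartAt V x).symm (chartAt V x x) :=
    (contMDiffOn_chart_symm (I := 𝓘(ℝ, V)) (x := x)).contMDiffAt
      ((chartAt V x).open_target.mem_nhds (mem_chart_target V x))
  have hf : ContMDiff 𝓘(ℝ, V) 𝓘(ℝ) ∞ (f : X → ℝ) := f.2
  exact contMDiffAt_iff_contDiffAt.1 (hf.contMDiffAt.comp _ hs)

namespace HolomorphicVectorBundle

variable (𝓔 : HolomorphicVectorBundle V X)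

/-- Multiplication of a form at `x` by a smooth function. -/
instance formModule (k : ℕ) (x : X) : Module (smoothFunctions V X) (V [⋀^Fin k]→L[ℝ] 𝓔.E x) :=
  Module.compHom _ ((Pi.evalRingHom (fun _ : X => ℝ) x).comp
    (smoothFunctions V X).subtype)

lemma function_smul_def {k : ℕ} {x : X} (f : smoothFunctions V X) (m : V [⋀^Fin k]→L[ℝ] 𝓔.E x) :
    f • m = (f : X → ℝ) x • m := rfl

variable {𝓔} [FiniteDimensional ℂ V]

lemma SmoothAt.add {k : ℕ} {η η' : 𝓔.Form k} {x : X} (h : 𝓔.SmoothAt η x) (h' : 𝓔.SmoothAt η' x) :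
    𝓔.SmoothAt (η + η') x := by
  rw [SmoothAt, localRep_add]
  exact ContDiffAt.add h h'

lemma SmoothAt.const_smul {k : ℕ} {η : 𝓔.Form k} {x : X} (c : ℂ) (h : 𝓔.SmoothAt η x) :
    𝓔.SmoothAt (c • η) x := by
  rw [SmoothAt, localRep_smul]
  exact ContDiffAt.const_smul c h

lemma SmoothAt.zero {k : ℕ} {x : X} : 𝓔.SmoothAt (0 : 𝓔.Form k) x := by
  rw [SmoothAt, localRep_zero]
  exact contDiffAt_const

lemma SmoothAt.congr {k : ℕ} {η η' : 𝓔.Form k} {x : X} (h : 𝓔.SmoothAt η x)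
    (he : ∀ᶠ y in 𝓝 x, η y = η' y) : 𝓔.SmoothAt η' x :=
  ContDiffAt.congr_of_eventuallyEq h (𝓔.localRep_congr he).symm

lemma SmoothAt.function_smul {k : ℕ} {η : 𝓔.Form k} {x : X} (f : smoothFunctions V X)
    (h : 𝓔.SmoothAt η x) : 𝓔.SmoothAt (fun y => f • η y) x := by
  have h1 : 𝓔.localRep (fun y => f • η y) x =
      fun z => (f : X → ℝ) ((chartAt V x).symm z) • 𝓔.localRep η x z := by
    ext z m
    simp only [localRep_apply, function_smul_def, ContinuousAlternatingMap.smul_apply]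
    exact (((trivializationAt 𝓔.F 𝓔.E x).continuousLinearMapAt ℂ
      ((chartAt V x).symm z)).restrictScalars ℝ).map_smul _ _
  rw [SmoothAt, h1]
  exact (contDiffAt_smoothFunctions f x).smul h

lemma dbar_congr {k : ℕ} {η η' : 𝓔.Form k} {x : X} (he : ∀ᶠ y in 𝓝 x, η y = η' y) :
    𝓔.dbar η x = 𝓔.dbar η' x := by
  simp only [dbar, dbarFlat_congr (𝓔.localRep_congr he)]

lemma dbar_add_at {k : ℕ} {η η' : 𝓔.Form k} {x : X} (h : 𝓔.SmoothAt η x)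
    (h' : 𝓔.SmoothAt η' x) : 𝓔.dbar (η + η') x = 𝓔.dbar η x + 𝓔.dbar η' x := by
  have h1 := dbarFlat_add (ContDiffAt.differentiableAt h (by simp))
    (ContDiffAt.differentiableAt h' (by simp))
  simp only [dbar, localRep_add]
  have h2 : dbarFlat (𝓔.localRep η x + 𝓔.localRep η' x) (chartAt V x x) =
    dbarFlat (𝓔.localRep η x) (chartAt V x x) + dbarFlat (𝓔.localRep η' x) (chartAt V x x) := h1
  rw [h2]
  ext m
  simp

/-- `dbar` is computed at each point in the chart of that point; `localRep_dbar` brings all nearby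
values into one chart, so results on ∂̄ in a vector space apply. -/
lemma localRep_dbar_eventuallyEq {k : ℕ} {η : 𝓔.Form k} {x : X}
    (h : ∀ᶠ y in 𝓝 x, 𝓔.SmoothAt η y) :
    𝓔.localRep (𝓔.dbar η) x =ᶠ[𝓝 (chartAt V x x)] dbarFlat (𝓔.localRep η x) := by
  have hx := mem_chart_source V x
  filter_upwards [eventually_chart_symm hx h,
    eventually_chart_symm hx (𝓔.domain_mem_nhds (𝓔.mem_domain x)),
    (chartAt V x).open_target.mem_nhds (mem_chart_target V x)] with z h1 h2 hz
  have := localRep_dbar h2 h1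
  rwa [(chartAt V x).right_inv hz] at this

lemma contDiffAt_localRep_eventually {k : ℕ} {η : 𝓔.Form k} {x : X}
    (h : ∀ᶠ y in 𝓝 x, 𝓔.SmoothAt η y) :
    ∀ᶠ z in 𝓝 (chartAt V x x), ContDiffAt ℝ ∞ (𝓔.localRep η x) z := by
  have hx := mem_chart_source V x
  filter_upwards [eventually_chart_symm hx h,
    eventually_chart_symm hx (𝓔.domain_mem_nhds (𝓔.mem_domain x)),
    (chartAt V x).open_target.mem_nhds (mem_chart_target V x)] with z h1 h2 hz
  have := (smoothAt_iff h2).1 h1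
  rwa [(chartAt V x).right_inv hz] at this

lemma SmoothAt.dbar {k : ℕ} {η : 𝓔.Form k} {x : X} (h : ∀ᶠ y in 𝓝 x, 𝓔.SmoothAt η y) :
    𝓔.SmoothAt (𝓔.dbar η) x :=
  (ContDiffAt.dbarFlat h.self_of_nhds).congr_of_eventuallyEq (localRep_dbar_eventuallyEq h)

lemma dbar_dbar {k : ℕ} {η : 𝓔.Form k} {x : X} (h : ∀ᶠ y in 𝓝 x, 𝓔.SmoothAt η y) :
    𝓔.dbar (𝓔.dbar η) x = 0 := by
  ext m
  rw [HolomorphicVectorBundle.dbar, dbarFlat_congr (localRep_dbar_eventuallyEq h),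
    dbarFlat_dbarFlat h.self_of_nhds]
  simp

lemma OfType.localRep {k : ℕ} {η : 𝓔.Form k} {x : X} {p q : ℕ} {z : V}
    (h : OfType (η ((chartAt V x).symm z)) p q) : OfType (𝓔.localRep η x z) p q := by
  intro c m
  simp only [localRep_apply, map_smul]
  rw [h c, map_smul]

lemma OfType.eventually_localRep {k : ℕ} {η : 𝓔.Form k} {x : X} {p q : ℕ}
    (h : ∀ᶠ y in 𝓝 x, OfType (η y) p q) :
    ∀ᶠ z in 𝓝 (chartAt V x x), OfType (𝓔.localRep η x z) p q := by
  filter_upwards [eventually_chart_symm (mem_chart_source V x) h] with z hz using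
    OfType.localRep hz

lemma OfType.dbar {k : ℕ} {η : 𝓔.Form k} {x : X} {p q : ℕ} (hpq : p + q = k)
    (hs : 𝓔.SmoothAt η x) (h : ∀ᶠ y in 𝓝 x, OfType (η y) p q) :
    OfType (𝓔.dbar η x) p (q + 1) := by
  have h1 := OfType.dbarFlat (ContDiffAt.differentiableAt hs (by simp)) hpq
    (OfType.eventually_localRep h)
  intro c m
  simp only [HolomorphicVectorBundle.dbar,
    ContinuousLinearMap.compContinuousAlternatingMap_coe, Function.comp_apply]
  rw [h1 c m, ContinuousLinearMap.coe_restrictScalars', map_smul]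

variable (𝓔) in
/-- The form on `X` with a given local expression. -/
def ofLocal {k : ℕ} (γ : V → V [⋀^Fin k]→L[ℝ] 𝓔.F) (x : X) : 𝓔.Form k := fun y =>
  (((trivializationAt 𝓔.F 𝓔.E x).symmL ℂ y).restrictScalars ℝ).compContinuousAlternatingMap
    ((γ (chartAt V x y)).compContinuousLinearMap
      ((tangentCoordChange 𝓘(ℂ, V) y x y).restrictScalars ℝ))

lemma ofLocal_apply {k : ℕ} (γ : V → V [⋀^Fin k]→L[ℝ] 𝓔.F) (x y : X) (m : Fin k → V) :
    𝓔.ofLocal γ x y m = (trivializationAt 𝓔.F 𝓔.E x).symmL ℂ y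
      (γ (chartAt V x y) fun i => tangentCoordChange 𝓘(ℂ, V) y x y (m i)) := rfl

lemma localRep_ofLocal {k : ℕ} (γ : V → V [⋀^Fin k]→L[ℝ] 𝓔.F) {x y : X} (h : y ∈ 𝓔.domain x) :
    𝓔.localRep (𝓔.ofLocal γ x) x (chartAt V x y) = γ (chartAt V x y) := by
  ext m
  rw [localRep_chart _ _ h.1, ofLocal_apply, Trivialization.continuousLinearMapAt_symmL _ h.2]
  congr 1
  funext i
  have h1 := h.1
  rw [tangentCoordChange_comp (by simp [h1]), tangentCoordChange_self (by simp [h1])]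

lemma ofLocal_localRep {k : ℕ} (η : 𝓔.Form k) {x y : X} (h : y ∈ 𝓔.domain x) :
    𝓔.ofLocal (𝓔.localRep η x) x y = η y := by
  ext m
  rw [ofLocal_apply, localRep_chart _ _ h.1, Trivialization.symmL_continuousLinearMapAt _ h.2]
  congr 1
  funext i
  have h1 := h.1
  rw [tangentCoordChange_comp (by simp [h1]), tangentCoordChange_self (by simp)]

lemma eq_of_localRep_eq {k : ℕ} {η η' : 𝓔.Form k} {x y : X} (h : y ∈ 𝓔.domain x)
    (he : 𝓔.localRep η x (chartAt V x y) = 𝓔.localRep η' x (chartAt V x y)) : η y = η' y := by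
  rw [← ofLocal_localRep η h, ← ofLocal_localRep η' h, ofLocal, ofLocal, he]

lemma OfType.ofLocal {k : ℕ} {γ : V → V [⋀^Fin k]→L[ℝ] 𝓔.F} {p q : ℕ}
    (h : ∀ z, OfType (γ z) p q) (x y : X) : OfType (𝓔.ofLocal γ x y) p q := by
  intro c m
  simp only [ofLocal_apply, map_smul]
  rw [h _ c, map_smul]

/-- The Dolbeault lemma on `X`. -/
theorem exists_dbar_eq {k : ℕ} {η : 𝓔.Form (k + 1)} {x : X} {p q : ℕ} (hpq : p + q = k)
    (hη : ∀ᶠ y in 𝓝 x, 𝓔.SmoothAt η y) (hd : ∀ᶠ y in 𝓝 x, 𝓔.dbar η y = 0)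
    (ht : ∀ᶠ y in 𝓝 x, OfType (η y) p (q + 1)) :
    ∃ γ : 𝓔.Form k, (∀ᶠ y in 𝓝 x, 𝓔.SmoothAt γ y) ∧ (∀ y, OfType (γ y) p q) ∧
      ∀ᶠ y in 𝓝 x, 𝓔.dbar γ y = η y := by
  have := FiniteDimensional.complete ℂ 𝓔.F
  have hx := mem_chart_source V x
  have hdom := 𝓔.domain_mem_nhds (𝓔.mem_domain x)
  have hd' : ∀ᶠ z in 𝓝 (chartAt V x x), dbarFlat (𝓔.localRep η x) z = 0 := by
    filter_upwards [localRep_dbar_eventuallyEq hη, eventually_chart_symm hx hd] with z h1 h2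
    rw [← h1]
    ext m
    rw [localRep_apply, h2]
    simp
  obtain ⟨γ, hγ, hγt, hγe⟩ := exists_dbarFlat_eq hpq (contDiffAt_localRep_eventually hη) hd'
    (OfType.eventually_localRep ht)
  have hrep : ∀ y ∈ 𝓔.domain x,
      𝓔.localRep (𝓔.ofLocal γ x) x =ᶠ[𝓝 (chartAt V x y)] γ := by
    intro y hy
    filter_upwards [eventually_chart_symm hy.1 (𝓔.domain_mem_nhds hy),
      (chartAt V x).open_target.mem_nhds ((chartAt V x).map_source hy.1)] with z h2 hz
    have := localRep_ofLocal γ h2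
    rwa [(chartAt V x).right_inv hz] at this
  have hsm : ∀ y ∈ 𝓔.domain x, 𝓔.SmoothAt (𝓔.ofLocal γ x) y := fun y hy =>
    (smoothAt_iff hy).2 (hγ.contDiffAt.congr_of_eventuallyEq (hrep y hy))
  refine ⟨𝓔.ofLocal γ x, ?_, OfType.ofLocal hγt x, ?_⟩
  · filter_upwards [hdom] with y hy using hsm y hy
  · filter_upwards [hdom, eventually_chart hx hγe] with y hy he
    refine eq_of_localRep_eq hy ?_
    rw [localRep_dbar hy (hsm y hy), dbarFlat_congr (hrep y hy), he]

/-- Smooth `∂̄`-closed forms of type `(p, 0)` are holomorphic. -/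
lemma analyticAt_localRep {p : ℕ} {η : 𝓔.Form p} {x : X} (hη : ∀ᶠ y in 𝓝 x, 𝓔.SmoothAt η y)
    (hd : ∀ᶠ y in 𝓝 x, 𝓔.dbar η y = 0) (ht : ∀ᶠ y in 𝓝 x, OfType (η y) p 0) :
    AnalyticAt ℂ (𝓔.localRep η x) (chartAt V x x) := by
  have := FiniteDimensional.complete ℂ 𝓔.F
  have hx := mem_chart_source V x
  refine analyticAt_of_antilinearPart_fderiv_eq_zero (contDiffAt_localRep_eventually hη) ?_
  filter_upwards [localRep_dbar_eventuallyEq hη, eventually_chart_symm hx hd,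
    (OfType.eventually_localRep ht).eventually_nhds, contDiffAt_localRep_eventually hη]
    with z h1 h2 h3 h4
  have h5 : dbarFlat (𝓔.localRep η x) z = 0 := by
    rw [← h1]
    ext m
    rw [localRep_apply, h2]
    simp
  ext1 v
  rw [zero_apply, ← map_zero (contractBar v), ← h5]
  -- A form of type (p, 0) has no antiholomorphic components, so contracting ∂̄η with `v` leaves the
  -- antilinear derivative of the coefficients.
  cases p with
  | zero => exact (contractBar_dbarFlat_zero _ z v).symm
  | succ p =>
    refine (contractBar_dbarFlat_of_eq_zero (h4.differentiableAt (by simp)) ?_).symm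
    filter_upwards [h3] with y hy
    exact contractBar_eq_zero_iff.2 (hy.cons_I_smul v)

lemma SmoothAt.of_analyticAt {k : ℕ} {η : 𝓔.Form k} {x : X}
    (h : AnalyticAt ℂ (𝓔.localRep η x) (chartAt V x x)) : 𝓔.SmoothAt η x :=
  (h.restrictScalars (𝕜 := ℝ)).contDiffAt

lemma dbar_eq_zero_of_analyticAt {k : ℕ} {η : 𝓔.Form k} {x : X}
    (h : AnalyticAt ℂ (𝓔.localRep η x) (chartAt V x x)) : 𝓔.dbar η x = 0 := by
  have h1 := (h.differentiableAt.hasFDerivAt.restrictScalars ℝ).fderiv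
  have h2 : ContinuousAlternatingMap.alternatizeUncurryFin
      (0 : V →L[ℝ] V [⋀^Fin k]→L[ℝ] 𝓔.F) = 0 :=
    map_zero (ContinuousAlternatingMap.alternatizeUncurryFinCLM ℝ V 𝓔.F)
  ext m
  rw [HolomorphicVectorBundle.dbar, dbarFlat_def, h1, antilinearPart_restrictScalars, h2]
  simp

lemma Hom.smoothAt_form {𝓔' : HolomorphicVectorBundle V X} (φ : Hom 𝓔 𝓔') {k : ℕ} {η : 𝓔.Form k}
    {x : X} (h : 𝓔.SmoothAt η x) : 𝓔'.SmoothAt (φ.form k η) x := by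
  refine ContDiffAt.congr_of_eventuallyEq ?_ (φ.localRep_form η x)
  exact (isBoundedBilinearMap_compBilin V 𝓔.F 𝓔'.F k).contDiff.contDiffAt.comp _
    (((φ.analyticAt x).restrictScalars (𝕜 := ℝ)).contDiffAt.prodMk h)

lemma Hom.dbar_form_at {𝓔' : HolomorphicVectorBundle V X} (φ : Hom 𝓔 𝓔') {k : ℕ} {η : 𝓔.Form k}
    {x : X} (h : 𝓔.SmoothAt η x) : 𝓔'.dbar (φ.form k η) x = φ.form (k + 1) (𝓔.dbar η) x := by
  have h1 : dbarFlat (𝓔'.localRep (φ.form k η) x) (chartAt V x x) =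
      compBilin V 𝓔.F 𝓔'.F (k + 1) (homRep φ.map x (chartAt V x x))
        (dbarFlat (𝓔.localRep η x) (chartAt V x x)) := by
    rw [dbarFlat_congr (φ.localRep_form η x)]
    exact dbarFlat_compBilin (φ.analyticAt x).differentiableAt
      (ContDiffAt.differentiableAt h (by simp))
  ext m
  simp only [HolomorphicVectorBundle.dbar, h1, form_apply, compBilin_apply,
    ContinuousLinearMap.compContinuousAlternatingMap_coe, Function.comp_apply,
    ContinuousLinearMap.coe_restrictScalars', homRep_self]
  simp

lemma Hom.ofType_form {𝓔' : HolomorphicVectorBundle V X} (φ : Hom 𝓔 𝓔') {k : ℕ} {η : 𝓔.Form k}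
    {x : X} {p q : ℕ} (h : OfType (η x) p q) : OfType (φ.form k η x) p q := by
  intro c m
  simp only [form_apply]
  rw [h c, map_smul]

end HolomorphicVectorBundle

end SmoothFunctions

end

noncomputable section

/-! ### Sheaves of smooth, of closed and of holomorphic forms -/

section FormSheaves

variable {V X : Type u} [NormedAddCommGroup V] [NormedSpace ℂ V]
  [TopologicalSpace X] [ChartedSpace V X] [IsManifold 𝓘(ℂ, V) ω X] [FiniteDimensional ℂ V]

/-- Between two operators a section is restricted and extended by zero again; locality makes this
invisible, so an identity on germs suffices. -/
lemma GermSheaf.sheafHom_comp_eq {X : Type u} [TopologicalSpace X]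
    {M : X → Type u} [∀ x, AddCommGroup (M x)] {N : X → Type u} [∀ x, AddCommGroup (N x)]
    {N' : X → Type u} [∀ x, AddCommGroup (N' x)] {P : X → Type u} [∀ x, AddCommGroup (P x)]
    {F : GermSheaf M} {G : GermSheaf N} {G' : GermSheaf N'} {H : GermSheaf P}
    {f : GermSheaf.Hom F G} {g : GermSheaf.Hom G H} {f' : GermSheaf.Hom F G'}
    {g' : GermSheaf.Hom G' H}
    (h : ∀ {x : X} {s : ∀ y, M y}, (∀ᶠ y in 𝓝 x, s ∈ F.good y) →
      g.toFun (f.toFun s) x = g'.toFun (f'.toFun s) x) :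
    CategoryTheory.CategoryStruct.comp f.sheafHom g.sheafHom =
      CategoryTheory.CategoryStruct.comp f'.sheafHom g'.sheafHom := by
  ext U s
  refine Subtype.ext (funext fun x => ?_)
  have hU := U.unop.isOpen
  have hs := GermSheaf.good_ext0 (F := F) hU s x.2
  exact (g.congr' (GermSheaf.ext0_restrict hU _ x.2)).trans
    ((h hs).trans (g'.congr' (GermSheaf.ext0_restrict hU _ x.2)).symm)

namespace HolomorphicVectorBundle

open CategoryTheory Opposite TopologicalSpace

variable (𝓔 : HolomorphicVectorBundle V X)

/-- The sheaf of smooth `k`-forms of type `(p, q)`. -/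
def smoothSheaf (k p q : ℕ) : GermSheaf fun x : X => V [⋀^Fin k]→L[ℝ] 𝓔.E x where
  good x :=
    { carrier := {s | 𝓔.SmoothAt s x ∧ OfType (s x) p q}
      add_mem' hs ht := ⟨hs.1.add ht.1, hs.2.add ht.2⟩
      zero_mem' := ⟨SmoothAt.zero, OfType.zero⟩
      neg_mem' {s} hs := ⟨by simpa using hs.1.const_smul (-1), hs.2.neg⟩ }
  congr h hs := ⟨hs.1.congr h, h.self_of_nhds ▸ hs.2⟩

/-- The sheaf of `∂̄`-closed smooth `k`-forms of type `(p, q)`. -/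
def closedSheaf (k p q : ℕ) : GermSheaf fun x : X => V [⋀^Fin k]→L[ℝ] 𝓔.E x where
  good x :=
    { carrier := {s | 𝓔.SmoothAt s x ∧ OfType (s x) p q ∧ 𝓔.dbar s x = 0}
      add_mem' hs ht := ⟨hs.1.add ht.1, hs.2.1.add ht.2.1, by
        rw [dbar_add_at hs.1 ht.1, hs.2.2, ht.2.2, add_zero]⟩
      zero_mem' := ⟨SmoothAt.zero, OfType.zero, by
        simpa using congrFun (𝓔.dbar_smul 0 (0 : 𝓔.Form k)) x⟩
      neg_mem' {s} hs := ⟨by simpa using hs.1.const_smul (-1), hs.2.1.neg, by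
        simpa [hs.2.2] using congrFun (𝓔.dbar_smul (-1) s) x⟩ }
  congr h hs := ⟨hs.1.congr h, h.self_of_nhds ▸ hs.2.1, (dbar_congr h).symm.trans hs.2.2⟩

lemma closedSheaf_le (k p q : ℕ) (x : X) :
    (𝓔.closedSheaf k p q).good x ≤ (𝓔.smoothSheaf k p q).good x := fun _ hs => ⟨hs.1, hs.2.1⟩

/-- The operator `∂̄` as a morphism of sheaves. -/
def dbarHom {k p q : ℕ} (hpq : p + q = k) :
    GermSheaf.Hom (𝓔.smoothSheaf k p q) (𝓔.closedSheaf (k + 1) p (q + 1)) where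
  toFun s := 𝓔.dbar s
  congr' h := dbar_congr h
  map_good h := ⟨SmoothAt.dbar (h.mono fun _ h => h.1),
    OfType.dbar hpq h.self_of_nhds.1 (h.mono fun _ h => h.2), dbar_dbar (h.mono fun _ h => h.1)⟩
  map_add hs ht := dbar_add_at hs.1 ht.1

/-- The Dolbeault lemma as the exact sequence 0 → Z^{p,q} → A^{p,q} → Z^{p,q+1} → 0. -/
lemma isKernel_dbarHom {k p q : ℕ} (hpq : p + q = k) :
    GermSheaf.IsKernel (𝓔.closedSheaf_le k p q) (𝓔.dbarHom hpq) where
  ker h := ⟨fun h' => h'.mono fun _ h => h.2.2,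
    fun h' => (h.and h').mono fun _ h => ⟨h.1.1, h.1.2, h.2⟩⟩
  surj h := by
    obtain ⟨γ, h1, h2, h3⟩ := exists_dbar_eq hpq (h.mono fun _ h => h.1)
      (h.mono fun _ h => h.2.2) (h.mono fun _ h => h.2.1)
    exact ⟨γ, h1.mono fun y h => ⟨h, h2 y⟩, h3⟩

lemma isFine_smoothSheaf (k p q : ℕ) :
    (𝓔.smoothSheaf k p q).IsFine (R := smoothFunctions V X) where
  smul_eq_zero h m := by
    rw [function_smul_def, h.self_of_nhds, zero_smul]
  smul_good {x} f s hs := ⟨hs.1.function_smul f, by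
    have h : f • s x = (((f : X → ℝ) x : ℝ) : ℂ) • s x := by
      ext m
      exact (Complex.coe_smul _ _).symm
    exact (congrArg (fun η => OfType η p q) h).mpr (hs.2.smul _)⟩

variable {𝓔} {𝓔' : HolomorphicVectorBundle V X} (φ : Hom 𝓔 𝓔')

/-- The action of a morphism of bundles on smooth forms. -/
def Hom.smoothHom (k p q : ℕ) : GermSheaf.Hom (𝓔.smoothSheaf k p q) (𝓔'.smoothSheaf k p q) where
  toFun s := φ.form k s
  congr' h := congrArg ((φ.map _).restrictScalars ℝ).compContinuousAlternatingMap h.self_of_nhds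
  map_good h := ⟨φ.smoothAt_form h.self_of_nhds.1, φ.ofType_form h.self_of_nhds.2⟩
  map_add _ _ := by rw [map_add, Pi.add_apply]

/-- The action of a morphism of bundles on closed forms. -/
def Hom.closedHom (k p q : ℕ) : GermSheaf.Hom (𝓔.closedSheaf k p q) (𝓔'.closedSheaf k p q) where
  toFun s := φ.form k s
  congr' h := congrArg ((φ.map _).restrictScalars ℝ).compContinuousAlternatingMap h.self_of_nhds
  map_good {x s} h := ⟨φ.smoothAt_form h.self_of_nhds.1, φ.ofType_form h.self_of_nhds.2.1, by
    rw [φ.dbar_form_at h.self_of_nhds.1]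
    ext m
    rw [Hom.form_apply, h.self_of_nhds.2.2]
    simp⟩
  map_add _ _ := by rw [map_add, Pi.add_apply]

lemma Hom.closedHom_inclusion (k p q : ℕ) :
    (φ.closedHom k p q).sheafHom ≫ (GermSheaf.inclusion (𝓔'.closedSheaf_le k p q)).sheafHom =
      (GermSheaf.inclusion (𝓔.closedSheaf_le k p q)).sheafHom ≫ (φ.smoothHom k p q).sheafHom := by
  exact GermSheaf.sheafHom_comp_eq fun _ => rfl

lemma Hom.smoothHom_dbarHom {k p q : ℕ} (hpq : p + q = k) :
    (φ.smoothHom k p q).sheafHom ≫ (𝓔'.dbarHom hpq).sheafHom =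
      (𝓔.dbarHom hpq).sheafHom ≫ (φ.closedHom (k + 1) p (q + 1)).sheafHom := by
  exact GermSheaf.sheafHom_comp_eq fun h => φ.dbar_form_at h.self_of_nhds.1

variable (𝓔) in
/-- Holomorphic forms as closed smooth forms. -/
def omegaIncl (p : ℕ) : 𝓔.omegaSheaf p ⟶ (𝓔.closedSheaf p p 0).sheaf where
  hom :=
    { app U := AddCommGrpCat.ofHom
        { toFun s := ⟨fun x => (s.1 x).restrictScalars ℝ, fun x hx =>
            ⟨SmoothAt.of_analyticAt (s.2 x hx), by
              rw [GermSheaf.ext0_of_mem _ hx]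
              exact ofType_restrictScalars _, dbar_eq_zero_of_analyticAt (s.2 x hx)⟩⟩
          map_zero' := rfl
          map_add' _ _ := rfl }
      naturality _ _ _ := rfl }

/-- For surjectivity, type (p, 0) makes each value complex multilinear, and ∂̄-closedness makes the
local expressions analytic. -/
lemma omegaIncl_bijective (p : ℕ) (U : (Opens (TopCat.of X))ᵒᵖ) :
    Function.Bijective ((𝓔.omegaIncl p).hom.app U) := by
  constructor
  · intro s t h
    refine Subtype.ext (funext fun x => ?_)
    have h1 := congrFun (congrArg Subtype.val h) x
    ext m
    exact congrArg (fun η : V [⋀^Fin p]→L[ℝ] 𝓔.E x => η m) h1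
  · intro (t : (𝓔.closedSheaf p p 0).sections ((unop U : Opens (TopCat.of X)) : Set X))
    have h (x : (unop U : Opens (TopCat.of X))) : OfType (t.1 x) p 0 := by
      have h1 := (t.2 x x.2).2.1
      rwa [GermSheaf.ext0_of_mem _ x.2] at h1
    choose s hs using fun x => exists_restrictScalars_eq (h x)
    have hst : 𝓔.extendZero (U := ((unop U : Opens (TopCat.of X)) : Set X)) s =
        GermSheaf.ext0 t.1 := by
      funext y
      by_cases hy : y ∈ ((unop U : Opens (TopCat.of X)) : Set X)
      · rw [GermSheaf.ext0_of_mem _ hy, ← hs]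
        simp only [extendZero, hy, dite_true]
      · simp [extendZero, GermSheaf.ext0, hy]
    refine ⟨⟨s, fun x hx => ?_⟩, Subtype.ext (funext hs)⟩
    have h2 := GermSheaf.good_ext0 (F := 𝓔.closedSheaf p p 0) (unop U).isOpen t hx
    rw [hst]
    exact analyticAt_localRep (h2.mono fun _ h => h.1) (h2.mono fun _ h => h.2.2)
      (h2.mono fun _ h => h.2.1)

instance isIso_omegaIncl (p : ℕ) : IsIso (𝓔.omegaIncl p) := by
  have h1 : ∀ U, IsIso ((𝓔.omegaIncl p).hom.app U) := fun U =>
    (ConcreteCategory.isIso_iff_bijective _).2 (omegaIncl_bijective p U)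
  have h2 : IsIso ((sheafToPresheaf _ _).map (𝓔.omegaIncl p)) :=
    (NatTrans.isIso_iff_isIso_app _).2 h1
  exact isIso_of_reflects_iso _ (sheafToPresheaf _ _)

lemma Hom.omegaMap_incl (p : ℕ) :
    φ.omegaMap p ≫ 𝓔'.omegaIncl p = 𝓔.omegaIncl p ≫ (φ.closedHom p p 0).sheafHom := by
  ext U s
  refine Subtype.ext (funext fun x => ?_)
  have hx : (x : X) ∈ ((unop U : Opens (TopCat.of X)) : Set X) := x.2
  ext m
  change φ.map x ((show 𝓔.holomorphicForms p _ from s).1 x m) =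
    φ.map x (𝓔.extendZero (show 𝓔.holomorphicForms p _ from s).1 x m)
  have hx' : (x : X) ∈ (unop U : Opens (TopCat.of X)) := x.2
  simp only [extendZero]
  rw [dif_pos hx]
  rfl

variable (𝓔) in
/-- Multiplication by a complex number as a morphism of bundles. -/
def scalarHom (c : ℂ) : Hom 𝓔 𝓔 where
  map x := c • ContinuousLinearMap.id ℂ (𝓔.E x)
  analyticAt x₀ := by
    refine (analyticAt_const (v := c • ContinuousLinearMap.id ℂ 𝓔.F)).congr ?_
    filter_upwards [eventually_chart_symm (mem_chart_source V x₀)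
      (𝓔.domain_mem_nhds (𝓔.mem_domain x₀))] with z hz
    ext w
    rw [homRep_apply]
    simp only [_root_.smul_apply, ContinuousLinearMap.id_apply, map_smul]
    rw [Trivialization.continuousLinearMapAt_symmL _ hz.2]

/-- Scalar multiplication on cohomology is induced by a morphism of bundles, so linearity over ℂ is
a case of naturality. -/
lemma omegaMap_scalarHom (p : ℕ) (c : ℂ) : (𝓔.scalarHom c).omegaMap p = 𝓔.omegaSmul p c := by
  ext U s
  rfl

lemma form_scalarHom (k : ℕ) (c : ℂ) (η : 𝓔.Form k) : (𝓔.scalarHom c).form k η = c • η := by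
  ext x m
  simp [Hom.form_apply, scalarHom]

end HolomorphicVectorBundle

end FormSheaves

end

noncomputable section

/-! ### The Dolbeault isomorphism -/

section Dolbeault

variable {V X : Type u} [NormedAddCommGroup V] [NormedSpace ℂ V]
  [TopologicalSpace X] [ChartedSpace V X] [IsManifold 𝓘(ℂ, V) ω X] [FiniteDimensional ℂ V]

namespace HolomorphicVectorBundle

open CategoryTheory Opposite TopologicalSpace

variable (𝓔 : HolomorphicVectorBundle V X)

/-- The iterated connecting homomorphism `H^n(Z^{p,q}) → H^{n+q}(Z^{p,0})`, where `Z^{p,q}` is the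
sheaf of `∂̄`-closed forms of type `(p, q)`. -/
def shift (p : ℕ) : ∀ q n m : ℕ, m = n + q →
    (Sheaf.H.{u} (𝓔.closedSheaf (p + q) p q).sheaf n →+ Sheaf.H.{u} (𝓔.closedSheaf p p 0).sheaf m)
  | 0, n, _, rfl => AddMonoidHom.id (Sheaf.H.{u} (𝓔.closedSheaf p p 0).sheaf n)
  | q + 1, n, m, h => (shift p q (n + 1) m (by omega)).comp
      ((𝓔.isKernel_dbarHom (rfl : p + q = p + q)).δ n)

lemma shift_zero (p n : ℕ) (x : Sheaf.H.{u} (𝓔.closedSheaf p p 0).sheaf n) :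
    𝓔.shift p 0 n n rfl x = x := rfl

lemma shift_succ (p q n m : ℕ) (h : m = n + (q + 1))
    (x : Sheaf.H.{u} (𝓔.closedSheaf (p + (q + 1)) p (q + 1)).sheaf n) :
    𝓔.shift p (q + 1) n m h x =
      𝓔.shift p q (n + 1) m (by omega) ((𝓔.isKernel_dbarHom (rfl : p + q = p + q)).δ n x) := rfl

variable {𝓔} in
lemma Hom.shift_naturality {𝓔' : HolomorphicVectorBundle V X} (φ : Hom 𝓔 𝓔') (p : ℕ) :
    ∀ (q n m : ℕ) (h : m = n + q) (x : Sheaf.H.{u} (𝓔.closedSheaf (p + q) p q).sheaf n),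
      𝓔'.shift p q n m h (Sheaf.H.map (φ.closedHom (p + q) p q).sheafHom n x) =
        Sheaf.H.map (φ.closedHom p p 0).sheafHom m (𝓔.shift p q n m h x)
  | 0, _, _, rfl, _ => rfl
  | q + 1, n, m, h, x => by
    rw [shift_succ, shift_succ, ← shift_naturality φ p q]
    congr 1
    exact GermSheaf.IsKernel.δ_naturality _ _ _ _ _ (φ.closedHom_inclusion _ _ _)
      (φ.smoothHom_dbarHom rfl) n x

section Vanishing

variable [T2Space X] [SigmaCompactSpace X]

lemma subsingleton_H_smoothSheaf (k p q n : ℕ) :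
    Subsingleton (Sheaf.H.{u} (𝓔.smoothSheaf k p q).sheaf (n + 1)) :=
  (𝓔.isFine_smoothSheaf k p q).subsingleton_H hasPartitions_smoothFunctions n

lemma shift_surjective (p : ℕ) : ∀ (q n m : ℕ) (h : m = n + q),
    Function.Surjective (𝓔.shift p q n m h)
  | 0, _, _, rfl => Function.surjective_id
  | q + 1, n, m, h => (shift_surjective p q (n + 1) m (by omega)).comp
      (GermSheaf.IsKernel.δ_surjective _ n (𝓔.subsingleton_H_smoothSheaf _ _ _ _))

/-- Injectivity starts in positive degree: from degree 0 the first connecting map kills the ∂̄-exact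
forms, since A^{p,q} has global sections. -/
lemma shift_injective (p : ℕ) : ∀ (q n m : ℕ) (h : m = n + 1 + q),
    Function.Injective (𝓔.shift p q (n + 1) m h)
  | 0, _, _, rfl => Function.injective_id
  | q + 1, n, m, h => (shift_injective p q (n + 1) m (by omega)).comp
      (GermSheaf.IsKernel.δ_injective _ (n + 1) (𝓔.subsingleton_H_smoothSheaf _ _ _ _))

end Vanishing

/-- The identification of the cohomology of the sheaf of holomorphic forms with that of the
sheaf of closed smooth forms of type `(p, 0)`. -/
def sheafHEquiv (p j : ℕ) : 𝓔.SheafH p j ≃+ Sheaf.H.{u} (𝓔.closedSheaf p p 0).sheaf j where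
  toFun := Sheaf.H.map (𝓔.omegaIncl p) j
  invFun := Sheaf.H.map (inv (𝓔.omegaIncl p)) j
  left_inv a := by
    have h := Sheaf.H.map_comp_apply (𝓔.omegaIncl p) (inv (𝓔.omegaIncl p)) (n := j) a
    rw [IsIso.hom_inv_id] at h
    exact h.symm.trans (Sheaf.H.map_id_apply a)
  right_inv a := by
    have h := Sheaf.H.map_comp_apply (inv (𝓔.omegaIncl p)) (𝓔.omegaIncl p) (n := j) a
    rw [IsIso.inv_hom_id] at h
    exact h.symm.trans (Sheaf.H.map_id_apply a)
  map_add' a b := map_add (Sheaf.H.map (𝓔.omegaIncl p) j) a b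

variable {𝓔} in
lemma Hom.sheafHEquiv_naturality {𝓔' : HolomorphicVectorBundle V X} (φ : Hom 𝓔 𝓔') (p j : ℕ)
    (a : 𝓔.SheafH p j) : 𝓔'.sheafHEquiv p j (φ.sheafH p j a) =
      Sheaf.H.map (φ.closedHom p p 0).sheafHom j (𝓔.sheafHEquiv p j a) := by
  have h1 := Sheaf.H.map_comp_apply (φ.omegaMap p) (𝓔'.omegaIncl p) (n := j) a
  have h2 := Sheaf.H.map_comp_apply (𝓔.omegaIncl p) (φ.closedHom p p 0).sheafHom (n := j) a
  rw [φ.omegaMap_incl p] at h1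
  exact h1.symm.trans h2

/-- The Dolbeault class of a closed form of type `(p, q)`, for `k = p + q`. -/
def dolbeaultClass {k p q : ℕ} (h : p + q = k) :
    (𝓔.closedSheaf k p q).global →+ 𝓔.SheafH p q := by
  subst h
  exact ((𝓔.sheafHEquiv p q).symm.toAddMonoidHom.comp (𝓔.shift p q 0 q (by omega))).comp
    (𝓔.closedSheaf (p + q) p q).H0.symm.toAddMonoidHom

lemma dolbeaultClass_rfl {p q : ℕ} (s : (𝓔.closedSheaf (p + q) p q).global) :
    𝓔.dolbeaultClass rfl s = (𝓔.sheafHEquiv p q).symm (𝓔.shift p q 0 q (by omega)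
      ((𝓔.closedSheaf (p + q) p q).H0.symm s)) := rfl

/-- For q = 0 no connecting map is involved, and H^0 is the space of global sections itself. -/
lemma dolbeaultClass_eq_zero_iff_of_zero {k p : ℕ} (h : p + 0 = k)
    (s : (𝓔.closedSheaf k p 0).global) : 𝓔.dolbeaultClass h s = 0 ↔ s.1 = 0 := by
  subst h
  rw [dolbeaultClass_rfl, EmbeddingLike.map_eq_zero_iff, shift_zero]
  rw [EmbeddingLike.map_eq_zero_iff]
  exact Subtype.ext_iff

variable {𝓔} in
lemma Hom.dolbeaultClass_naturality {𝓔' : HolomorphicVectorBundle V X} (φ : Hom 𝓔 𝓔') {k p q : ℕ}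
    (h : p + q = k) (s : (𝓔.closedSheaf k p q).global) (s' : (𝓔'.closedSheaf k p q).global)
    (hs : s'.1 = φ.form k s.1) :
    𝓔'.dolbeaultClass h s' = φ.sheafH p q (𝓔.dolbeaultClass h s) := by
  subst h
  apply (𝓔'.sheafHEquiv p q).injective
  rw [φ.sheafHEquiv_naturality, dolbeaultClass_rfl, dolbeaultClass_rfl, AddEquiv.apply_symm_apply,
    AddEquiv.apply_symm_apply, ← φ.shift_naturality]
  congr 1
  apply (𝓔'.closedSheaf (p + q) p q).H0.injective
  refine Subtype.ext ?_
  rw [GermSheaf.H0_map, AddEquiv.apply_symm_apply, AddEquiv.apply_symm_apply, hs]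
  rfl

lemma dolbeaultClass_smul {k p q : ℕ} (h : p + q = k) (c : ℂ) (s s' : (𝓔.closedSheaf k p q).global)
    (hs : s'.1 = c • s.1) : 𝓔.dolbeaultClass h s' = c • 𝓔.dolbeaultClass h s := by
  rw [(𝓔.scalarHom c).dolbeaultClass_naturality h s s' (by rw [form_scalarHom, hs]),
    sheafH_smul_def, ← omegaMap_scalarHom]
  rfl

variable [T2Space X] [SigmaCompactSpace X]

/-- Only the first connecting map H^0 → H^1 has a kernel, described by `δ_H0_eq_zero_iff`; the later
ones are injective. -/
lemma dolbeaultClass_eq_zero_iff_of_succ {k p q : ℕ} (h : p + q = k)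
    (s : (𝓔.closedSheaf (k + 1) p (q + 1)).global) :
    𝓔.dolbeaultClass (p := p) (q := q + 1) (by omega) s = 0 ↔
      ∃ t ∈ (𝓔.smoothSheaf k p q).global, 𝓔.dbar t = s.1 := by
  subst h
  have h1 := 𝓔.dolbeaultClass_rfl (p := p) (q := q + 1) s
  rw [h1, EmbeddingLike.map_eq_zero_iff, shift_succ,
    map_eq_zero_iff _ (𝓔.shift_injective p q 0 (q + 1) (by omega)),
    GermSheaf.IsKernel.δ_H0_eq_zero_iff]
  erw [AddEquiv.apply_symm_apply]
  rfl

lemma dolbeaultClass_surjective {k p q : ℕ} (h : p + q = k) :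
    Function.Surjective (𝓔.dolbeaultClass h) := by
  subst h
  exact ((𝓔.sheafHEquiv p q).symm.surjective.comp (𝓔.shift_surjective p q 0 q (by omega))).comp
    (𝓔.closedSheaf (p + q) p q).H0.symm.surjective

end HolomorphicVectorBundle

end Dolbeault

end

noncomputable section

/-! ### Dolbeault cohomology and sheaf cohomology -/

section Decomposition

variable {V X : Type u} [NormedAddCommGroup V] [NormedSpace ℂ V]
  [TopologicalSpace X] [ChartedSpace V X] [IsManifold 𝓘(ℂ, V) ω X]

namespace HolomorphicVectorBundle

variable (𝓔 : HolomorphicVectorBundle V X)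

/-- The component of type `(k - q, q)` of a form. -/
def formProj (k q : ℕ) : 𝓔.Form k →ₗ[ℂ] 𝓔.Form k where
  toFun η x := typeProj k q (η x)
  map_add' _ _ := funext fun _ => map_add _ _ _
  map_smul' c η := funext fun x => (typeProj k q).map_smul c (η x)

lemma formProj_apply {k : ℕ} (q : ℕ) (η : 𝓔.Form k) (x : X) :
    𝓔.formProj k q η x = typeProj k q (η x) := rfl

lemma sum_formProj {k : ℕ} (η : 𝓔.Form k) :
    ∑ q ∈ Finset.range (k + 1), 𝓔.formProj k q η = η := by
  funext x
  rw [Finset.sum_apply]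
  exact sum_typeProj (η x)

lemma formProj_of_ofType {k : ℕ} {η : 𝓔.Form k} {p q : ℕ} (h : ∀ x, OfType (η x) p q)
    (hpq : p + q = k) {q' : ℕ} (hq' : q' ≤ k) :
    𝓔.formProj k q' η = if q' = q then η else 0 := by
  funext x
  rw [formProj_apply, (h x).typeProj_eq hpq hq']
  split_ifs <;> rfl

lemma localRep_formProj {k : ℕ} (q : ℕ) (η : 𝓔.Form k) (x : X) :
    𝓔.localRep (𝓔.formProj k q η) x = fun z => typeProj k q (𝓔.localRep η x z) := by
  funext z
  simp only [localRep]
  rw [typeProj_comp, typeProj_pullback]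
  rfl

variable {𝓔}

lemma IsSmooth.formProj {k : ℕ} {η : 𝓔.Form k} (h : 𝓔.IsSmooth η) (q : ℕ) :
    𝓔.IsSmooth (𝓔.formProj k q η) := fun x => by
  rw [localRep_formProj]
  exact ((typeProjC (V := V) (W := 𝓔.F) k q).restrictScalars ℝ).contDiff.contDiffAt.comp _ (h x)

lemma dbar_formProj {k : ℕ} {η : 𝓔.Form k} (h : 𝓔.IsSmooth η) {q : ℕ} (hq : q ≤ k) :
    𝓔.dbar (𝓔.formProj k q η) = 𝓔.formProj (k + 1) (q + 1) (𝓔.dbar η) := by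
  funext x
  rw [formProj_apply, dbar, dbar, localRep_formProj, typeProj_comp,
    typeProj_dbarFlat ((h x).differentiableAt (by simp)) hq]

lemma formProj_zero_dbar {k : ℕ} {η : 𝓔.Form k} (h : 𝓔.IsSmooth η) :
    𝓔.formProj (k + 1) 0 (𝓔.dbar η) = 0 := by
  funext x
  rw [formProj_apply, dbar, typeProj_comp,
    typeProj_zero_dbarFlat ((h x).differentiableAt (by simp))]
  ext m
  simp

lemma Hom.form_formProj {𝓔' : HolomorphicVectorBundle V X} (φ : Hom 𝓔 𝓔') {k : ℕ} (q : ℕ)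
    (η : 𝓔.Form k) : 𝓔'.formProj k q (φ.form k η) = φ.form k (𝓔.formProj k q η) :=
  funext fun x => typeProj_comp q (φ.map x) (η x)

lemma dbar_zero {k : ℕ} : 𝓔.dbar (0 : 𝓔.Form k) = 0 := by
  simpa using 𝓔.dbar_smul 0 (0 : 𝓔.Form k)

lemma dbar_sum {k : ℕ} {ι : Type*} (s : Finset ι) (η : ι → 𝓔.Form k)
    (h : ∀ i ∈ s, 𝓔.IsSmooth (η i)) : 𝓔.dbar (∑ i ∈ s, η i) = ∑ i ∈ s, 𝓔.dbar (η i) := by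
  classical
  induction s using Finset.induction_on with
  | empty => simp [dbar_zero]
  | insert a s ha ih =>
    rw [Finset.sum_insert ha, Finset.sum_insert ha, dbar_add _ (h a (by simp))
      ((𝓔.A k).sum_mem fun i hi => h i (by simp [hi])), ih fun i hi => h i (by simp [hi])]

variable (𝓔)

/-- The `∂̄`-closed smooth forms. -/
def dbarClosed (k : ℕ) : Submodule ℂ (𝓔.Form k) where
  carrier := {η | 𝓔.IsSmooth η ∧ 𝓔.dbar η = 0}
  add_mem' h h' := ⟨(𝓔.A k).add_mem h.1 h'.1, by rw [dbar_add _ h.1 h'.1, h.2, h'.2, add_zero]⟩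
  zero_mem' := ⟨(𝓔.A k).zero_mem, dbar_zero⟩
  smul_mem' c _ h := ⟨(𝓔.A k).smul_mem c h.1, by rw [dbar_smul, h.2, smul_zero]⟩

variable [FiniteDimensional ℂ V]

lemma formProj_mem_global {k q : ℕ} (hq : q ≤ k) {η : 𝓔.Form k} (h : η ∈ 𝓔.dbarClosed k) :
    𝓔.formProj k q η ∈ (𝓔.closedSheaf k (k - q) q).global := fun x =>
  ⟨h.1.formProj q x, ofType_typeProj (η x) hq, by rw [dbar_formProj h.1 hq, h.2, map_zero]; rfl⟩

lemma mem_dbarClosed_of_global {k p q : ℕ} {η : 𝓔.Form k}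
    (h : η ∈ (𝓔.closedSheaf k p q).global) : η ∈ 𝓔.dbarClosed k :=
  ⟨fun x => (h x).1, funext fun x => (h x).2.2⟩

/-- The Dolbeault class of the component of type `(k - q, q)` of a closed form. -/
def typeClass {k q : ℕ} (hq : q ≤ k) : 𝓔.dbarClosed k →ₗ[ℂ] 𝓔.SheafH (k - q) q where
  toFun η := 𝓔.dolbeaultClass (Nat.sub_add_cancel hq)
    ⟨𝓔.formProj k q η.1, 𝓔.formProj_mem_global hq η.2⟩
  map_add' η η' := by
    rw [← map_add]
    exact congrArg _ (Subtype.ext (map_add _ _ _))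
  map_smul' c η := 𝓔.dolbeaultClass_smul _ c _ _ (map_smul _ _ _)

lemma typeClass_apply {k q : ℕ} (hq : q ≤ k) (η : 𝓔.dbarClosed k) :
    𝓔.typeClass hq η = 𝓔.dolbeaultClass (Nat.sub_add_cancel hq)
      ⟨𝓔.formProj k q η.1, 𝓔.formProj_mem_global hq η.2⟩ := rfl

lemma typeClass_zero_eq_zero_iff {k : ℕ} (η : 𝓔.dbarClosed k) :
    𝓔.typeClass (Nat.zero_le k) η = 0 ↔ 𝓔.formProj k 0 η.1 = 0 :=
  𝓔.dolbeaultClass_eq_zero_iff_of_zero (Nat.sub_add_cancel (Nat.zero_le k))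
    ⟨𝓔.formProj k 0 η.1, 𝓔.formProj_mem_global (Nat.zero_le k) η.2⟩

variable {𝓔} in
lemma Hom.typeClass_naturality {𝓔' : HolomorphicVectorBundle V X} (φ : Hom 𝓔 𝓔') {k q : ℕ}
    (hq : q ≤ k) (η : 𝓔.dbarClosed k) (η' : 𝓔'.dbarClosed k) (h : η'.1 = φ.form k η.1) :
    𝓔'.typeClass hq η' = φ.sheafH (k - q) q (𝓔.typeClass hq η) :=
  φ.dolbeaultClass_naturality _ _ _ ((congrArg (𝓔'.formProj k q) h).trans (φ.form_formProj q η.1))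

lemma typeClass_eq_zero_of_ofType {k p q : ℕ} (hpq : p + q = k) (η : 𝓔.dbarClosed k)
    (h : ∀ x, OfType (η.1 x) p q) {l : ℕ} (hl : l ≤ k) (hlq : l ≠ q) : 𝓔.typeClass hl η = 0 := by
  rw [typeClass_apply, ← map_zero (𝓔.dolbeaultClass (Nat.sub_add_cancel hl))]
  congr 1
  refine Subtype.ext ?_
  change 𝓔.formProj k l η.1 = 0
  rw [𝓔.formProj_of_ofType h hpq hl, if_neg hlq]

/-- The Dolbeault classes of all the components of a closed form. -/
def dolbeaultMap (k : ℕ) : 𝓔.dbarClosed k →ₗ[ℂ] ∀ q : Fin (k + 1), 𝓔.SheafH (k - q) q :=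
  LinearMap.pi fun q => 𝓔.typeClass (Nat.lt_succ_iff.1 q.2)

lemma dolbeaultMap_apply (k : ℕ) (η : 𝓔.dbarClosed k) (q : Fin (k + 1)) :
    𝓔.dolbeaultMap k η q = 𝓔.typeClass (Nat.lt_succ_iff.1 q.2) η := rfl

lemma dolbeaultMap_eq_zero_iff_forall (k : ℕ) (η : 𝓔.dbarClosed k) :
    𝓔.dolbeaultMap k η = 0 ↔ ∀ q, ∀ hq : q ≤ k, 𝓔.typeClass hq η = 0 :=
  ⟨fun h q hq => congrFun h ⟨q, Nat.lt_succ_iff.2 hq⟩, fun h => funext fun q => h q (Nat.lt_succ_iff.1 q.2)⟩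

lemma dolbeaultMap_zero_eq_zero_iff (η : 𝓔.dbarClosed 0) :
    𝓔.dolbeaultMap 0 η = 0 ↔ η.1 = 0 := by
  rw [dolbeaultMap_eq_zero_iff_forall]
  have h := 𝓔.sum_formProj η.1
  rw [zero_add, Finset.sum_range_one] at h
  constructor
  · intro h0
    rw [← h]
    exact (𝓔.typeClass_zero_eq_zero_iff η).1 (h0 0 le_rfl)
  · intro h0 q hq
    have : η = 0 := Subtype.ext h0
    rw [this, map_zero]

variable [T2Space X] [SigmaCompactSpace X]

lemma typeClass_succ_eq_zero_iff {k q : ℕ} (hq : q ≤ k) (η : 𝓔.dbarClosed (k + 1)) :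
    𝓔.typeClass (Nat.succ_le_succ hq) η = 0 ↔
      ∃ t ∈ (𝓔.smoothSheaf k (k + 1 - (q + 1)) q).global,
        𝓔.dbar t = 𝓔.formProj (k + 1) (q + 1) η.1 :=
  𝓔.dolbeaultClass_eq_zero_iff_of_succ (by omega) _

/-- A primitive of η is the sum of primitives of its components; conversely the components of a
primitive of η are primitives of the components of η, with a shift of q by one. The component of
type (k + 1, 0) has no primitive to speak of and must vanish. -/
lemma dolbeaultMap_succ_eq_zero_iff (k : ℕ) (η : 𝓔.dbarClosed (k + 1)) :
    𝓔.dolbeaultMap (k + 1) η = 0 ↔ ∃ ζ : 𝓔.Form k, 𝓔.IsSmooth ζ ∧ 𝓔.dbar ζ = η.1 := by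
  rw [dolbeaultMap_eq_zero_iff_forall]
  constructor
  · intro h
    have h' : ∀ q : Fin (k + 1), ∃ t : 𝓔.Form k, 𝓔.IsSmooth t ∧
        𝓔.dbar t = 𝓔.formProj (k + 1) (q + 1) η.1 := fun q => by
      obtain ⟨t, ht, ht'⟩ := (𝓔.typeClass_succ_eq_zero_iff (Nat.lt_succ_iff.1 q.2) η).1 (h _ _)
      exact ⟨t, fun x => (ht x).1, ht'⟩
    choose t ht ht' using h'
    refine ⟨∑ q, t q, (𝓔.A k).sum_mem fun q _ => ht q, ?_⟩
    rw [dbar_sum _ _ fun q _ => ht q]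
    simp only [ht']
    have h1 := 𝓔.sum_formProj η.1
    rw [Finset.sum_range_succ', (𝓔.typeClass_zero_eq_zero_iff η).1 (h _ _), add_zero,
      Finset.sum_range] at h1
    exact h1
  · rintro ⟨ζ, hζ, hη⟩ q hq
    cases q with
    | zero => rw [typeClass_zero_eq_zero_iff, ← hη, formProj_zero_dbar hζ]
    | succ q =>
      have hq' : q ≤ k := Nat.le_of_succ_le_succ hq
      refine (𝓔.typeClass_succ_eq_zero_iff hq' η).2
        ⟨𝓔.formProj k q ζ, fun x => ⟨hζ.formProj q x, ?_⟩, ?_⟩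
      · have h := ofType_typeProj (ζ x) hq'
        rwa [← Nat.add_sub_add_right k 1 q] at h
      · rw [dbar_formProj hζ hq', hη]

lemma dolbeaultMap_surjective (k : ℕ) : Function.Surjective (𝓔.dolbeaultMap k) := by
  intro a
  choose s hs using fun q : Fin (k + 1) =>
    𝓔.dolbeaultClass_surjective (Nat.sub_add_cancel (Nat.lt_succ_iff.1 q.2)) (a q)
  -- Represent each class by a closed form of pure type and add; the projection to one type recovers
  -- the corresponding summand.
  refine ⟨⟨∑ q, (s q).1, Submodule.sum_mem _ fun q _ => 𝓔.mem_dbarClosed_of_global (s q).2⟩,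
    funext fun q => ?_⟩
  rw [← hs q, dolbeaultMap_apply, typeClass_apply]
  congr 1
  refine Subtype.ext ?_
  change 𝓔.formProj k q (∑ q, (s q).1) = (s q).1
  have h (q' : Fin (k + 1)) := 𝓔.formProj_of_ofType (fun x => ((s q').2 x).2.1)
    (Nat.sub_add_cancel (Nat.lt_succ_iff.1 q'.2)) (Nat.lt_succ_iff.1 q.2)
  rw [map_sum, Finset.sum_eq_single q]
  · rw [h, if_pos rfl]
  · intro q' _ hne
    rw [h, if_neg fun he => hne (Fin.ext he.symm)]
  · simp

end HolomorphicVectorBundle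

/-! ### Higgs bundles with vanishing Higgs field and the unitary case -/

namespace HiggsBundle

variable (𝓗 : HiggsBundle V X)

lemma D''_apply_of_theta_eq_zero (h : 𝓗.θ = 0) {k : ℕ} (η : 𝓗.bundle.A k) :
    𝓗.D'' k η = 𝓗.bundle.dbar η.1 := by
  funext x
  ext m
  change 𝓗.bundle.dbar η.1 x m + 𝓗.thetaWedge η.1 x m = _
  simp [thetaWedge_apply, h]

/-- If the Higgs field vanishes, the `D''`-closed forms are the `∂̄`-closed forms. -/
def closedToDbarClosed (h : 𝓗.θ = 0) (k : ℕ) : 𝓗.closedForms k →ₗ[ℂ] 𝓗.bundle.dbarClosed k where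
  toFun η := ⟨η.1.1, η.1.2, by
    rw [← 𝓗.D''_apply_of_theta_eq_zero h]
    exact LinearMap.mem_ker.1 η.2⟩
  map_add' _ _ := rfl
  map_smul' _ _ := rfl

lemma closedToDbarClosed_surjective (h : 𝓗.θ = 0) (k : ℕ) :
    Function.Surjective (𝓗.closedToDbarClosed h k) := fun η =>
  ⟨⟨⟨η.1, η.2.1⟩, LinearMap.mem_ker.2 (by rw [𝓗.D''_apply_of_theta_eq_zero h]; exact η.2.2)⟩, rfl⟩

variable [FiniteDimensional ℂ V]

/-- The map that induces the Dolbeault isomorphism. -/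
def classMap (h : 𝓗.θ = 0) (k : ℕ) :
    𝓗.closedForms k →ₗ[ℂ] ∀ q : Fin (k + 1), 𝓗.bundle.SheafH (k - q) q :=
  𝓗.bundle.dolbeaultMap k ∘ₗ 𝓗.closedToDbarClosed h k

variable [T2Space X] [SigmaCompactSpace X]

/-- Degree 0 is separate: there are no exact forms, and the class of a closed section is the
section. -/
lemma ker_classMap (h : 𝓗.θ = 0) (k : ℕ) :
    (𝓗.exactForms k).comap ((𝓗.bundle.A k).subtype ∘ₗ (𝓗.closedForms k).subtype) =
      LinearMap.ker (𝓗.classMap h k) := by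
  ext η
  rw [LinearMap.mem_ker]
  cases k with
  | zero => exact (𝓗.bundle.dolbeaultMap_zero_eq_zero_iff (𝓗.closedToDbarClosed h 0 η)).symm
  | succ k =>
    refine Iff.trans ?_
      (𝓗.bundle.dolbeaultMap_succ_eq_zero_iff k (𝓗.closedToDbarClosed h (k + 1) η)).symm
    constructor
    · rintro ⟨ζ, hζ⟩
      exact ⟨ζ.1, ζ.2, by rw [← 𝓗.D''_apply_of_theta_eq_zero h]; exact hζ⟩
    · rintro ⟨ζ, hs, hζ⟩
      exact ⟨⟨ζ, hs⟩, by rw [𝓗.D''_apply_of_theta_eq_zero h]; exact hζ⟩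

/-- The Dolbeault isomorphism. -/
def dolbeaultEquiv (h : 𝓗.θ = 0) (k : ℕ) :
    𝓗.DolbeaultH k ≃ₗ[ℂ] ∀ q : Fin (k + 1), 𝓗.bundle.SheafH (k - q) q :=
  (Submodule.quotEquivOfEq _ _ (𝓗.ker_classMap h k)).trans
    ((𝓗.classMap h k).quotKerEquivOfSurjective
      ((𝓗.bundle.dolbeaultMap_surjective k).comp (𝓗.closedToDbarClosed_surjective h k)))

variable {𝓗}

/-- θ + θ* = D - ∇ is a difference of unitary connections, so it is skew; being also self-adjoint it
vanishes, which makes each θ(v) skew. Complex linearity in v excludes this unless θ = 0. -/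
lemma IsAssociatedTo.theta_eq_zero {D : 𝓗.bundle.Connection} {m : 𝓗.bundle.HermitianMetric}
    (h : 𝓗.IsAssociatedTo D m) (hD : D.IsUnitary m) : 𝓗.θ = 0 := by
  obtain ⟨hflat, nabla, θs, hn, -, hadj, hdec⟩ := h
  have hadj' (x : X) (v : V) (e e' : 𝓗.bundle.E x) :
      m.inner x e (θs x v e') = m.inner x (𝓗.θ x v e) e' := by
    rw [← m.conj_symm, hadj, m.conj_symm]
  have hskew (x : X) (v : V) (e e' : 𝓗.bundle.E x) :
      m.inner x (𝓗.θ x v e) e' + m.inner x e (𝓗.θ x v e') = 0 := by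
    -- Flatness provides global smooth sections through the prescribed vectors; that they are
    -- parallel nearby plays no role.
    obtain ⟨s, rfl, -⟩ := hflat x e
    obtain ⟨t, rfl, -⟩ := hflat x e'
    have h1 := (hD s t x v).symm.trans (hn s t x v)
    simp only [hdec, map_add, LinearMap.add_apply, hadj, hadj'] at h1
    linear_combination (1 / 2 : ℂ) * h1
  funext x
  ext v e
  by_contra hne
  have h1 := hskew x v e (𝓗.θ x v e)
  -- Replacing v by iv reverses the relative sign of the two terms, because the metric is conjugate
  -- linear in its first argument. Both terms therefore vanish, and the vector θ(v)e has norm zero.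
  have h2 := hskew x (Complex.I • v) e (𝓗.θ x v e)
  simp only [map_smul, _root_.smul_apply, LinearMap.map_smulₛₗ, LinearMap.smul_apply,
    Complex.conj_I, smul_eq_mul, neg_mul] at h2
  have h3 : m.inner x (𝓗.θ x v e) (𝓗.θ x v e) = 0 := by
    linear_combination (1 / 2 : ℂ) * h1 + (Complex.I / 2) * h2 +
      (1 / 2 * m.inner x (𝓗.θ x v e) (𝓗.θ x v e)
        - 1 / 2 * m.inner x e (𝓗.θ x v (𝓗.θ x v e))) * Complex.I_mul_I
  have h4 := m.pos x _ hne
  rw [h3] at h4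
  exact lt_irrefl _ h4

end HiggsBundle

end Decomposition

end

/-! ### The decomposition theorem -/

theorem lemma3p4 {V X : Type u} [NormedAddCommGroup V] [NormedSpace ℂ V] [FiniteDimensional ℂ V]
    [TopologicalSpace X] [T2Space X] [SigmaCompactSpace X] [ChartedSpace V X]
    [IsManifold 𝓘(ℂ, V) ω X] :
    -- an isomorphism for every Higgs bundle with vanishing Higgs field and every degree
    ∃ Φ : ∀ 𝓗 : HiggsBundle V X, 𝓗.θ = 0 → ∀ i : ℕ,
        𝓗.DolbeaultH i ≃ₗ[ℂ] (∀ j : Fin (i + 1), 𝓗.bundle.SheafH (i - j) j),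
      -- natural with respect to morphisms of Higgs bundles
      (∀ (𝓗 𝓗' : HiggsBundle V X) (h : 𝓗.θ = 0) (h' : 𝓗'.θ = 0) (φ : HiggsBundle.Hom 𝓗 𝓗')
        (i : ℕ) (c : 𝓗.DolbeaultH i) (j : Fin (i + 1)),
        Φ 𝓗' h' i (φ.dolbeaultH i c) j = φ.toHom.sheafH (i - j) j (Φ 𝓗 h i c j)) ∧
      -- the summand with index `j` corresponds to the forms of type `(i - j, j)`
      (∀ (𝓗 : HiggsBundle V X) (h : 𝓗.θ = 0) (i : ℕ) (j : Fin (i + 1)) (η : 𝓗.closedForms i),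
        𝓗.bundle.IsOfType η.1.1 (i - j) j → ∀ l, l ≠ j → Φ 𝓗 h i (𝓗.classOf i η) l = 0) ∧
      -- the case of the Higgs bundle of a unitary flat bundle
      (∀ (𝓗 : HiggsBundle V X) (D : 𝓗.bundle.Connection) (m : 𝓗.bundle.HermitianMetric),
        𝓗.IsAssociatedTo D m → D.IsUnitary m →
        ∃ h : 𝓗.θ = 0,
          ∃ e : 𝓗.DolbeaultH 1 ≃ₗ[ℂ] 𝓗.bundle.SheafH 0 1 × 𝓗.bundle.SheafH 1 0,
            ∀ c, e c = (Φ 𝓗 h 1 c 1, Φ 𝓗 h 1 c 0)) := by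
  refine ⟨fun 𝓗 h i => 𝓗.dolbeaultEquiv h i, fun 𝓗 𝓗' h h' φ i c j => ?_,
    fun 𝓗 h i j η hη l hl => ?_, fun 𝓗 D m hA hD => ⟨hA.theta_eq_zero hD, ?_⟩⟩
  · obtain ⟨η, rfl⟩ := Submodule.mkQ_surjective _ c
    exact φ.toHom.typeClass_naturality (Nat.lt_succ_iff.1 j.2) (𝓗.closedToDbarClosed h i η)
      (𝓗'.closedToDbarClosed h' i (φ.closedMap i η)) rfl
  · exact 𝓗.bundle.typeClass_eq_zero_of_ofType (Nat.sub_add_cancel (Nat.lt_succ_iff.1 j.2))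
      (𝓗.closedToDbarClosed h i η) hη (Nat.lt_succ_iff.1 l.2) fun he => hl (Fin.ext he)
  -- The product over j lists the summand H^0(𝓔 ⊗ Ω^1) with j = 0 before H^1(𝓔) with j = 1, hence
  -- the exchange of factors.
  · exact ⟨((𝓗.dolbeaultEquiv (hA.theta_eq_zero hD) 1).trans
      (LinearEquiv.piFinTwo ℂ fun j : Fin 2 => 𝓗.bundle.SheafH (1 - j) j)).trans
        (LinearEquiv.prodComm ℂ _ _), fun c => rfl⟩
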